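/- Let $S=I^2$ with $I=(-\frac{\pi}{2},\frac{\pi}{2})$. For $h\in\mathbb{R}$ let $\lambda_{1,h}(S)\le\lambda_{2,h}(S)\le\dots$ be the eigenvalues, counted with multiplicity, of the Robin Laplacian on $S$ with parameter $h$, that is, of the problem $-\Delta u=\lambda u$ in $S$, $\frac{\partial u}{\partial\nu}+hu=0$ on $\partial S$, $u\in H^1(S)$ (understood weakly, through the form $\int_S\nabla u\cdot\nabla v+h\int_{\partial S}uv\,d\sigma$, for real-valued functions). The nodal domains of an eigenfunction $u$ are the connected components of $\{u\neq0\}\subset S$, and $\lambda_{k,h}(S)$ is called Courant-sharp if it has an eigenfunction with exactly $k$ nodal domains. Let $\lambda_{1,h}(I)<\lambda_{2,h}(I)<\dots$ be the (simple) eigenvalues of the Robin problem $-w''=\lambda w$ on $I$, $-w'(-\frac{\pi}{2})+hw(-\frac{\pi}{2})=0$, $w'(\frac{\pi}{2})+hw(\frac{\pi}{2})=0$. For integers $p,q\ge 0$, an eigenvalue $\lambda$ of $S$ is said to come from the pair $(p,q)$ if $\lambda=\lambda_{p+1,h}(I)+\lambda_{q+1,h}(I)$. There exists $h_9^*<0$,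 with $|h_9^*+1.6293|<5\cdot10^{-5}$, such that: (a) for every $h$ with $h_9^*\le h\le 0$, the eigenvalue $\lambda_{9,h}(S)$ comes from the pair $(2,2)$ and is Courant-sharp; moreover, whenever $u$ and $v$ are eigenfunctions of the Robin problem on $I$ for $\lambda_{3,h}(I)$, the product $(x,y)\mapsto u(x)v(y)$ is an eigenfunction for $\lambda_{9,h}(S)$ with exactly $9$ nodal domains; (b) for every $h<h_9^*$, the eigenvalue $\lambda_{9,h}(S)$ comes from the pair $(0,3)$ and, up to interchanging $p$ and $q$, from no other pair $(p,q)$; every (continuous) eigenfunction $u$ for $\lambda_{9,h}(S)$ satisfies $u(-x,-y)=-u(x,y)$ on $S$ and has a finite, even number of nodal domains; and $\lambda_{9,h}(S)$ is not Courant-sharp. -/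

import Mathlib

open MeasureTheory Set
open scoped ContDiff

noncomputable section

namespace RobinSquare

/-! ### The interval `I = (-π/2, π/2)` and the square `S = I × I` -/

/-- The open interval `I = (-π/2, π/2)`. -/
def interval : Set ℝ := Ioo (-(Real.pi / 2)) (Real.pi / 2)

/-- The open square `S = (-π/2, π/2)²`. -/
def square : Set (ℝ × ℝ) := interval ×ˢ interval

/-- Real `L²(I)`, used both for the factor `I` and for each side of the square. -/
abbrev L2I : Type := Lp ℝ 2 (volume.restrict interval)

/-- Real `L²(S)`. -/
abbrev L2S : Type := Lp ℝ 2 (volume.restrict square)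

/-! ### The Sobolev space `H¹(S)` with its traces -/

/-- An element of `H¹(S)`: a function `val ∈ L²(S)` together with its weak partial derivatives
`dx, dy ∈ L²(S)` and its traces on the four sides `x = π/2`, `x = -π/2`, `y = π/2`, `y = -π/2`,
each parametrised by arc length over `I`.  All of these are determined by `val` through
Green's formula against functions that are smooth up to the boundary: test functions with compact
support in `S` give the weak derivatives, and the others give the traces. -/
structure H1 where
  val : L2S
  dx : L2S
  dy : L2S
  traceRight : L2I
  traceLeft : L2I
  traceTop : L2I
  traceBottom : L2I
  green_x : ∀ φ : ℝ × ℝ → ℝ, ContDiff ℝ ∞ φ →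
    (∫ p in square, val p * fderiv ℝ φ p (1, 0)) + (∫ p in square, dx p * φ p) =
      (∫ t in interval, traceRight t * φ (Real.pi / 2, t)) -
        ∫ t in interval, traceLeft t * φ (-(Real.pi / 2), t)
  green_y : ∀ φ : ℝ × ℝ → ℝ, ContDiff ℝ ∞ φ →
    (∫ p in square, val p * fderiv ℝ φ p (0, 1)) + (∫ p in square, dy p * φ p) =
      (∫ t in interval, traceTop t * φ (t, Real.pi / 2)) -
        ∫ t in interval, traceBottom t * φ (t, -(Real.pi / 2))

/-- The boundary integral `∫_{∂S} u v dσ`. -/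
def bdryInner (U V : H1) : ℝ :=
  inner ℝ U.traceRight V.traceRight + inner ℝ U.traceLeft V.traceLeft +
    inner ℝ U.traceTop V.traceTop + inner ℝ U.traceBottom V.traceBottom

/-- The Robin form `∫_S ∇u · ∇v + h ∫_{∂S} u v dσ`. -/
def robinForm (h : ℝ) (U V : H1) : ℝ :=
  inner ℝ U.dx V.dx + inner ℝ U.dy V.dy + h * bdryInner U V

/-! ### Eigenvalues and eigenfunctions of the Robin Laplacian on `S` -/

/-- `u ∈ L²(S)` is a (nonzero) eigenfunction, with eigenvalue `μ`, of the Robin Laplacian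
`-Δu = μ u` in `S`, `∂u/∂ν + h u = 0` on `∂S`. -/
def IsEigenvector (h μ : ℝ) (u : L2S) : Prop :=
  u ≠ 0 ∧ ∃ U : H1, U.val = u ∧ ∀ V : H1, robinForm h U V = μ * inner ℝ U.val V.val

/-- The span of all eigenfunctions with eigenvalue `< μ`. -/
def spanLT (h μ : ℝ) : Submodule ℝ L2S :=
  Submodule.span ℝ {u | ∃ ν < μ, IsEigenvector h ν u}

/-- The span of all eigenfunctions with eigenvalue `≤ μ`. -/
def spanLE (h μ : ℝ) : Submodule ℝ L2S :=
  Submodule.span ℝ {u | ∃ ν ≤ μ, IsEigenvector h ν u}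

/-- `μ = λ_{k,h}(S)`, the `k`-th Robin eigenvalue of `S` (`k ≥ 1`), counted with multiplicity:
the eigenvalues `< μ` have total multiplicity less than `k`, and the eigenvalues `≤ μ` have total
multiplicity at least `k`. -/
def IsKthEigenvalue (h : ℝ) (k : ℕ) (μ : ℝ) : Prop :=
  Module.rank ℝ (spanLT h μ) < (k : Cardinal) ∧ (k : Cardinal) ≤ Module.rank ℝ (spanLE h μ)

/-- The `k`-th eigenvalue is unique. -/
theorem IsKthEigenvalue.unique {h : ℝ} {k : ℕ} {μ ν : ℝ} (hμ : IsKthEigenvalue h k μ)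
    (hν : IsKthEigenvalue h k ν) : μ = ν := by
  have key : ∀ a b : ℝ, IsKthEigenvalue h k a → IsKthEigenvalue h k b → ¬ a < b := by
    intro a b ha hb hab
    have hle : spanLE h a ≤ spanLT h b := by
      apply Submodule.span_mono
      rintro u ⟨c, hc, hu⟩
      exact ⟨c, lt_of_le_of_lt hc hab, hu⟩
    exact absurd (ha.2.trans (Submodule.rank_mono hle)) (not_le.mpr hb.1)
  exact le_antisymm (not_lt.mp (key ν μ hν hμ)) (not_lt.mp (key μ ν hμ hν))

/-- The function `f` is, on `S`, the continuous representative of a Robin eigenfunction with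
eigenvalue `μ`. -/
def IsEigenfunction (h μ : ℝ) (f : ℝ × ℝ → ℝ) : Prop :=
  ContinuousOn f square ∧ ∃ u : L2S, u =ᵐ[volume.restrict square] f ∧ IsEigenvector h μ u

/-- The nodal domains of `f` in `S`: the connected components of `{p ∈ S | f p ≠ 0}`. -/
def nodalDomains (f : ℝ × ℝ → ℝ) : Set (Set (ℝ × ℝ)) :=
  {D | ∃ p ∈ {q ∈ square | f q ≠ 0}, D = connectedComponentIn {q ∈ square | f q ≠ 0} p}

/-- `λ_{k,h}(S)` is Courant-sharp: some eigenfunction for `λ_{k,h}(S)` has exactly `k` nodal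
domains. -/
def IsCourantSharp (h : ℝ) (k : ℕ) : Prop :=
  ∃ μ, IsKthEigenvalue h k μ ∧
    ∃ f, IsEigenfunction h μ f ∧ (nodalDomains f).encard = (k : ℕ∞)

/-! ### The Robin problem on the interval and pairs -/

/-- `w` is a (nonzero) eigenfunction, with eigenvalue `μ`, of the Robin problem on `I`:
`-w'' = μ w`, `-w'(-π/2) + h w(-π/2) = 0`, `w'(π/2) + h w(π/2) = 0`. -/
def IsIntervalEigenfunction (h μ : ℝ) (w : ℝ → ℝ) : Prop :=
  (∃ x ∈ interval, w x ≠ 0) ∧ ∃ w' : ℝ → ℝ,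
    (∀ x ∈ closure interval, HasDerivWithinAt w (w' x) (closure interval) x) ∧
    (∀ x ∈ closure interval, HasDerivWithinAt w' (-(μ * w x)) (closure interval) x) ∧
    -w' (-(Real.pi / 2)) + h * w (-(Real.pi / 2)) = 0 ∧
    w' (Real.pi / 2) + h * w (Real.pi / 2) = 0

/-- `μ` is an eigenvalue of the Robin problem on `I`. -/
def IsIntervalEigenvalue (h μ : ℝ) : Prop := ∃ w, IsIntervalEigenfunction h μ w

/-- `μ = λ_{p+1,h}(I)`: `μ` is a Robin eigenvalue of `I` and exactly `p` Robin eigenvalues of `I`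
are smaller (all of them are simple), `p = 0, 1, 2, …`. -/
def IsIntervalEigenvalueAt (h : ℝ) (p : ℕ) (μ : ℝ) : Prop :=
  IsIntervalEigenvalue h μ ∧ {ν | ν < μ ∧ IsIntervalEigenvalue h ν}.encard = (p : ℕ∞)

/-- `μ` comes from the pair `(p, q)`, that is, `μ = λ_{p+1,h}(I) + λ_{q+1,h}(I)`. -/
def ComesFromPair (h : ℝ) (p q : ℕ) (μ : ℝ) : Prop :=
  ∃ μ₁ μ₂ : ℝ, IsIntervalEigenvalueAt h p μ₁ ∧ IsIntervalEigenvalueAt h q μ₂ ∧ μ = μ₁ + μ₂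

/-- `w` is an eigenfunction of the Robin problem on `I` for the eigenvalue `λ_{p+1,h}(I)`. -/
def IsIntervalEigenfunctionAt (h : ℝ) (p : ℕ) (w : ℝ → ℝ) : Prop :=
  ∃ μ, IsIntervalEigenvalueAt h p μ ∧ IsIntervalEigenfunction h μ w

end RobinSquare

end

open RobinSquare

noncomputable section

namespace RobinSquare

/-! ### Fundamental solutions of `-w'' = l w` -/

/-! Separation of variables. On `I` every Robin eigenfunction is a multiple of the even or of the
odd solution of `-w'' = l w`, so the eigenvalues are the zeros of `evenChar` and `oddChar`. For `h ≤
0` the Green operator of `-w'' + (1 - h)² w` is compact, symmetric and injective, so the modes are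
complete in `L²(I)` and their products in `L²(S)` (`eq_zero_of_forall_inner_tensor_mode_eq_zero`).
By symmetry of the Robin form, an eigenfunction of `S` for `μ` is orthogonal to every product of
modes whose eigenvalues do not add up to `μ`. Multiplicities on the square thus reduce to counting
pairs.

Let `λ₁ < λ₂ < λ₃ < λ₄` be the lowest eigenvalues of `I`; they are `-b²`, `l`, `(1 + s)²`, `(2 +
t)²` (`exists_low_spectrum`). Since `λ₂ - λ₁ < 2` (`second_sub_first_lt`) and `λ₄ - λ₃ > 3`, exactly
eight ordered pairs have a sum below both `2λ₃` and `λ₁ + λ₄`. Hence the ninth eigenvalue of `S` is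
the smaller of these two numbers (`isKthEigenvalue_nine`).

Which one it is depends on the sign of the gap `F = λ₁ + λ₄ - 2λ₃` (`exists_critical_parameter`).
For `-2/π ≤ h ≤ 0` a direct estimate gives `F > 0`. For `h < -2/π` put `c = π/2` and `d = c h² + h >
0`. Each of the three eigenvalues has derivative `2λ / (cλ + d)` in `h`, which increases with `λ >
0` and stays below `2/c`, but exceeds `2/c` for `λ = λ₁ < 0`. So `F' > 0`, and `F` has a single
zero, enclosed by rational bounds at `-1.62935` and `-1.62925`.

If `2λ₃` is the minimum, a product of two third modes vanishes where `cos ((1 + s) x) cos ((1 + s)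
y)` does, and `1 < 1 + s ≤ 2` gives a 3 by 3 grid. If `λ₁ + λ₄ < 2λ₃`, the eigenspace is spanned by
`u₁ ⊗ u₄` and `u₄ ⊗ u₁` with `u₁` even and `u₄` odd. Every eigenfunction is then odd under `p ↦ -p`,
which exchanges positive and negative nodal domains, so their number is even once it is finite
(`even_ncard_nodalDomains`). For finiteness, division by `u₁(x) u₁(y) > 0` leaves `α g(y) + β g(x)`
with `g = u₄ / u₁` monotone on each of three intervals, and each of the nine resulting rectangles
meets at most one nodal domain of each sign (`nodalDomains_finite`). Nine is odd, so the eigenvalue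
is not Courant-sharp. -/

/-- The even solution of `-w'' = l w` with `w 0 = 1`. -/
def cosL (l x : ℝ) : ℝ :=
  if 0 ≤ l then Real.cos (√l * x) else Real.cosh (√(-l) * x)

/-- The odd solution of `-w'' = l w` with `w' 0 = 1`. -/
def sinL (l x : ℝ) : ℝ :=
  if 0 < l then Real.sin (√l * x) / √l else if l = 0 then x else Real.sinh (√(-l) * x) / √(-l)

theorem cosL_sq {a : ℝ} (ha : 0 ≤ a) (x : ℝ) : cosL (a ^ 2) x = Real.cos (a * x) := by
  simp [cosL, sq_nonneg, Real.sqrt_sq ha]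

theorem sinL_sq {a : ℝ} (ha : 0 < a) (x : ℝ) : sinL (a ^ 2) x = Real.sin (a * x) / a := by
  simp [sinL, pow_pos ha, Real.sqrt_sq ha.le]

theorem cosL_neg_sq {b : ℝ} (hb : 0 ≤ b) (x : ℝ) : cosL (-b ^ 2) x = Real.cosh (b * x) := by
  rcases hb.eq_or_lt with rfl | hb
  · simp [cosL]
  · have : ¬ (0 : ℝ) ≤ -b ^ 2 := by have := pow_pos hb 2; linarith
    simp [cosL, this, Real.sqrt_sq hb.le]

theorem sinL_neg_sq {b : ℝ} (hb : 0 < b) (x : ℝ) : sinL (-b ^ 2) x = Real.sinh (b * x) / b := by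
  have h2 := pow_pos hb 2
  have h3 : ¬ (0 : ℝ) < -b ^ 2 := by linarith
  have h4 : -b ^ 2 ≠ 0 := by linarith
  rw [sinL, if_neg h3, if_neg h4, neg_neg, Real.sqrt_sq hb.le]

theorem sinL_zero_left (x : ℝ) : sinL 0 x = x := by simp [sinL]

theorem cosL_zero_left (x : ℝ) : cosL 0 x = 1 := by simp [cosL]

/-- Every real number is `a²`, `0` or `-b²`. -/
theorem sq_cases (l : ℝ) : (∃ a, 0 < a ∧ l = a ^ 2) ∨ l = 0 ∨ ∃ b, 0 < b ∧ l = -b ^ 2 := by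
  rcases lt_trichotomy l 0 with h | h | h
  · exact Or.inr (Or.inr ⟨√(-l), Real.sqrt_pos.2 (by linarith), by
      rw [Real.sq_sqrt (by linarith)]; ring⟩)
  · exact Or.inr (Or.inl h)
  · exact Or.inl ⟨√l, Real.sqrt_pos.2 h, (Real.sq_sqrt h.le).symm⟩

theorem hasDerivAt_cosL (l x : ℝ) : HasDerivAt (cosL l) (-(l * sinL l x)) x := by
  have hlin (a : ℝ) : HasDerivAt (fun y => a * y) a x := by
    simpa using (hasDerivAt_id x).const_mul a
  rcases sq_cases l with ⟨a, ha, rfl⟩ | rfl | ⟨b, hb, rfl⟩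
  · rw [funext (cosL_sq ha.le), sinL_sq ha]
    convert (hlin a).cos using 1
    field_simp
  · rw [funext cosL_zero_left]
    simpa using hasDerivAt_const x (1 : ℝ)
  · rw [funext (cosL_neg_sq hb.le), sinL_neg_sq hb]
    convert (hlin b).cosh using 1
    field_simp

theorem hasDerivAt_sinL (l x : ℝ) : HasDerivAt (sinL l) (cosL l x) x := by
  have hlin (a : ℝ) : HasDerivAt (fun y => a * y) a x := by
    simpa using (hasDerivAt_id x).const_mul a
  rcases sq_cases l with ⟨a, ha, rfl⟩ | rfl | ⟨b, hb, rfl⟩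
  · rw [funext (sinL_sq ha), cosL_sq ha.le]
    refine ((hlin a).sin.div_const a).congr_deriv ?_
    field_simp
  · rw [funext sinL_zero_left, cosL_zero_left]
    exact hasDerivAt_id x
  · rw [funext (sinL_neg_sq hb), cosL_neg_sq hb.le]
    refine ((hlin b).sinh.div_const b).congr_deriv ?_
    field_simp

theorem contDiff_cosL (l : ℝ) : ContDiff ℝ ∞ (cosL l) := by
  rcases sq_cases l with ⟨a, ha, rfl⟩ | rfl | ⟨b, hb, rfl⟩
  · rw [funext (cosL_sq ha.le)]; fun_prop
  · rw [funext cosL_zero_left]; fun_prop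
  · rw [funext (cosL_neg_sq hb.le)]; fun_prop

theorem contDiff_sinL (l : ℝ) : ContDiff ℝ ∞ (sinL l) := by
  rcases sq_cases l with ⟨a, ha, rfl⟩ | rfl | ⟨b, hb, rfl⟩
  · rw [funext (sinL_sq ha)]; fun_prop
  · rw [funext sinL_zero_left]; fun_prop
  · rw [funext (sinL_neg_sq hb)]; fun_prop

@[simp] theorem cosL_zero_right (l : ℝ) : cosL l 0 = 1 := by simp [cosL]

@[simp] theorem sinL_zero_right (l : ℝ) : sinL l 0 = 0 := by simp [sinL]

@[simp] theorem cosL_neg (l x : ℝ) : cosL l (-x) = cosL l x := by simp [cosL]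

@[simp] theorem sinL_neg (l x : ℝ) : sinL l (-x) = -sinL l x := by
  simp only [sinL, mul_neg, Real.sin_neg, Real.sinh_neg]
  split_ifs <;> ring

theorem cosL_sq_add (l x : ℝ) : cosL l x ^ 2 + l * sinL l x ^ 2 = 1 := by
  rcases sq_cases l with ⟨a, ha, rfl⟩ | rfl | ⟨b, hb, rfl⟩
  · rw [cosL_sq ha.le, sinL_sq ha]
    have := Real.sin_sq_add_cos_sq (a * x)
    field_simp
    linarith
  · simp [cosL_zero_left]
  · rw [cosL_neg_sq hb.le, sinL_neg_sq hb]
    have := Real.cosh_sq (b * x)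
    field_simp
    linarith

/-! ### Characteristic functions of the Robin problem on the interval -/

/-- The Robin boundary expression at `π/2` of `cosL l`. -/
def evenChar (h l : ℝ) : ℝ := -(l * sinL l (Real.pi / 2)) + h * cosL l (Real.pi / 2)

/-- The Robin boundary expression at `π/2` of `sinL l`. -/
def oddChar (h l : ℝ) : ℝ := cosL l (Real.pi / 2) + h * sinL l (Real.pi / 2)

/-- Eliminating `cosL` leaves `sinL * (l + h ^ 2) = 0` at `π/2`, whereas `cosL_sq_add` with `cosL =
-h * sinL` gives `sinL ^ 2 * (l + h ^ 2) = 1`. An eigenvalue therefore has exactly one parity, which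
makes it simple. -/
theorem not_evenChar_and_oddChar (h l : ℝ) (hE : evenChar h l = 0) (hO : oddChar h l = 0) :
    False := by
  have h1 := cosL_sq_add l (Real.pi / 2)
  unfold evenChar at hE
  unfold oddChar at hO
  have h2 : cosL l (Real.pi / 2) = -(h * sinL l (Real.pi / 2)) := by linarith
  rw [h2] at h1 hE
  have h3 : sinL l (Real.pi / 2) * (l + h ^ 2) = 0 := by linear_combination -hE
  have : (1 : ℝ) = 0 := by
    rw [← h1]; linear_combination sinL l (Real.pi / 2) * h3
  exact one_ne_zero this

theorem closure_interval : closure interval = Icc (-(Real.pi / 2)) (Real.pi / 2) :=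
  closure_Ioo (by linarith [Real.pi_pos])

theorem mem_interval {x : ℝ} : x ∈ interval ↔ -(Real.pi / 2) < x ∧ x < Real.pi / 2 := Iff.rfl

theorem zero_mem_interval : (0 : ℝ) ∈ interval := by
  constructor <;> linarith [Real.pi_pos]

theorem IsIntervalEigenfunction.eq_combination {h l : ℝ} {w : ℝ → ℝ}
    (hw : IsIntervalEigenfunction h l w) :
    ∃ α β : ℝ, (∀ x ∈ closure interval, w x = α * cosL l x + β * sinL l x) ∧
      α * evenChar h l = 0 ∧ β * oddChar h l = 0 := by
  obtain ⟨-, w', h1, h2, hl, hr⟩ := hw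
  rw [closure_interval] at *
  have hpi := Real.pi_pos
  set c := Real.pi / 2 with hc
  have hc0 : 0 < c := by positivity
  have huniq : UniqueDiffOn ℝ (Icc (-c) c) := uniqueDiffOn_Icc (by linarith)
  have const_of (f : ℝ → ℝ) (hf : ∀ x ∈ Icc (-c) c, HasDerivWithinAt f 0 (Icc (-c) c) x) :
      ∀ x ∈ Icc (-c) c, f x = f 0 := by
    intro x hx
    refine (convex_Icc (-c) c).is_const_of_fderivWithin_eq_zero (𝕜 := ℝ)
      (fun y hy => (hf y hy).differentiableWithinAt) (fun y hy => ?_) hx ⟨by linarith, hc0.le⟩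
    have := (hf y hy).hasFDerivWithinAt.fderivWithin (huniq y hy)
    rw [this]; ext; simp
  -- Two first integrals of `-w'' = l w`. By `cosL_sq_add` the linear system they form for `w` and
  -- `w'` has determinant 1, so it can be solved.
  have hA := const_of (fun x => w x * cosL l x - w' x * sinL l x) (fun x hx => by
    refine (((h1 x hx).mul (hasDerivAt_cosL l x).hasDerivWithinAt).sub
      ((h2 x hx).mul (hasDerivAt_sinL l x).hasDerivWithinAt)).congr_deriv ?_
    ring)
  have hB := const_of (fun x => w x * (l * sinL l x) + w' x * cosL l x) (fun x hx => by
    refine (((h1 x hx).mul ((hasDerivAt_sinL l x).const_mul l).hasDerivWithinAt).add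
      ((h2 x hx).mul (hasDerivAt_cosL l x).hasDerivWithinAt)).congr_deriv ?_
    ring)
  simp only [cosL_zero_right, sinL_zero_right, mul_one, mul_zero, sub_zero, zero_add] at hA hB
  have hw : ∀ x ∈ Icc (-c) c, w x = w 0 * cosL l x + w' 0 * sinL l x := fun x hx => by
    linear_combination (-w x) * cosL_sq_add l x + cosL l x * hA x hx + sinL l x * hB x hx
  have hw' : ∀ x ∈ Icc (-c) c, w' x = w 0 * -(l * sinL l x) + w' 0 * cosL l x := fun x hx => by
    linear_combination (-w' x) * cosL_sq_add l x - l * sinL l x * hA x hx + cosL l x * hB x hx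
  have hcm : c ∈ Icc (-c) c := ⟨by linarith, le_rfl⟩
  have hcm' : -c ∈ Icc (-c) c := ⟨le_rfl, by linarith⟩
  rw [hw _ hcm, hw' _ hcm] at hr
  rw [hw _ hcm', hw' _ hcm', cosL_neg, sinL_neg] at hl
  refine ⟨w 0, w' 0, hw, ?_, ?_⟩
  -- Half the sum and half the difference of the two boundary conditions separate the even from the
  -- odd part.
  · rw [evenChar, ← hc]; linear_combination (hl + hr) / 2
  · rw [oddChar, ← hc]; linear_combination (hr - hl) / 2

theorem isIntervalEigenfunction_cosL {h l : ℝ} (hE : evenChar h l = 0) :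
    IsIntervalEigenfunction h l (cosL l) := by
  refine ⟨⟨0, zero_mem_interval, by simp⟩, fun x => -(l * sinL l x),
    fun x _ => (hasDerivAt_cosL l x).hasDerivWithinAt,
    fun x _ => ((hasDerivAt_sinL l x).const_mul l).neg.hasDerivWithinAt, ?_, hE⟩
  simpa [evenChar] using hE

theorem isIntervalEigenfunction_sinL {h l : ℝ} (hO : oddChar h l = 0) :
    IsIntervalEigenfunction h l (sinL l) := by
  refine ⟨?_, fun x => cosL l x,
    fun x _ => (hasDerivAt_sinL l x).hasDerivWithinAt,
    fun x _ => (hasDerivAt_cosL l x).hasDerivWithinAt, ?_, hO⟩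
  -- Vanishing on `I` would force derivative 0 at the origin, where `sinL l` has derivative 1.
  · by_contra! hcon
    have h1 : HasDerivAt (sinL l) 0 0 := by
      refine (hasDerivAt_const (0 : ℝ) (0 : ℝ)).congr_of_eventuallyEq ?_
      filter_upwards [isOpen_Ioo.mem_nhds zero_mem_interval] with x hx using hcon x hx
    simpa using h1.unique (hasDerivAt_sinL l 0)
  · unfold oddChar at hO
    simp only [cosL_neg, sinL_neg]
    linarith

/-- The Robin eigenfunction on the interval for the eigenvalue `l`, normalised at `0`. -/
def mode (h l : ℝ) : ℝ → ℝ := if evenChar h l = 0 then cosL l else sinL l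

theorem mode_of_even {h l : ℝ} (hE : evenChar h l = 0) : mode h l = cosL l := if_pos hE

theorem mode_of_odd {h l : ℝ} (hO : oddChar h l = 0) : mode h l = sinL l :=
  if_neg fun hE => not_evenChar_and_oddChar h l hE hO

theorem contDiff_mode (h l : ℝ) : ContDiff ℝ ∞ (mode h l) := by
  unfold mode; split_ifs
  exacts [contDiff_cosL l, contDiff_sinL l]

theorem continuous_mode (h l : ℝ) : Continuous (mode h l) := (contDiff_mode h l).continuous

theorem IsIntervalEigenfunction.eq_mode {h l : ℝ} {w : ℝ → ℝ}
    (hw : IsIntervalEigenfunction h l w) :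
    ∃ α : ℝ, α ≠ 0 ∧ ∀ x ∈ closure interval, w x = α * mode h l x := by
  obtain ⟨α, β, h1, h2, h3⟩ := hw.eq_combination
  obtain ⟨x, hx, hwx⟩ := hw.1
  by_cases hE : evenChar h l = 0
  · have hβ : β = 0 := (mul_eq_zero.1 h3).resolve_right
      (fun hO => not_evenChar_and_oddChar h l hE hO)
    refine ⟨α, ?_, fun y hy => by rw [h1 y hy, hβ, mode_of_even hE]; ring⟩
    rintro rfl
    exact hwx (by rw [h1 x (subset_closure hx), hβ]; ring)
  · have hα : α = 0 := (mul_eq_zero.1 h2).resolve_right hE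
    have hβ : β ≠ 0 := by
      rintro rfl
      exact hwx (by rw [h1 x (subset_closure hx), hα]; ring)
    have hO := (mul_eq_zero.1 h3).resolve_left hβ
    exact ⟨β, hβ, fun y hy => by rw [h1 y hy, hα, mode_of_odd hO]; ring⟩

theorem isIntervalEigenvalue_iff {h l : ℝ} :
    IsIntervalEigenvalue h l ↔ evenChar h l = 0 ∨ oddChar h l = 0 := by
  constructor
  · rintro ⟨w, hw⟩
    obtain ⟨α, β, h1, h2, h3⟩ := hw.eq_combination
    obtain ⟨x, hx, hwx⟩ := hw.1
    rw [h1 x (subset_closure hx)] at hwx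
    by_contra! hcon
    exact hwx (by rw [(mul_eq_zero.1 h2).resolve_right hcon.1,
      (mul_eq_zero.1 h3).resolve_right hcon.2]; ring)
  · rintro (hE | hO)
    exacts [⟨_, isIntervalEigenfunction_cosL hE⟩, ⟨_, isIntervalEigenfunction_sinL hO⟩]

theorem IsIntervalEigenvalue.mode {h l : ℝ} (hl : IsIntervalEigenvalue h l) :
    IsIntervalEigenfunction h l (mode h l) := by
  rcases isIntervalEigenvalue_iff.1 hl with hE | hO
  · rw [mode_of_even hE]; exact isIntervalEigenfunction_cosL hE
  · rw [mode_of_odd hO]; exact isIntervalEigenfunction_sinL hO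

/-- The derivative of `mode h l`. -/
def modeDeriv (h l : ℝ) : ℝ → ℝ :=
  if evenChar h l = 0 then fun x => -(l * sinL l x) else cosL l

theorem hasDerivAt_mode (h l x : ℝ) : HasDerivAt (mode h l) (modeDeriv h l x) x := by
  unfold mode modeDeriv; split_ifs
  exacts [hasDerivAt_cosL l x, hasDerivAt_sinL l x]

theorem hasDerivAt_modeDeriv (h l x : ℝ) :
    HasDerivAt (modeDeriv h l) (-(l * mode h l x)) x := by
  unfold mode modeDeriv; split_ifs
  exacts [((hasDerivAt_sinL l x).const_mul l).neg, hasDerivAt_cosL l x]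

theorem contDiff_modeDeriv (h l : ℝ) : ContDiff ℝ ∞ (modeDeriv h l) := by
  unfold modeDeriv; split_ifs
  exacts [(contDiff_const.mul (contDiff_sinL l)).neg, contDiff_cosL l]

theorem IsIntervalEigenvalue.modeDeriv_right {h l : ℝ} (hl : IsIntervalEigenvalue h l) :
    modeDeriv h l (Real.pi / 2) = -(h * RobinSquare.mode h l (Real.pi / 2)) := by
  rcases isIntervalEigenvalue_iff.1 hl with hE | hO
  · rw [mode_of_even hE, modeDeriv, if_pos hE]
    unfold evenChar at hE; linarith
  · rw [mode_of_odd hO, modeDeriv, if_neg fun hE => not_evenChar_and_oddChar h l hE hO]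
    unfold oddChar at hO; linarith

theorem IsIntervalEigenvalue.modeDeriv_left {h l : ℝ} (hl : IsIntervalEigenvalue h l) :
    modeDeriv h l (-(Real.pi / 2)) = h * RobinSquare.mode h l (-(Real.pi / 2)) := by
  rcases isIntervalEigenvalue_iff.1 hl with hE | hO
  · rw [mode_of_even hE, modeDeriv, if_pos hE]
    unfold evenChar at hE; simp only [cosL_neg, sinL_neg]; linarith
  · rw [mode_of_odd hO, modeDeriv, if_neg fun hE => not_evenChar_and_oddChar h l hE hO]
    unfold oddChar at hO; simp only [cosL_neg, sinL_neg]; linarith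

/-! ### Integral operators with continuous symmetric kernels on `L²(I)` -/

instance : IsFiniteMeasure (volume.restrict interval) :=
  inferInstanceAs (IsFiniteMeasure (volume.restrict (Ioo _ _)))

theorem measurableSet_interval : MeasurableSet interval := measurableSet_Ioo

theorem _root_.Continuous.memLp_interval {f : ℝ → ℝ} (hf : Continuous f) :
    MemLp f 2 (volume.restrict interval) := by
  obtain ⟨C, hC⟩ := (isCompact_Icc (a := -(Real.pi / 2)) (b := Real.pi / 2)).exists_bound_of_continuousOn
    hf.continuousOn
  refine MemLp.of_bound hf.aestronglyMeasurable C ?_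
  filter_upwards [ae_restrict_mem measurableSet_interval] with x hx
  exact hC x (Ioo_subset_Icc_self hx)

/-- The class in `L²(I)` of a continuous function. -/
def toL2I (f : ℝ → ℝ) (hf : Continuous f) : L2I := hf.memLp_interval.toLp f

theorem coeFn_toL2I {f : ℝ → ℝ} (hf : Continuous f) :
    toL2I f hf =ᵐ[volume.restrict interval] f := MemLp.coeFn_toLp _

theorem inner_toL2I {f : ℝ → ℝ} (hf : Continuous f) (g : L2I) :
    inner ℝ (toL2I f hf) g = ∫ x in interval, f x * g x := by
  rw [L2.inner_def]
  refine integral_congr_ae ?_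
  filter_upwards [coeFn_toL2I hf] with x hx
  rw [hx]; simp [mul_comm]

theorem exists_norm_le_of_ae_bound : ∃ M : ℝ, 0 < M ∧ ∀ (F : L2I) (C : ℝ), 0 ≤ C →
    (∀ᵐ x ∂volume.restrict interval, ‖F x‖ ≤ C) → ‖F‖ ≤ M * C := by
  -- The added 1 makes the constant strictly positive, so that later estimates can divide by it.
  refine ⟨(measureUnivNNReal (volume.restrict interval) : ℝ) ^ (2 : ENNReal).toReal⁻¹ + 1,
    by positivity, fun F C hC hF => (Lp.norm_le_of_ae_bound hC hF).trans ?_⟩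
  gcongr
  linarith

section Kernel

variable {K : ℝ → ℝ → ℝ} (hK : Continuous (Function.uncurry K))

/-- The section `K x ·` of a kernel as an element of `L²(I)`. -/
def slice (x : ℝ) : L2I :=
  toL2I (K x) (hK.comp (Continuous.prodMk_right x))

theorem inner_slice (x : ℝ) (f : L2I) :
    inner ℝ (slice hK x) f = ∫ y in interval, K x y * f y := inner_toL2I _ f

theorem coeFn_slice (x : ℝ) : slice hK x =ᵐ[volume.restrict interval] K x :=
  coeFn_toL2I (hK.comp (Continuous.prodMk_right x))

/-- Uniform continuity of `K` on a compact rectangle makes nearby sections uniformly close on `I`,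
and on a finite measure space the sup norm controls the `L²` norm. -/
theorem continuous_slice : Continuous (slice hK) := by
  obtain ⟨M, hM, hbd⟩ := exists_norm_le_of_ae_bound
  rw [Metric.continuous_iff]
  intro x ε hε
  have hunif := ((isCompact_Icc (a := x - 1) (b := x + 1)).prod
    (isCompact_Icc (a := -(Real.pi / 2)) (b := Real.pi / 2))).uniformContinuousOn_of_continuous
      hK.continuousOn
  rw [Metric.uniformContinuousOn_iff] at hunif
  obtain ⟨δ, hδ, H⟩ := hunif (ε / (2 * M)) (by positivity)
  refine ⟨min δ 1, by positivity, fun y hy => ?_⟩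
  have hy1 : |y - x| < 1 := (Real.dist_eq y x ▸ hy).trans_le (min_le_right _ _)
  rw [abs_lt] at hy1
  rw [dist_eq_norm]
  refine (hbd _ (ε / (2 * M)) (by positivity) ?_).trans_lt ?_
  · filter_upwards [Lp.coeFn_sub (slice hK y) (slice hK x), ae_restrict_mem measurableSet_interval,
      coeFn_slice hK x, coeFn_slice hK y] with t ht htI h1 h2
    rw [ht, Pi.sub_apply, h1, h2]
    have := H (y, t) ⟨⟨by linarith, by linarith⟩, Ioo_subset_Icc_self htI⟩ (x, t)
      ⟨⟨by linarith, by linarith⟩, Ioo_subset_Icc_self htI⟩ (by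
        rw [Prod.dist_eq]; simpa using hy.trans_le (min_le_left _ _))
    rw [Real.dist_eq] at this
    exact this.le
  · rw [show M * (ε / (2 * M)) = ε / 2 by field_simp]
    linarith

/-- The function `x ↦ ∫ K(x, y) f(y) dy`. -/
def kernelFun (f : L2I) (x : ℝ) : ℝ := inner ℝ (slice hK x) f

theorem continuous_kernelFun (f : L2I) : Continuous (kernelFun hK f) :=
  (continuous_slice hK).inner continuous_const

theorem exists_norm_slice_le : ∃ B : ℝ, 0 ≤ B ∧ ∀ x ∈ interval, ‖slice hK x‖ ≤ B := by
  obtain ⟨C, hC⟩ := (isCompact_Icc (a := -(Real.pi / 2)) (b := Real.pi / 2)).exists_bound_of_continuousOn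
    (continuous_slice hK).continuousOn
  exact ⟨C, (norm_nonneg _).trans (hC 0 (Ioo_subset_Icc_self zero_mem_interval)),
    fun x hx => hC x (Ioo_subset_Icc_self hx)⟩

theorem exists_kernelOp : ∃ T : L2I →L[ℝ] L2I, ∀ f, T f = toL2I _ (continuous_kernelFun hK f) := by
  obtain ⟨M, hM, hbd⟩ := exists_norm_le_of_ae_bound
  obtain ⟨B, hB, hB'⟩ := exists_norm_slice_le hK
  refine ⟨LinearMap.mkContinuous
    { toFun := fun f => toL2I _ (continuous_kernelFun hK f)
      map_add' := fun f g => ?_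
      map_smul' := fun r f => ?_ } (M * B) ?_, fun f => rfl⟩
  · rw [toL2I, toL2I, toL2I, ← MemLp.toLp_add]
    congr 1; ext x; simp [kernelFun, inner_add_right]
  · rw [toL2I, toL2I, RingHom.id_apply, ← MemLp.toLp_const_smul]
    congr 1; ext x; simp [kernelFun, inner_smul_right]
  · intro f
    rw [mul_assoc]
    refine hbd _ _ (by positivity) ?_
    filter_upwards [coeFn_toL2I (continuous_kernelFun hK f),
      ae_restrict_mem measurableSet_interval] with x hx hxI
    simp only [LinearMap.coe_mk, AddHom.coe_mk]
    rw [hx]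
    exact (norm_inner_le_norm _ _).trans (by gcongr; exact hB' x hxI)

/-- The integral operator on `L²(I)` with kernel `K`. -/
def kernelOp : L2I →L[ℝ] L2I := (exists_kernelOp hK).choose

theorem kernelOp_apply (f : L2I) : kernelOp hK f = toL2I _ (continuous_kernelFun hK f) :=
  (exists_kernelOp hK).choose_spec f

/-- Compact operators form a closed set, and the operator is a norm limit of finite rank ones: `x`
is rounded down to the grid `ℤ / n`, so that only finitely many sections of the kernel are used. -/
theorem isCompactOperator_kernelOp : IsCompactOperator (kernelOp hK) := by
  obtain ⟨M, hM, hbd⟩ := exists_norm_le_of_ae_bound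
  have hclosed := isClosed_setOfPred_isCompactOperator (σ₁₂ := RingHom.id ℝ) (M₁ := L2I) (M₂ := L2I)
  refine hclosed.closure_subset (Metric.mem_closure_iff.2 fun ε hε => ?_)
  -- `I` lies in `(-2, 2)` because `π < 4`, and rounding moves a point by less than 1, so `[-3, 3]`
  -- contains all base points.
  have hunif := (isCompact_Icc (a := (-3 : ℝ)) (b := 3)).uniformContinuousOn_of_continuous
    (continuous_slice hK).continuousOn
  rw [Metric.uniformContinuousOn_iff] at hunif
  obtain ⟨δ, hδ, H⟩ := hunif (ε / (2 * M)) (by positivity)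
  obtain ⟨n, hn⟩ := exists_nat_gt (max (1 / δ) 1)
  have hn1 : (1 : ℝ) < n := (le_max_right _ _).trans_lt hn
  have hnδ : 1 / (n : ℝ) < δ := by
    rw [div_lt_comm₀ (by linarith) hδ]; exact (le_max_left _ _).trans_lt hn
  have hn0 : (0 : ℝ) < n := by linarith
  have hmeas (i : ℤ) : MeasurableSet {x : ℝ | ⌊n * x⌋ = i} :=
    (Int.measurable_floor.comp (measurable_const_mul (n : ℝ))) (measurableSet_singleton i)
  let e (i : ℤ) : L2I :=
    indicatorConstLp 2 (hmeas i) (measure_ne_top (volume.restrict interval) _) (1 : ℝ)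
  let s : Finset ℤ := Finset.Icc (-(2 * n)) (2 * n)
  let R : L2I →L[ℝ] L2I := ∑ i ∈ s, (innerSL ℝ (slice hK (i / n))).smulRight (e i)
  refine ⟨R, ?_, ?_⟩
  · refine Finset.sum_induction _ (fun S : L2I →L[ℝ] L2I => IsCompactOperator S)
      (fun _ _ h1 h2 => h1.add h2) isCompactOperator_zero fun i _ => ?_
    exact (isCompactOperator_of_locallyCompactSpace_dom (innerSL ℝ (slice hK (i / n)))).clm_comp
      (ContinuousLinearMap.toSpanSingleton ℝ (e i))
  · rw [dist_eq_norm]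
    refine (ContinuousLinearMap.opNorm_le_bound _ (by positivity : (0 : ℝ) ≤ ε / 2) fun f => ?_).trans_lt
      (by linarith)
    rw [show ε / 2 * ‖f‖ = M * (ε / (2 * M) * ‖f‖) by field_simp]
    refine hbd _ _ (by positivity) ?_
    have he : ∀ᵐ x ∂volume.restrict interval, ∀ i : ℤ,
        e i x = ({x : ℝ | ⌊n * x⌋ = i}.indicator (fun _ => (1 : ℝ))) x :=
      ae_all_iff.2 fun i => indicatorConstLp_coeFn
    have hsm : ∀ᵐ x ∂volume.restrict interval, ∀ i : ℤ,
        ((inner ℝ (slice hK (i / n)) f : ℝ) • e i : L2I) x = inner ℝ (slice hK (i / n)) f * e i x :=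
      ae_all_iff.2 fun i => Lp.coeFn_smul _ _
    filter_upwards [Lp.coeFn_sub (kernelOp hK f) (R f), ae_restrict_mem measurableSet_interval,
      kernelOp_apply hK f ▸ coeFn_toL2I (continuous_kernelFun hK f), he, hsm,
      Lp.coeFn_finsetSum s fun i => (inner ℝ (slice hK (i / n)) f : ℝ) • e i]
      with x hx hxI h1 h2 h3 h4
    have hRf : R f = ∑ i ∈ s, (inner ℝ (slice hK (i / n)) f : ℝ) • e i := by
      simp [R]
    have hpi := Real.pi_lt_four
    rw [mem_interval] at hxI
    have hf1 := Int.floor_le (n * x)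
    have hf2 := Int.lt_floor_add_one (n * x)
    have hmem : ⌊n * x⌋ ∈ s := by
      rw [Finset.mem_Icc]
      constructor
      · rw [Int.le_floor]; push_cast; nlinarith
      · rw [Int.floor_le_iff]; push_cast; nlinarith
    have hRx : R f x = inner ℝ (slice hK (⌊n * x⌋ / n)) f := by
      rw [hRf, h4, Finset.sum_apply, Finset.sum_eq_single_of_mem _ hmem]
      · rw [h3, h2, indicator_of_mem (by simp), mul_one]
      · intro j _ hj
        rw [h3, h2, indicator_of_notMem (by simpa using hj.symm), mul_zero]
    change ‖(kernelOp hK f - R f) x‖ ≤ _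
    rw [hx, Pi.sub_apply, h1, hRx, kernelFun, ← inner_sub_left]
    refine (norm_inner_le_norm _ _).trans ?_
    gcongr
    rw [← dist_eq_norm]
    have hd1 : (⌊n * x⌋ : ℝ) / n ≤ x := by rw [div_le_iff₀ hn0]; linarith
    have hd2 : x - 1 / n < (⌊n * x⌋ : ℝ) / n := by
      rw [lt_div_iff₀ hn0, sub_mul, one_div_mul_cancel hn0.ne']; linarith
    have h1n : 1 / (n : ℝ) < 1 := by rw [div_lt_one hn0]; exact hn1
    refine (H x ⟨by linarith, by linarith⟩ _ ⟨by linarith, by linarith⟩ ?_).le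
    rw [Real.dist_eq, abs_lt]
    constructor <;> linarith

theorem inner_kernelOp (f g : L2I) : inner ℝ (kernelOp hK f) g =
    ∫ x in interval, ∫ y in interval, K x y * (f y * g x) := by
  rw [kernelOp_apply, inner_toL2I]
  refine integral_congr_ae (.of_forall fun x => ?_)
  simp only [kernelFun]
  rw [inner_slice, ← integral_mul_const]
  simp only [mul_assoc]

theorem isSymmetric_kernelOp (hsymm : ∀ x y, K x y = K y x) :
    (kernelOp hK : L2I →ₗ[ℝ] L2I).IsSymmetric := by
  intro f g
  have hint (f : L2I) : Integrable f (volume.restrict interval) :=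
    (Lp.memLp f).integrable (by norm_num)
  change inner ℝ (kernelOp hK f) g = inner ℝ f (kernelOp hK g)
  rw [real_inner_comm _ f,
    inner_kernelOp, inner_kernelOp, integral_integral_swap]
  · refine integral_congr_ae (.of_forall fun x => ?_)
    refine integral_congr_ae (.of_forall fun y => ?_)
    simp only [hsymm x y, mul_comm]
  · obtain ⟨C, hC⟩ := ((isCompact_Icc (a := -(Real.pi / 2)) (b := Real.pi / 2)).prod
      (isCompact_Icc (a := -(Real.pi / 2)) (b := Real.pi / 2))).exists_bound_of_continuousOn
      hK.continuousOn
    have := ((hint g).mul_prod (hint f)).bdd_mul (c := C) hK.aestronglyMeasurable ?_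
    · refine this.congr (.of_forall fun z => ?_)
      simp [Function.uncurry, mul_comm]
    · rw [Measure.prod_restrict]
      filter_upwards [ae_restrict_mem (measurableSet_interval.prod measurableSet_interval)] with z hz
      exact hC z ⟨Ioo_subset_Icc_self hz.1, Ioo_subset_Icc_self hz.2⟩

end Kernel

/-! ### The Green kernel of the Robin problem and completeness of the modes -/

section Green

variable (h : ℝ)

/-- The solution of `-w'' + (1 - h)² w = 0` with `w 0 = 1` and `w' 0 = h`. -/
def greenSol (t : ℝ) : ℝ := Real.cosh ((1 - h) * t) + h / (1 - h) * Real.sinh ((1 - h) * t)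

/-- The derivative of `greenSol`. -/
def greenSolDeriv (t : ℝ) : ℝ := (1 - h) * Real.sinh ((1 - h) * t) + h * Real.cosh ((1 - h) * t)

/-- The solution satisfying the Robin condition at `-π/2`. -/
def greenLo (x : ℝ) : ℝ := greenSol h (x + Real.pi / 2)

/-- The solution satisfying the Robin condition at `π/2`. -/
def greenHi (x : ℝ) : ℝ := greenSol h (Real.pi / 2 - x)

/-- The derivative of `greenLo`. -/
def greenLoDeriv (x : ℝ) : ℝ := greenSolDeriv h (x + Real.pi / 2)

/-- The derivative of `greenHi`. -/
def greenHiDeriv (x : ℝ) : ℝ := -greenSolDeriv h (Real.pi / 2 - x)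

/-- The (constant) Wronskian of `greenLo` and `greenHi`. -/
def greenWronskian : ℝ := greenSolDeriv h Real.pi + h * greenSol h Real.pi

/-- The Green kernel, up to the factor `greenWronskian`. -/
def greenKernel (x y : ℝ) : ℝ := greenLo h (min x y) * greenHi h (max x y)

variable {h}

theorem hasDerivAt_greenSol (hh : h ≤ 0) (t : ℝ) :
    HasDerivAt (greenSol h) (greenSolDeriv h t) t := by
  have hlin : HasDerivAt (fun y => (1 - h) * y) (1 - h) t := by
    simpa using (hasDerivAt_id t).const_mul (1 - h)
  refine (hlin.cosh.add (hlin.sinh.const_mul (h / (1 - h)))).congr_deriv ?_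
  have : 1 - h ≠ 0 := by linarith
  unfold greenSolDeriv
  field_simp

theorem hasDerivAt_greenSolDeriv (hh : h ≤ 0) (t : ℝ) :
    HasDerivAt (greenSolDeriv h) ((1 - h) ^ 2 * greenSol h t) t := by
  have hlin : HasDerivAt (fun y => (1 - h) * y) (1 - h) t := by
    simpa using (hasDerivAt_id t).const_mul (1 - h)
  refine ((hlin.sinh.const_mul (1 - h)).add (hlin.cosh.const_mul h)).congr_deriv ?_
  have : 1 - h ≠ 0 := by linarith
  unfold greenSol
  field_simp

theorem hasDerivAt_greenLo (hh : h ≤ 0) (x : ℝ) :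
    HasDerivAt (greenLo h) (greenLoDeriv h x) x :=
  (hasDerivAt_greenSol hh (x + Real.pi / 2)).comp_add_const x (Real.pi / 2)

theorem hasDerivAt_greenLoDeriv (hh : h ≤ 0) (x : ℝ) :
    HasDerivAt (greenLoDeriv h) ((1 - h) ^ 2 * greenLo h x) x :=
  (hasDerivAt_greenSolDeriv hh (x + Real.pi / 2)).comp_add_const x (Real.pi / 2)

theorem hasDerivAt_greenHi (hh : h ≤ 0) (x : ℝ) :
    HasDerivAt (greenHi h) (greenHiDeriv h x) x :=
  (hasDerivAt_greenSol hh (Real.pi / 2 - x)).comp_const_sub (Real.pi / 2) x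

theorem hasDerivAt_greenHiDeriv (hh : h ≤ 0) (x : ℝ) :
    HasDerivAt (greenHiDeriv h) ((1 - h) ^ 2 * greenHi h x) x := by
  refine ((hasDerivAt_greenSolDeriv hh (Real.pi / 2 - x)).comp_const_sub
    (Real.pi / 2) x).neg.congr_deriv ?_
  rw [neg_neg, greenHi]

theorem continuous_greenLo : Continuous (greenLo h) := by
  unfold greenLo greenSol; fun_prop

theorem continuous_greenHi : Continuous (greenHi h) := by
  unfold greenHi greenSol; fun_prop

theorem continuous_greenKernel : Continuous (Function.uncurry (greenKernel h)) := by
  unfold greenKernel Function.uncurry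
  exact (continuous_greenLo.comp (by fun_prop)).mul (continuous_greenHi.comp (by fun_prop))

theorem greenKernel_comm (x y : ℝ) : greenKernel h x y = greenKernel h y x := by
  rw [greenKernel, greenKernel, min_comm, max_comm]

theorem greenWronskian_eq (hh : h ≤ 0) (x : ℝ) :
    greenLoDeriv h x * greenHi h x - greenLo h x * greenHiDeriv h x = greenWronskian h := by
  have hd (y : ℝ) : HasDerivAt
      (fun x => greenLoDeriv h x * greenHi h x - greenLo h x * greenHiDeriv h x) 0 y := by
    refine (((hasDerivAt_greenLoDeriv hh y).mul (hasDerivAt_greenHi hh y)).sub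
      ((hasDerivAt_greenLo hh y).mul (hasDerivAt_greenHiDeriv hh y))).congr_deriv ?_
    ring
  have := is_const_of_deriv_eq_zero (fun y => (hd y).differentiableAt) (fun y => (hd y).deriv)
    x (-(Real.pi / 2))
  rw [this]
  have e1 : Real.pi / 2 - -(Real.pi / 2) = Real.pi := by ring
  simp only [greenLoDeriv, greenHi, greenLo, greenHiDeriv, neg_add_cancel, greenWronskian, e1]
  simp [greenSolDeriv, greenSol]
  ring

/-- With `E = exp ((1 - h) π)` the Wronskian equals `(E² - (1 - 2h)²) / (2 (1 - h) E)`, and `E ≥ 1 +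
(1 - h) π > 1 - 2h`. The shift `(1 - h)²` is chosen for this: it makes the Green operator available
for all `h ≤ 0`. -/
theorem greenWronskian_pos (hh : h ≤ 0) : 0 < greenWronskian h := by
  have hs : 0 < 1 - h := by linarith
  set E := Real.exp ((1 - h) * Real.pi) with hE
  have hE1 : 1 + (1 - h) * Real.pi ≤ E := by
    have := Real.add_one_le_exp ((1 - h) * Real.pi); linarith
  have hpi := Real.pi_gt_three
  have hE2 : 1 - 2 * h < E := by nlinarith
  have hEpos : 0 < E := Real.exp_pos _
  have key : greenWronskian h * (2 * (1 - h) * E) = E ^ 2 - (1 - 2 * h) ^ 2 := by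
    simp only [greenWronskian, greenSolDeriv, greenSol, Real.cosh_eq, Real.sinh_eq, Real.exp_neg,
      ← hE]
    field_simp
    ring
  have : 0 < greenWronskian h * (2 * (1 - h) * E) := by
    rw [key]; nlinarith
  exact pos_of_mul_pos_left this (by positivity)

theorem integral_greenKernel_mul {g : ℝ → ℝ} (hg : Continuous g) {x : ℝ}
    (hx : x ∈ Icc (-(Real.pi / 2)) (Real.pi / 2)) :
    ∫ y in interval, greenKernel h x y * g y =
      greenHi h x * (∫ y in (-(Real.pi / 2))..x, greenLo h y * g y) +
        greenLo h x * ∫ y in x..(Real.pi / 2), greenHi h y * g y := by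
  have hc : Continuous fun y => greenKernel h x y * g y :=
    (continuous_greenKernel.comp (Continuous.prodMk_right x)).mul hg
  rw [interval, ← integral_Ioc_eq_integral_Ioo,
    ← intervalIntegral.integral_of_le (hx.1.trans hx.2),
    ← intervalIntegral.integral_add_adjacent_intervals (hc.intervalIntegrable _ x)
      (hc.intervalIntegrable _ _), ← intervalIntegral.integral_const_mul,
    ← intervalIntegral.integral_const_mul]
  congr 1
  · refine intervalIntegral.integral_congr fun y hy => ?_
    rw [uIcc_of_le hx.1] at hy
    simp only [greenKernel, min_eq_right hy.2, max_eq_left hy.2]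
    ring
  · refine intervalIntegral.integral_congr fun y hy => ?_
    rw [uIcc_of_le hx.2] at hy
    simp only [greenKernel, min_eq_left hy.1, max_eq_right hy.1]
    ring

/-- The Green operator inverts `-v'' + (1 - h)² v` on functions vanishing near the endpoints. -/
theorem integral_greenKernel_inverse (hh : h ≤ 0) {v v' v'' : ℝ → ℝ}
    (h1 : ∀ x, HasDerivAt v (v' x) x) (h2 : ∀ x, HasDerivAt v' (v'' x) x) (hc : Continuous v'')
    (hl : v (-(Real.pi / 2)) = 0) (hl' : v' (-(Real.pi / 2)) = 0)
    (hr : v (Real.pi / 2) = 0) (hr' : v' (Real.pi / 2) = 0) {x : ℝ}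
    (hx : x ∈ Icc (-(Real.pi / 2)) (Real.pi / 2)) :
    ∫ y in interval, greenKernel h x y * ((1 - h) ^ 2 * v y - v'' y) = greenWronskian h * v x := by
  have hcv : Continuous v := continuous_iff_continuousAt.2 fun y => (h1 y).continuousAt
  have hq : Continuous fun y => (1 - h) ^ 2 * v y - v'' y := by fun_prop
  rw [integral_greenKernel_mul hq hx]
  have hlo : ∫ y in (-(Real.pi / 2))..x, greenLo h y * ((1 - h) ^ 2 * v y - v'' y) =
      (greenLoDeriv h x * v x - greenLo h x * v' x) -
        (greenLoDeriv h (-(Real.pi / 2)) * v (-(Real.pi / 2)) -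
          greenLo h (-(Real.pi / 2)) * v' (-(Real.pi / 2))) :=
    intervalIntegral.integral_eq_sub_of_hasDerivAt
      (f := fun y => greenLoDeriv h y * v y - greenLo h y * v' y)
      (fun y _ => (((hasDerivAt_greenLoDeriv hh y).mul (h1 y)).sub
        ((hasDerivAt_greenLo hh y).mul (h2 y))).congr_deriv (by ring))
      ((continuous_greenLo.mul hq).intervalIntegrable _ _)
  have hhi : ∫ y in x..(Real.pi / 2), greenHi h y * ((1 - h) ^ 2 * v y - v'' y) =
      (greenHiDeriv h (Real.pi / 2) * v (Real.pi / 2) - greenHi h (Real.pi / 2) * v' (Real.pi / 2))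
        - (greenHiDeriv h x * v x - greenHi h x * v' x) :=
    intervalIntegral.integral_eq_sub_of_hasDerivAt
      (f := fun y => greenHiDeriv h y * v y - greenHi h y * v' y)
      (fun y _ => (((hasDerivAt_greenHiDeriv hh y).mul (h1 y)).sub
        ((hasDerivAt_greenHi hh y).mul (h2 y))).congr_deriv (by ring))
      ((continuous_greenHi.mul hq).intervalIntegrable _ _)
  rw [hlo, hhi, hl, hl', hr, hr', ← greenWronskian_eq hh x]
  ring

/-- By symmetry `f` is orthogonal to the range of the Green operator, and that range contains every
test function supported in `I`. -/
theorem eq_zero_of_greenOp_eq_zero (hh : h ≤ 0) {f : L2I}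
    (hf : kernelOp (continuous_greenKernel (h := h)) f = 0) : f = 0 := by
  have hint : Integrable f (volume.restrict interval) := (Lp.memLp f).integrable (by norm_num)
  have key : ∀ᵐ x ∂(volume : Measure ℝ), x ∈ interval → f x = 0 := by
    refine isOpen_Ioo.ae_eq_zero_of_integral_contDiff_smul_eq_zero
      (IntegrableOn.locallyIntegrableOn hint) fun v hv hvc hvs => ?_
    have hv1 : ContDiff ℝ ∞ (deriv v) := hv.iterate_deriv 1
    have hv2 : ContDiff ℝ ∞ (deriv (deriv v)) := hv.iterate_deriv 2
    have hd1 (x : ℝ) : HasDerivAt v (deriv v x) x :=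
      (hv.differentiable (by simp) x).hasDerivAt
    have hd2 (x : ℝ) : HasDerivAt (deriv v) (deriv (deriv v) x) x :=
      (hv1.differentiable (by simp) x).hasDerivAt
    have hz (x : ℝ) (hx : x ∉ interval) : v x = 0 :=
      image_eq_zero_of_notMem_tsupport fun hx' => hx (hvs hx')
    have hz' (x : ℝ) (hx : x ∉ interval) : deriv v x = 0 :=
      image_eq_zero_of_notMem_tsupport fun hx' => hx (hvs (tsupport_deriv_subset hx'))
    have hm1 : -(Real.pi / 2) ∉ interval := fun hx => lt_irrefl _ hx.1
    have hm2 : Real.pi / 2 ∉ interval := fun hx => lt_irrefl _ hx.2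
    -- The Green operator sends this `q` to `greenWronskian h * v`.
    set q : ℝ → ℝ := fun y => (1 - h) ^ 2 * v y - deriv (deriv v) y with hq
    have hqc : Continuous q := by
      have := hv.continuous; have := hv2.continuous; fun_prop
    have h1 : inner ℝ (kernelOp (continuous_greenKernel (h := h)) (toL2I q hqc)) f = 0 := by
      have := isSymmetric_kernelOp (continuous_greenKernel (h := h)) greenKernel_comm
        (toL2I q hqc) f
      simp only [ContinuousLinearMap.coe_coe, hf, inner_zero_right] at this
      exact this
    rw [kernelOp_apply, inner_toL2I] at h1
    have h2 : ∫ x in interval, greenWronskian h * (v x * f x) = 0 := by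
      rw [← h1]
      refine setIntegral_congr_fun measurableSet_interval fun x hx => ?_
      simp only [kernelFun]
      rw [real_inner_comm, inner_toL2I, ← mul_assoc, ← integral_greenKernel_inverse hh hd1 hd2
        hv2.continuous (hz _ hm1) (hz' _ hm1) (hz _ hm2) (hz' _ hm2) (Ioo_subset_Icc_self hx)]
      congr 1
      refine integral_congr_ae ?_
      filter_upwards [coeFn_slice (continuous_greenKernel (h := h)) x] with y hy
      rw [hy, mul_comm]
    rw [integral_const_mul] at h2
    have h3 := (mul_eq_zero.1 h2).resolve_left (greenWronskian_pos hh).ne'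
    rw [← h3]
    simp only [smul_eq_mul]
    refine (setIntegral_eq_integral_of_forall_compl_eq_zero fun x hx => ?_).symm
    rw [hz x hx, zero_mul]
  rw [Lp.eq_zero_iff_ae_eq_zero]
  exact (ae_restrict_iff' measurableSet_interval).2 key

/-- Regularity: an eigenvector is a multiple of its own image, a continuous function `F`. Splitting
the kernel integral at `x` and differentiating twice shows that `F` satisfies the Robin problem with
`l = W / κ - (1 - h)²`, where `W` is the Wronskian. -/
theorem eigenvector_greenOp (hh : h ≤ 0) {f : L2I} {κ : ℝ} (hκ : κ ≠ 0)
    (hf : kernelOp (continuous_greenKernel (h := h)) f = κ • f) :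
    ∃ l α : ℝ, (α = 0 ∨ IsIntervalEigenvalue h l) ∧
      f = α • toL2I (mode h l) (continuous_mode h l) := by
  set hK := continuous_greenKernel (h := h)
  set F := kernelFun hK f with hF
  have hFc : Continuous F := continuous_kernelFun hK f
  have hfF : f = κ⁻¹ • toL2I F hFc := by
    rw [← kernelOp_apply, hf, inv_smul_smul₀ hκ]
  have hFeq (x : ℝ) : F x = κ⁻¹ * ∫ y in interval, greenKernel h x y * F y := by
    conv_lhs => rw [hF, kernelFun, hfF, inner_smul_right, inner_slice]
    congr 1
    refine integral_congr_ae ?_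
    filter_upwards [coeFn_toL2I hFc] with y hy
    rw [hy]
  by_cases hne : ∃ x ∈ interval, F x ≠ 0
  · set A : ℝ → ℝ := fun x => ∫ y in (-(Real.pi / 2))..x, greenLo h y * F y with hA
    set B : ℝ → ℝ := fun x => ∫ y in x..(Real.pi / 2), greenHi h y * F y with hB
    have hdA (x : ℝ) : HasDerivAt A (greenLo h x * F x) x :=
      ((continuous_greenLo.mul hFc).integral_hasStrictDerivAt _ x).hasDerivAt
    have hdB (x : ℝ) : HasDerivAt B (-(greenHi h x * F x)) x := by
      have : B = fun x => -∫ y in (Real.pi / 2)..x, greenHi h y * F y := by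
        ext x; exact intervalIntegral.integral_symm _ _
      rw [this]
      exact ((continuous_greenHi.mul hFc).integral_hasStrictDerivAt _ x).hasDerivAt.neg
    have hFAB : ∀ x ∈ closure interval, F x = κ⁻¹ * (greenHi h x * A x + greenLo h x * B x) := by
      intro x hx
      rw [closure_interval] at hx
      rw [hFeq, integral_greenKernel_mul hFc hx]
    have hd1 (x : ℝ) : HasDerivAt (fun x => κ⁻¹ * (greenHi h x * A x + greenLo h x * B x))
        (κ⁻¹ * (greenHiDeriv h x * A x + greenLoDeriv h x * B x)) x := by
      refine ((((hasDerivAt_greenHi hh x).mul (hdA x)).add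
        ((hasDerivAt_greenLo hh x).mul (hdB x))).const_mul κ⁻¹).congr_deriv ?_
      ring
    have hd2 (x : ℝ) : HasDerivAt (fun x => κ⁻¹ * (greenHiDeriv h x * A x + greenLoDeriv h x * B x))
        ((1 - h) ^ 2 * (κ⁻¹ * (greenHi h x * A x + greenLo h x * B x)) -
          κ⁻¹ * (greenWronskian h * F x)) x := by
      refine ((((hasDerivAt_greenHiDeriv hh x).mul (hdA x)).add
        ((hasDerivAt_greenLoDeriv hh x).mul (hdB x))).const_mul κ⁻¹).congr_deriv ?_
      rw [← greenWronskian_eq hh x]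
      ring
    have hend : -(Real.pi / 2) ∈ closure interval ∧ Real.pi / 2 ∈ closure interval := by
      rw [closure_interval]
      have := Real.pi_pos
      exact ⟨⟨le_rfl, by linarith⟩, ⟨by linarith, le_rfl⟩⟩
    have hwF : IsIntervalEigenfunction h (κ⁻¹ * greenWronskian h - (1 - h) ^ 2) F := by
      refine ⟨hne, fun x => κ⁻¹ * (greenHiDeriv h x * A x + greenLoDeriv h x * B x),
        fun x hx => ?_, fun x hx => ?_, ?_, ?_⟩
      · exact (hd1 x).hasDerivWithinAt.congr hFAB (hFAB x hx)
      · refine (hd2 x).hasDerivWithinAt.congr_deriv ?_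
        rw [← hFAB x hx]; ring
      · rw [hFAB _ hend.1]
        simp [hA, greenLoDeriv, greenLo, greenSolDeriv, greenSol]
        ring
      · rw [hFAB _ hend.2]
        simp [hB, greenHiDeriv, greenHi, greenSolDeriv, greenSol]
        ring
    obtain ⟨α, -, hα⟩ := hwF.eq_mode
    refine ⟨_, κ⁻¹ * α, Or.inr ⟨F, hwF⟩, ?_⟩
    rw [mul_smul]
    conv_lhs => rw [hfF]
    congr 1
    refine Lp.ext ?_
    filter_upwards [coeFn_toL2I hFc, ae_restrict_mem measurableSet_interval,
      Lp.coeFn_smul α (toL2I _ (continuous_mode h (κ⁻¹ * greenWronskian h - (1 - h) ^ 2))),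
      coeFn_toL2I (continuous_mode h (κ⁻¹ * greenWronskian h - (1 - h) ^ 2))] with x h1 h2 h3 h4
    rw [h1, h3, Pi.smul_apply, h4, hα x (subset_closure h2), smul_eq_mul]
  · push Not at hne
    -- Here `f = 0`; the value 0 for `l` is a dummy, covered by the alternative `α = 0`.
    refine ⟨0, 0, Or.inl rfl, ?_⟩
    rw [zero_smul, hfF, smul_eq_zero]
    right
    rw [Lp.eq_zero_iff_ae_eq_zero]
    filter_upwards [coeFn_toL2I hFc, ae_restrict_mem measurableSet_interval] with x h1 h2
    rw [h1, hne x h2]; rfl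

/-- The Robin eigenfunctions of the interval are complete in `L²(I)`. -/
theorem eq_zero_of_forall_inner_mode_eq_zero (hh : h ≤ 0) {g : L2I}
    (hg : ∀ l, IsIntervalEigenvalue h l →
      inner ℝ (toL2I (mode h l) (continuous_mode h l)) g = 0) : g = 0 := by
  -- Spectral theorem for the Green operator: only 0 is orthogonal to all eigenspaces. It then
  -- suffices that every eigenspace is orthogonal to `g`; the kernel is trivial and the others are
  -- multiples of modes.
  have hbot := ContinuousLinearMap.orthogonalComplement_iSup_eigenspaces_eq_bot
    (isCompactOperator_kernelOp (continuous_greenKernel (h := h)))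
    (isSymmetric_kernelOp (continuous_greenKernel (h := h)) greenKernel_comm)
  rw [← Submodule.mem_bot ℝ, ← hbot, Submodule.mem_orthogonal]
  suffices H : (⨆ μ, Module.End.eigenspace
      (kernelOp (continuous_greenKernel (h := h)) : L2I →ₗ[ℝ] L2I) μ) ≤ (ℝ ∙ g)ᗮ by
    intro u hu
    exact Submodule.mem_orthogonal_singleton_iff_inner_left.1 (H hu)
  refine iSup_le fun κ u hu => ?_
  rw [Module.End.mem_eigenspace_iff] at hu
  rw [Submodule.mem_orthogonal_singleton_iff_inner_left]
  by_cases hκ : κ = 0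
  · rw [hκ, zero_smul] at hu
    rw [eq_zero_of_greenOp_eq_zero hh hu, inner_zero_left]
  · obtain ⟨l, α, h1, h2⟩ := eigenvector_greenOp hh hκ hu
    rw [h2, inner_smul_left]
    rcases h1 with h1 | h1
    · simp [h1]
    · rw [hg l h1, mul_zero]

end Green

/-! ### Tensor products in `L²(S)` -/

theorem restrict_square : (volume.restrict square : Measure (ℝ × ℝ)) =
    (volume.restrict interval).prod (volume.restrict interval) := by
  rw [Measure.prod_restrict]; rfl

instance : IsFiniteMeasure (volume.restrict square) := by
  rw [restrict_square]; infer_instance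

theorem isOpen_interval : IsOpen interval := isOpen_Ioo

theorem isOpen_square : IsOpen square := isOpen_interval.prod isOpen_interval

theorem measurableSet_square : MeasurableSet square := isOpen_square.measurableSet

theorem memLp_tensor (f g : L2I) :
    MemLp (fun p : ℝ × ℝ => f p.1 * g p.2) 2 (volume.restrict square) := by
  rw [restrict_square]
  rw [memLp_two_iff_integrable_sq]
  · refine ((Lp.memLp f).integrable_sq.mul_prod (Lp.memLp g).integrable_sq).congr
      (.of_forall fun p => ?_)
    simp [mul_pow]
  · exact (Lp.aestronglyMeasurable f).comp_fst.mul (Lp.aestronglyMeasurable g).comp_snd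

theorem ae_square_of_ae_fst {P : ℝ → Prop} (hP : ∀ᵐ x ∂volume.restrict interval, P x) :
    ∀ᵐ p : ℝ × ℝ ∂volume.restrict square, P p.1 := by
  rw [restrict_square]; exact Measure.quasiMeasurePreserving_fst.ae hP

theorem ae_square_of_ae_snd {P : ℝ → Prop} (hP : ∀ᵐ x ∂volume.restrict interval, P x) :
    ∀ᵐ p : ℝ × ℝ ∂volume.restrict square, P p.2 := by
  rw [restrict_square]; exact Measure.quasiMeasurePreserving_snd.ae hP

theorem exists_tensor : ∃ B : L2I →L[ℝ] L2I →L[ℝ] L2S, ∀ f g,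
    B f g = (memLp_tensor f g).toLp _ := by
  have hext {F G : ℝ × ℝ → ℝ} (hF : MemLp F 2 (volume.restrict square))
      (hG : MemLp G 2 (volume.restrict square)) (h : F =ᵐ[volume.restrict square] G) :
      hF.toLp F = hG.toLp G := MemLp.toLp_congr hF hG h
  refine ⟨LinearMap.mkContinuous₂ (LinearMap.mk₂ ℝ (fun f g => (memLp_tensor f g).toLp _)
    ?_ ?_ ?_ ?_) 1 ?_, fun f g => rfl⟩
  · intro f f' g
    rw [← MemLp.toLp_add]
    refine hext _ _ ?_
    filter_upwards [ae_square_of_ae_fst (Lp.coeFn_add f f')] with p hp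
    change (f + f' : L2I) p.1 * g p.2 = f p.1 * g p.2 + f' p.1 * g p.2
    rw [hp, Pi.add_apply, add_mul]
  · intro c f g
    rw [← MemLp.toLp_const_smul]
    refine hext _ _ ?_
    filter_upwards [ae_square_of_ae_fst (Lp.coeFn_smul c f)] with p hp
    simp [hp, mul_assoc]
  · intro f g g'
    rw [← MemLp.toLp_add]
    refine hext _ _ ?_
    filter_upwards [ae_square_of_ae_snd (Lp.coeFn_add g g')] with p hp
    change f p.1 * (g + g' : L2I) p.2 = f p.1 * g p.2 + f p.1 * g' p.2
    rw [hp, Pi.add_apply, mul_add]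
  · intro c f g
    rw [← MemLp.toLp_const_smul]
    refine hext _ _ ?_
    filter_upwards [ae_square_of_ae_snd (Lp.coeFn_smul c g)] with p hp
    simp [hp, mul_left_comm]
  · intro f g
    rw [one_mul]
    refine abs_le_of_sq_le_sq' ?_ (by positivity) |>.2
    rw [mul_pow, ← real_inner_self_eq_norm_sq, ← real_inner_self_eq_norm_sq,
      ← real_inner_self_eq_norm_sq, L2.inner_def, L2.inner_def, L2.inner_def,
      ← integral_prod_mul, ← restrict_square]
    refine (integral_congr_ae ?_).le
    filter_upwards [(memLp_tensor f g).coeFn_toLp] with p hp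
    simp only [LinearMap.mk₂_apply, hp, RCLike.inner_apply, conj_trivial]
    ring

/-- The tensor product `(x, y) ↦ f x * g y` as a bounded bilinear map. -/
def tensor : L2I →L[ℝ] L2I →L[ℝ] L2S := exists_tensor.choose

theorem coeFn_tensor (f g : L2I) :
    tensor f g =ᵐ[volume.restrict square] fun p => f p.1 * g p.2 := by
  rw [tensor, exists_tensor.choose_spec f g]
  exact MemLp.coeFn_toLp _

theorem inner_tensor (f g : L2I) (u : L2S) :
    inner ℝ (tensor f g) u = ∫ p in square, u p * (f p.1 * g p.2) := by
  rw [L2.inner_def]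
  refine integral_congr_ae ?_
  filter_upwards [coeFn_tensor f g] with p hp
  rw [hp]; simp

theorem inner_tensor_tensor (f g f' g' : L2I) :
    inner ℝ (tensor f g) (tensor f' g') = (inner ℝ f f' : ℝ) * inner ℝ g g' := by
  rw [inner_tensor, L2.inner_def, L2.inner_def, ← integral_prod_mul, ← restrict_square]
  refine integral_congr_ae ?_
  filter_upwards [coeFn_tensor f' g'] with p hp
  rw [hp]
  simp only [RCLike.inner_apply, conj_trivial]
  ring

theorem coeFn_tensor_toL2I {u v : ℝ → ℝ} (hu : Continuous u) (hv : Continuous v) :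
    tensor (toL2I u hu) (toL2I v hv) =ᵐ[volume.restrict square] fun p => u p.1 * v p.2 := by
  filter_upwards [coeFn_tensor (toL2I u hu) (toL2I v hv), ae_square_of_ae_fst (coeFn_toL2I hu),
    ae_square_of_ae_snd (coeFn_toL2I hv)] with p h1 h2 h3
  rw [h1, h2, h3]

theorem inner_tensor_toL2I {u v : ℝ → ℝ} (hu : Continuous u) (hv : Continuous v) (F : L2S) :
    inner ℝ (tensor (toL2I u hu) (toL2I v hv)) F = ∫ p in square, F p * (u p.1 * v p.2) := by
  rw [L2.inner_def]
  refine integral_congr_ae ?_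
  filter_upwards [coeFn_tensor_toL2I hu hv] with p hp
  rw [hp]; simp

/-- Tensor products are total in `L²(S)`. -/
theorem eq_zero_of_forall_inner_tensor_eq_zero {u : L2S}
    (hu : ∀ f g, inner ℝ (tensor f g) u = 0) : u = 0 := by
  have hint : Integrable u (volume.restrict square) := (Lp.memLp u).integrable (by norm_num)
  rw [Lp.eq_zero_iff_ae_eq_zero]
  refine hint.ae_eq_zero_of_forall_setIntegral_eq_zero fun s hs _ => ?_
  -- Indicator functions as factors show that `u` integrates to 0 over measurable rectangles, a
  -- π-system generating the σ-algebra.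
  have hrect (s t : Set ℝ) (hs : MeasurableSet s) (ht : MeasurableSet t) :
      ∫ p in s ×ˢ t, u p ∂(volume.restrict square) = 0 := by
    rw [← hu (indicatorConstLp 2 hs (measure_ne_top _ _) (1 : ℝ))
      (indicatorConstLp 2 ht (measure_ne_top _ _) (1 : ℝ)), inner_tensor,
      ← integral_indicator (hs.prod ht)]
    refine integral_congr_ae ?_
    filter_upwards [ae_square_of_ae_fst (indicatorConstLp_coeFn (p := 2) (hs := hs)
        (hμs := measure_ne_top (volume.restrict interval) _) (c := (1 : ℝ))),
      ae_square_of_ae_snd (indicatorConstLp_coeFn (p := 2) (hs := ht)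
        (hμs := measure_ne_top (volume.restrict interval) _) (c := (1 : ℝ)))] with p h1 h2
    rw [h1, h2]
    by_cases h3 : p.1 ∈ s <;> by_cases h4 : p.2 ∈ t <;>
      simp [indicator, h3, h4]
  have huniv : ∫ p, u p ∂(volume.restrict square) = 0 := by
    simpa using hrect univ univ .univ .univ
  induction s, hs using MeasurableSpace.induction_on_inter generateFrom_prod.symm isPiSystem_prod with
  | empty => simp
  | basic t ht =>
    obtain ⟨a, ha, b, hb, rfl⟩ := ht
    exact hrect a b ha hb
  | compl t ht ih =>
    have := integral_add_compl ht hint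
    rw [ih (measure_lt_top _ _), huniv] at this
    simpa using this
  | iUnion f hd hm ih =>
    rw [integral_iUnion hm hd hint.integrableOn]
    simp [fun i => ih i (measure_lt_top _ _)]

/-- A function in `L²(S)` orthogonal to all products of Robin modes vanishes. -/
theorem eq_zero_of_forall_inner_tensor_mode_eq_zero {h : ℝ} (hh : h ≤ 0) {u : L2S}
    (hu : ∀ l l', IsIntervalEigenvalue h l → IsIntervalEigenvalue h l' →
      inner ℝ (tensor (toL2I (mode h l) (continuous_mode h l))
        (toL2I (mode h l') (continuous_mode h l'))) u = 0) : u = 0 := by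
  -- Completeness on `I` is applied to one variable at a time: the adjoint of `g ↦ f ⊗ g` turns
  -- orthogonality to products into orthogonality to modes.
  have h1 (l : ℝ) (hl : IsIntervalEigenvalue h l) (g : L2I) :
      inner ℝ (tensor (toL2I (mode h l) (continuous_mode h l)) g) u = 0 := by
    have : (tensor (toL2I (mode h l) (continuous_mode h l))).adjoint u = 0 := by
      refine eq_zero_of_forall_inner_mode_eq_zero hh fun l' hl' => ?_
      rw [ContinuousLinearMap.adjoint_inner_right]
      exact hu l l' hl hl'
    rw [← ContinuousLinearMap.adjoint_inner_right, this, inner_zero_right]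
  refine eq_zero_of_forall_inner_tensor_eq_zero fun f g => ?_
  have : (tensor.flip g).adjoint u = 0 := by
    refine eq_zero_of_forall_inner_mode_eq_zero hh fun l hl => ?_
    rw [ContinuousLinearMap.adjoint_inner_right]
    exact h1 l hl g
  rw [← ContinuousLinearMap.flip_apply, ← ContinuousLinearMap.adjoint_inner_right, this,
    inner_zero_right]

/-! ### Products of modes as elements of `H¹(S)` -/

theorem integrable_square {f : ℝ × ℝ → ℝ} (hf : Continuous f) :
    Integrable f (volume.restrict square) := by
  obtain ⟨C, hC⟩ := ((isCompact_Icc (a := -(Real.pi / 2)) (b := Real.pi / 2)).prod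
    (isCompact_Icc (a := -(Real.pi / 2)) (b := Real.pi / 2))).exists_bound_of_continuousOn
    hf.continuousOn
  refine Integrable.of_bound hf.aestronglyMeasurable C ?_
  filter_upwards [ae_restrict_mem measurableSet_square] with z hz
  exact hC z ⟨Ioo_subset_Icc_self hz.1, Ioo_subset_Icc_self hz.2⟩

theorem integral_square_deriv_fst {G g : ℝ × ℝ → ℝ} (hG : Continuous G) (hg : Continuous g)
    (hd : ∀ x y, HasDerivAt (fun x => G (x, y)) (g (x, y)) x) :
    ∫ p in square, g p = (∫ t in interval, G (Real.pi / 2, t)) -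
      ∫ t in interval, G (-(Real.pi / 2), t) := by
  have hpi := Real.pi_pos
  have hint : Integrable g (volume.restrict square) := integrable_square hg
  have hI {k : ℝ → ℝ} (hk : Continuous k) : Integrable k (volume.restrict interval) :=
    hk.memLp_interval.integrable (by norm_num)
  rw [restrict_square] at hint ⊢
  rw [integral_prod_symm _ hint, ← integral_sub (hI (by fun_prop)) (hI (by fun_prop))]
  refine integral_congr_ae (.of_forall fun y => ?_)
  simp only
  rw [interval, ← integral_Ioc_eq_integral_Ioo, ← intervalIntegral.integral_of_le (by linarith)]
  exact intervalIntegral.integral_eq_sub_of_hasDerivAt (fun x _ => hd x y)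
    ((by fun_prop : Continuous fun x => g (x, y)).intervalIntegrable _ _)

theorem integral_square_swap (g : ℝ × ℝ → ℝ) :
    ∫ p in square, g p.swap = ∫ p in square, g p := by
  rw [restrict_square]; exact integral_prod_swap g

theorem integral_square_deriv_snd {G g : ℝ × ℝ → ℝ} (hG : Continuous G) (hg : Continuous g)
    (hd : ∀ x y, HasDerivAt (fun y => G (x, y)) (g (x, y)) y) :
    ∫ p in square, g p = (∫ t in interval, G (t, Real.pi / 2)) -
      ∫ t in interval, G (t, -(Real.pi / 2)) := by
  rw [← integral_square_swap]
  exact integral_square_deriv_fst (G := fun p => G p.swap) (by fun_prop)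
    (by fun_prop) fun x y => hd y x

theorem fderiv_apply_fst {φ : ℝ × ℝ → ℝ} (hφ : ContDiff ℝ ∞ φ) (x y : ℝ) :
    HasDerivAt (fun x => φ (x, y)) (fderiv ℝ φ (x, y) (1, 0)) x :=
  ((hφ.differentiable (by simp) (x, y)).hasFDerivAt).comp_hasDerivAt x
    ((hasDerivAt_id x).prodMk (hasDerivAt_const x y))

theorem fderiv_apply_snd {φ : ℝ × ℝ → ℝ} (hφ : ContDiff ℝ ∞ φ) (x y : ℝ) :
    HasDerivAt (fun y => φ (x, y)) (fderiv ℝ φ (x, y) (0, 1)) y :=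
  ((hφ.differentiable (by simp) (x, y)).hasFDerivAt).comp_hasDerivAt y
    ((hasDerivAt_const y x).prodMk (hasDerivAt_id y))

theorem continuous_fderiv_apply_const {φ : ℝ × ℝ → ℝ} (hφ : ContDiff ℝ ∞ φ) (e : ℝ × ℝ) :
    Continuous fun p => fderiv ℝ φ p e :=
  (hφ.continuous_fderiv (by simp)).clm_apply continuous_const

/-- The element of `H¹(S)` given by the product of two `C¹` functions. -/
def prodH1 {u u' v v' : ℝ → ℝ} (hu : ∀ x, HasDerivAt u (u' x) x) (hu' : Continuous u')
    (hv : ∀ x, HasDerivAt v (v' x) x) (hv' : Continuous v') : H1 :=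
  have cu : Continuous u := continuous_iff_continuousAt.2 fun x => (hu x).continuousAt
  have cv : Continuous v := continuous_iff_continuousAt.2 fun x => (hv x).continuousAt
  { val := tensor (toL2I u cu) (toL2I v cv)
    dx := tensor (toL2I u' hu') (toL2I v cv)
    dy := tensor (toL2I u cu) (toL2I v' hv')
    traceRight := toL2I (fun t => u (Real.pi / 2) * v t) (by fun_prop)
    traceLeft := toL2I (fun t => u (-(Real.pi / 2)) * v t) (by fun_prop)
    traceTop := toL2I (fun t => u t * v (Real.pi / 2)) (by fun_prop)
    traceBottom := toL2I (fun t => u t * v (-(Real.pi / 2))) (by fun_prop)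
    green_x := fun φ hφ => by
      have cφ := hφ.continuous
      have cd := continuous_fderiv_apply_const hφ (1, 0)
      have e1 : ∫ p in square, tensor (toL2I u cu) (toL2I v cv) p * fderiv ℝ φ p (1, 0) =
          ∫ p in square, u p.1 * v p.2 * fderiv ℝ φ p (1, 0) := by
        refine integral_congr_ae ?_
        filter_upwards [coeFn_tensor_toL2I cu cv] with p hp
        rw [hp]
      have e2 : ∫ p in square, tensor (toL2I u' hu') (toL2I v cv) p * φ p =
          ∫ p in square, u' p.1 * v p.2 * φ p := by
        refine integral_congr_ae ?_
        filter_upwards [coeFn_tensor_toL2I hu' cv] with p hp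
        rw [hp]
      rw [e1, e2, ← integral_add (integrable_square (by fun_prop)) (integrable_square (by fun_prop)),
        integral_square_deriv_fst (G := fun p => u p.1 * v p.2 * φ p) (by fun_prop) (by fun_prop)
          fun x y => (((hu x).mul_const (v y)).mul (fderiv_apply_fst hφ x y)).congr_deriv (by ring)]
      congr 1 <;> refine integral_congr_ae ?_
      · filter_upwards [coeFn_toL2I (f := fun t => u (Real.pi / 2) * v t) (by fun_prop)] with t ht
        rw [ht]
      · filter_upwards [coeFn_toL2I (f := fun t => u (-(Real.pi / 2)) * v t) (by fun_prop)] with t ht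
        rw [ht]
    green_y := fun φ hφ => by
      have cφ := hφ.continuous
      have cd := continuous_fderiv_apply_const hφ (0, 1)
      have e1 : ∫ p in square, tensor (toL2I u cu) (toL2I v cv) p * fderiv ℝ φ p (0, 1) =
          ∫ p in square, u p.1 * v p.2 * fderiv ℝ φ p (0, 1) := by
        refine integral_congr_ae ?_
        filter_upwards [coeFn_tensor_toL2I cu cv] with p hp
        rw [hp]
      have e2 : ∫ p in square, tensor (toL2I u cu) (toL2I v' hv') p * φ p =
          ∫ p in square, u p.1 * v' p.2 * φ p := by
        refine integral_congr_ae ?_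
        filter_upwards [coeFn_tensor_toL2I cu hv'] with p hp
        rw [hp]
      rw [e1, e2, ← integral_add (integrable_square (by fun_prop)) (integrable_square (by fun_prop)),
        integral_square_deriv_snd (G := fun p => u p.1 * v p.2 * φ p) (by fun_prop) (by fun_prop)
          fun x y => (((hv y).const_mul (u x)).mul (fderiv_apply_snd hφ x y)).congr_deriv (by ring)]
      congr 1 <;> refine integral_congr_ae ?_
      · filter_upwards [coeFn_toL2I (f := fun t => u t * v (Real.pi / 2)) (by fun_prop)] with t ht
        rw [ht]
      · filter_upwards [coeFn_toL2I (f := fun t => u t * v (-(Real.pi / 2))) (by fun_prop)] with t ht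
        rw [ht] }

/-! ### Eigenvectors of the Robin Laplacian on the square -/

/-- The product of the modes for `l` and `l'`. -/
def prodMode (h l l' : ℝ) : L2S :=
  tensor (toL2I (mode h l) (continuous_mode h l)) (toL2I (mode h l') (continuous_mode h l'))

theorem coeFn_prodMode (h l l' : ℝ) :
    prodMode h l l' =ᵐ[volume.restrict square] fun p => mode h l p.1 * mode h l' p.2 :=
  coeFn_tensor_toL2I _ _

theorem continuous_modeDeriv (h l : ℝ) : Continuous (modeDeriv h l) :=
  (contDiff_modeDeriv h l).continuous

/-- The product of two modes as an element of `H¹(S)`. -/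
def prodModeH1 (h l l' : ℝ) : H1 :=
  prodH1 (hasDerivAt_mode h l) (continuous_modeDeriv h l) (hasDerivAt_mode h l')
    (continuous_modeDeriv h l')

theorem prodModeH1_val (h l l' : ℝ) : (prodModeH1 h l l').val = prodMode h l l' := rfl

/-- Green's formula for `V` is used with the test functions `u' ⊗ v` and `u ⊗ v'`, which are smooth
up to the boundary. The second derivatives produce `l + l'`, and the Robin conditions turn the trace
terms into the boundary part of the form. -/
theorem robinForm_prodModeH1 {h l l' : ℝ} (hl : IsIntervalEigenvalue h l)
    (hl' : IsIntervalEigenvalue h l') (V : H1) :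
    robinForm h (prodModeH1 h l l') V = (l + l') * inner ℝ (prodMode h l l') V.val := by
  set u := mode h l with hu
  set v := mode h l' with hv
  set u' := modeDeriv h l with hu'
  set v' := modeDeriv h l' with hv'
  have cu : Continuous u := continuous_mode h l
  have cv : Continuous v := continuous_mode h l'
  have cu' : Continuous u' := continuous_modeDeriv h l
  have cv' : Continuous v' := continuous_modeDeriv h l'
  have su := contDiff_mode h l
  have sv := contDiff_mode h l'
  have su' := contDiff_modeDeriv h l
  have sv' := contDiff_modeDeriv h l'
  have hx : inner ℝ (prodModeH1 h l l').dx V.dx = ∫ p in square, V.dx p * (u' p.1 * v p.2) :=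
    inner_tensor_toL2I cu' cv V.dx
  have hy : inner ℝ (prodModeH1 h l l').dy V.dy = ∫ p in square, V.dy p * (u p.1 * v' p.2) :=
    inner_tensor_toL2I cu cv' V.dy
  have hv0 : inner ℝ (prodMode h l l') V.val = ∫ p in square, V.val p * (u p.1 * v p.2) :=
    inner_tensor_toL2I cu cv V.val
  have hr : inner ℝ (prodModeH1 h l l').traceRight V.traceRight =
      ∫ t in interval, u (Real.pi / 2) * v t * V.traceRight t :=
    inner_toL2I (f := fun t => u (Real.pi / 2) * v t) (by fun_prop) _
  have hle : inner ℝ (prodModeH1 h l l').traceLeft V.traceLeft =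
      ∫ t in interval, u (-(Real.pi / 2)) * v t * V.traceLeft t :=
    inner_toL2I (f := fun t => u (-(Real.pi / 2)) * v t) (by fun_prop) _
  have ht : inner ℝ (prodModeH1 h l l').traceTop V.traceTop =
      ∫ t in interval, u t * v (Real.pi / 2) * V.traceTop t :=
    inner_toL2I (f := fun t => u t * v (Real.pi / 2)) (by fun_prop) _
  have hb : inner ℝ (prodModeH1 h l l').traceBottom V.traceBottom =
      ∫ t in interval, u t * v (-(Real.pi / 2)) * V.traceBottom t :=
    inner_toL2I (f := fun t => u t * v (-(Real.pi / 2))) (by fun_prop) _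
  have sφ : ContDiff ℝ ∞ fun p : ℝ × ℝ => u' p.1 * v p.2 :=
    (su'.comp contDiff_fst).mul (sv.comp contDiff_snd)
  have sψ : ContDiff ℝ ∞ fun p : ℝ × ℝ => u p.1 * v' p.2 :=
    (su.comp contDiff_fst).mul (sv'.comp contDiff_snd)
  have gx := V.green_x (fun p => u' p.1 * v p.2) sφ
  have gy := V.green_y (fun p => u p.1 * v' p.2) sψ
  have e1 : ∫ p in square, V.val p * fderiv ℝ (fun p : ℝ × ℝ => u' p.1 * v p.2) p (1, 0) =
      -l * ∫ p in square, V.val p * (u p.1 * v p.2) := by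
    rw [← integral_const_mul]
    refine integral_congr_ae (.of_forall fun p => ?_)
    have := (fderiv_apply_fst sφ p.1 p.2).unique ((hasDerivAt_modeDeriv h l p.1).mul_const (v p.2))
    simp only [Prod.mk.eta] at this ⊢
    rw [this]; ring
  have e2 : ∫ p in square, V.val p * fderiv ℝ (fun p : ℝ × ℝ => u p.1 * v' p.2) p (0, 1) =
      -l' * ∫ p in square, V.val p * (u p.1 * v p.2) := by
    rw [← integral_const_mul]
    refine integral_congr_ae (.of_forall fun p => ?_)
    have := (fderiv_apply_snd sψ p.1 p.2).unique
      ((hasDerivAt_modeDeriv h l' p.2).const_mul (u p.1))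
    simp only [Prod.mk.eta] at this ⊢
    rw [this]; ring
  have e3 : ∫ t in interval, V.traceRight t * (u' (Real.pi / 2) * v t) =
      -h * ∫ t in interval, u (Real.pi / 2) * v t * V.traceRight t := by
    rw [← integral_const_mul]
    refine integral_congr_ae (.of_forall fun t => ?_)
    simp only [hu', hl.modeDeriv_right]; ring
  have e4 : ∫ t in interval, V.traceLeft t * (u' (-(Real.pi / 2)) * v t) =
      h * ∫ t in interval, u (-(Real.pi / 2)) * v t * V.traceLeft t := by
    rw [← integral_const_mul]
    refine integral_congr_ae (.of_forall fun t => ?_)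
    simp only [hu', hl.modeDeriv_left]; ring
  have e5 : ∫ t in interval, V.traceTop t * (u t * v' (Real.pi / 2)) =
      -h * ∫ t in interval, u t * v (Real.pi / 2) * V.traceTop t := by
    rw [← integral_const_mul]
    refine integral_congr_ae (.of_forall fun t => ?_)
    simp only [hv', hl'.modeDeriv_right]; ring
  have e6 : ∫ t in interval, V.traceBottom t * (u t * v' (-(Real.pi / 2))) =
      h * ∫ t in interval, u t * v (-(Real.pi / 2)) * V.traceBottom t := by
    rw [← integral_const_mul]
    refine integral_congr_ae (.of_forall fun t => ?_)
    simp only [hv', hl'.modeDeriv_left]; ring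
  rw [e1, e3, e4] at gx
  rw [e2, e5, e6] at gy
  rw [robinForm, bdryInner, hx, hy, hr, hle, ht, hb, hv0]
  linear_combination gx + gy

theorem robinForm_comm (h : ℝ) (U V : H1) : robinForm h U V = robinForm h V U := by
  simp only [robinForm, bdryInner, real_inner_comm]

/-- Lagrange's identity: `(l - l')` times the integral is a boundary Wronskian, which vanishes
because both modes satisfy the same Robin conditions. -/
theorem inner_mode_mode_of_ne {h l l' : ℝ} (hl : IsIntervalEigenvalue h l)
    (hl' : IsIntervalEigenvalue h l') (hne : l ≠ l') :
    inner ℝ (toL2I (mode h l) (continuous_mode h l))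
      (toL2I (mode h l') (continuous_mode h l')) = 0 := by
  have hpi := Real.pi_pos
  have cu := continuous_mode h l
  have cv := continuous_mode h l'
  rw [inner_toL2I]
  have e : ∫ x in interval, mode h l x * toL2I (mode h l') cv x =
      ∫ x in (-(Real.pi / 2))..(Real.pi / 2), mode h l x * mode h l' x := by
    rw [intervalIntegral.integral_of_le (by linarith), integral_Ioc_eq_integral_Ioo]
    refine integral_congr_ae ?_
    filter_upwards [coeFn_toL2I cv] with x hx
    rw [hx]
  have h1 : ∫ x in (-(Real.pi / 2))..(Real.pi / 2), (l - l') * (mode h l x * mode h l' x) = _ :=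
    intervalIntegral.integral_eq_sub_of_hasDerivAt
      (f := fun x => mode h l x * modeDeriv h l' x - modeDeriv h l x * mode h l' x)
      (fun x _ => (((hasDerivAt_mode h l x).mul (hasDerivAt_modeDeriv h l' x)).sub
        ((hasDerivAt_modeDeriv h l x).mul (hasDerivAt_mode h l' x))).congr_deriv (by ring))
      ((by fun_prop : Continuous _).intervalIntegrable _ _)
  rw [intervalIntegral.integral_const_mul, hl.modeDeriv_right, hl.modeDeriv_left,
    hl'.modeDeriv_right, hl'.modeDeriv_left] at h1
  rw [e]
  have h2 : (l - l') * ∫ x in (-(Real.pi / 2))..(Real.pi / 2), mode h l x * mode h l' x = 0 := by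
    rw [h1]; ring
  exact (mul_eq_zero.1 h2).resolve_left (sub_ne_zero.2 hne)

theorem toL2I_mode_ne_zero {h l : ℝ} (hl : IsIntervalEigenvalue h l) :
    toL2I (mode h l) (continuous_mode h l) ≠ 0 := by
  intro h0
  obtain ⟨x, hx, hne⟩ := hl.mode.1
  rw [Lp.eq_zero_iff_ae_eq_zero] at h0
  refine hne (Measure.eqOn_open_of_ae_eq (μ := volume) (U := interval) (f := mode h l) (g := fun _ => 0) ?_
    isOpen_interval (continuous_mode h l).continuousOn continuousOn_const hx)
  filter_upwards [h0, coeFn_toL2I (continuous_mode h l)] with y h1 h2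
  rw [← h2, h1]; rfl

theorem prodMode_ne_zero {h l l' : ℝ} (hl : IsIntervalEigenvalue h l)
    (hl' : IsIntervalEigenvalue h l') : prodMode h l l' ≠ 0 := by
  rw [← inner_self_ne_zero (𝕜 := ℝ), prodMode, inner_tensor_tensor]
  exact mul_ne_zero (inner_self_ne_zero.2 (toL2I_mode_ne_zero hl))
    (inner_self_ne_zero.2 (toL2I_mode_ne_zero hl'))

theorem isEigenvector_prodMode {h l l' : ℝ} (hl : IsIntervalEigenvalue h l)
    (hl' : IsIntervalEigenvalue h l') : IsEigenvector h (l + l') (prodMode h l l') :=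
  ⟨prodMode_ne_zero hl hl', prodModeH1 h l l', rfl, robinForm_prodModeH1 hl hl'⟩

theorem IsEigenvector.smul {h μ : ℝ} {u : L2S} (hu : IsEigenvector h μ u) {c : ℝ} (hc : c ≠ 0) :
    IsEigenvector h μ (c • u) := by
  obtain ⟨h0, U, rfl, hU⟩ := hu
  have hsm {m : Measure ℝ} (f : Lp ℝ 2 m) (g : ℝ → ℝ) :
      ∫ t, (c • f) t * g t ∂m = c * ∫ t, f t * g t ∂m := by
    rw [← integral_const_mul]
    refine integral_congr_ae ?_
    filter_upwards [Lp.coeFn_smul c f] with t ht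
    rw [ht, Pi.smul_apply, smul_eq_mul, mul_assoc]
  have hsm2 (f : L2S) (g : ℝ × ℝ → ℝ) :
      ∫ t in square, (c • f) t * g t = c * ∫ t in square, f t * g t := by
    rw [← integral_const_mul]
    refine integral_congr_ae ?_
    filter_upwards [Lp.coeFn_smul c f] with t ht
    rw [ht, Pi.smul_apply, smul_eq_mul, mul_assoc]
  refine ⟨smul_ne_zero hc h0, ⟨c • U.val, c • U.dx, c • U.dy, c • U.traceRight, c • U.traceLeft,
    c • U.traceTop, c • U.traceBottom, fun φ hφ => ?_, fun φ hφ => ?_⟩, rfl, fun V => ?_⟩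
  · rw [hsm, hsm, hsm2, hsm2, ← mul_add, ← mul_sub, U.green_x φ hφ]
  · rw [hsm, hsm, hsm2, hsm2, ← mul_add, ← mul_sub, U.green_y φ hφ]
  · have := hU V
    simp only [robinForm, bdryInner, inner_smul_left, conj_trivial] at this ⊢
    linear_combination c * this

/-- The form evaluated on the eigenfunction and the product mode gives the factor `μ` in one order
and `l + l'` in the other. With completeness of the products this determines the spectrum of the
square. -/
theorem IsEigenvector.inner_prodMode_eq_zero {h μ l l' : ℝ} {u : L2S} (hu : IsEigenvector h μ u)
    (hl : IsIntervalEigenvalue h l) (hl' : IsIntervalEigenvalue h l') (hne : l + l' ≠ μ) :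
    inner ℝ (prodMode h l l') u = 0 := by
  obtain ⟨-, U, rfl, hU⟩ := hu
  have h1 := hU (prodModeH1 h l l')
  rw [robinForm_comm, robinForm_prodModeH1 hl hl', prodModeH1_val, real_inner_comm U.val,
    ← sub_eq_zero, ← sub_mul] at h1
  rw [real_inner_comm] at h1
  exact (mul_eq_zero.1 h1).resolve_left (sub_ne_zero.2 hne)

theorem inner_prodMode_prodMode_of_ne {h : ℝ} {p q : ℝ × ℝ} (hp1 : IsIntervalEigenvalue h p.1)
    (hp2 : IsIntervalEigenvalue h p.2) (hq1 : IsIntervalEigenvalue h q.1)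
    (hq2 : IsIntervalEigenvalue h q.2) (hne : p ≠ q) :
    inner ℝ (prodMode h p.1 p.2) (prodMode h q.1 q.2) = 0 := by
  rw [prodMode, prodMode, inner_tensor_tensor]
  by_cases h1 : p.1 = q.1
  · have h2 : p.2 ≠ q.2 := fun h2 => hne (Prod.ext h1 h2)
    rw [inner_mode_mode_of_ne hp2 hq2 h2, mul_zero]
  · rw [inner_mode_mode_of_ne hp1 hq1 h1, zero_mul]

/-- An element of `L²(S)` orthogonal to all products of modes outside a finite set lies in the
span of the products in that set. -/
theorem mem_span_prodMode {h : ℝ} (hh : h ≤ 0) {A : Finset (ℝ × ℝ)}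
    (hA : ∀ p ∈ A, IsIntervalEigenvalue h p.1 ∧ IsIntervalEigenvalue h p.2) {u : L2S}
    (hu : ∀ p : ℝ × ℝ, IsIntervalEigenvalue h p.1 → IsIntervalEigenvalue h p.2 → p ∉ A →
      inner ℝ (prodMode h p.1 p.2) u = 0) :
    u ∈ Submodule.span ℝ ((fun p : ℝ × ℝ => prodMode h p.1 p.2) '' A) := by
  set K := Submodule.span ℝ ((fun p : ℝ × ℝ => prodMode h p.1 p.2) '' A) with hK
  have : FiniteDimensional ℝ K := FiniteDimensional.span_of_finite ℝ (A.finite_toSet.image _)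
  -- The residual of the projection is orthogonal to the products in `A` by construction, and to the
  -- others because both `u` and `K` are.
  have hz : u - K.starProjection u = 0 := by
    refine eq_zero_of_forall_inner_tensor_mode_eq_zero hh fun l l' hl hl' => ?_
    change inner ℝ (prodMode h l l') (u - K.starProjection u) = 0
    by_cases hmem : (l, l') ∈ A
    · exact Submodule.inner_right_of_mem_orthogonal
        (K := K) (Submodule.subset_span (mem_image_of_mem _ hmem)) (K.sub_starProjection_mem_orthogonal u)
    · rw [inner_sub_right, hu (l, l') hl hl' hmem, zero_sub, neg_eq_zero]
      have hle : K ≤ (ℝ ∙ prodMode h l l')ᗮ := by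
        rw [hK, Submodule.span_le]
        rintro _ ⟨p, hp, rfl⟩
        rw [SetLike.mem_coe, Submodule.mem_orthogonal_singleton_iff_inner_right]
        exact inner_prodMode_prodMode_of_ne (p := (l, l')) hl hl' (hA p hp).1 (hA p hp).2
          fun e => hmem (e ▸ hp)
      exact Submodule.mem_orthogonal_singleton_iff_inner_right.1
        (hle (K.starProjection_apply_mem u))
  rw [sub_eq_zero.1 hz]
  exact K.starProjection_apply_mem u

theorem IsEigenvector.mem_span_prodMode {h μ : ℝ} (hh : h ≤ 0) {A : Finset (ℝ × ℝ)}
    (hA : ∀ p ∈ A, IsIntervalEigenvalue h p.1 ∧ IsIntervalEigenvalue h p.2)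
    (hA' : ∀ p : ℝ × ℝ, IsIntervalEigenvalue h p.1 → IsIntervalEigenvalue h p.2 →
      p.1 + p.2 = μ → p ∈ A) {u : L2S} (hu : IsEigenvector h μ u) :
    u ∈ Submodule.span ℝ ((fun p : ℝ × ℝ => prodMode h p.1 p.2) '' A) :=
  RobinSquare.mem_span_prodMode hh hA fun p h1 h2 hp =>
    hu.inner_prodMode_eq_zero h1 h2 fun e => hp (hA' p h1 h2 e)

theorem rank_spanLT_le {h μ : ℝ} (hh : h ≤ 0) {A : Finset (ℝ × ℝ)}
    (hA : ∀ p ∈ A, IsIntervalEigenvalue h p.1 ∧ IsIntervalEigenvalue h p.2)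
    (hA' : ∀ p : ℝ × ℝ, IsIntervalEigenvalue h p.1 → IsIntervalEigenvalue h p.2 →
      p.1 + p.2 < μ → p ∈ A) :
    Module.rank ℝ (spanLT h μ) ≤ A.card := by
  classical
  have hle : spanLT h μ ≤ Submodule.span ℝ (A.image fun p : ℝ × ℝ => prodMode h p.1 p.2) := by
    rw [spanLT, Submodule.span_le, Finset.coe_image]
    rintro u ⟨ν, hν, hu⟩
    exact hu.mem_span_prodMode hh hA fun p h1 h2 e => hA' p h1 h2 (e ▸ hν)
  refine (Submodule.rank_mono hle).trans ((rank_span_finset_le _).trans ?_)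
  exact_mod_cast Finset.card_image_le

theorem le_rank_spanLE {h μ : ℝ} {A : Finset (ℝ × ℝ)}
    (hA : ∀ p ∈ A, IsIntervalEigenvalue h p.1 ∧ IsIntervalEigenvalue h p.2 ∧ p.1 + p.2 ≤ μ) :
    (A.card : Cardinal) ≤ Module.rank ℝ (spanLE h μ) := by
  have hmem (p : A) : prodMode h p.1.1 p.1.2 ∈ spanLE h μ :=
    Submodule.subset_span ⟨_, (hA p p.2).2.2,
      isEigenvector_prodMode (hA p p.2).1 (hA p p.2).2.1⟩
  have hli : LinearIndependent ℝ fun p : A => prodMode h p.1.1 p.1.2 :=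
    linearIndependent_of_ne_zero_of_inner_eq_zero
      (fun p => prodMode_ne_zero (hA p p.2).1 (hA p p.2).2.1)
      fun p q hpq => inner_prodMode_prodMode_of_ne (hA p p.2).1 (hA p p.2).2.1 (hA q q.2).1
        (hA q q.2).2.1 fun e => hpq (Subtype.ext e)
  have hli' : LinearIndependent ℝ fun p : A => (⟨_, hmem p⟩ : spanLE h μ) :=
    LinearIndependent.of_comp (spanLE h μ).subtype hli
  simpa using hli'.cardinal_le_rank

/-! ### Roots of the characteristic equations -/

/-- `(n + t)²`, with `0 < t ≤ 1`, is a Robin eigenvalue of `I`; here `n` is `1` or `2`. -/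
def TrigRoot (n h t : ℝ) : Prop :=
  0 < t ∧ t ≤ 1 ∧
    (n + t) * Real.cos (t * (Real.pi / 2)) + h * Real.sin (t * (Real.pi / 2)) = 0

/-- `-b²` is the lowest Robin eigenvalue of `I`. -/
def HypRoot (h b : ℝ) : Prop :=
  0 ≤ b ∧ b * Real.sinh (b * (Real.pi / 2)) + h * Real.cosh (b * (Real.pi / 2)) = 0

/-- The Robin parameter for which `(n + t)²` is an eigenvalue. -/
def trigParam (n t : ℝ) : ℝ :=
  -((n + t) * Real.cos (t * (Real.pi / 2)) / Real.sin (t * (Real.pi / 2)))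

/-- The Robin parameter for which `-b²` is an eigenvalue. -/
def hypParam (b : ℝ) : ℝ :=
  -(b * Real.sinh (b * (Real.pi / 2)) / Real.cosh (b * (Real.pi / 2)))

theorem sin_mul_pi_half_pos {t : ℝ} (h0 : 0 < t) (h1 : t ≤ 1) :
    0 < Real.sin (t * (Real.pi / 2)) := by
  have := Real.pi_pos
  exact Real.sin_pos_of_pos_of_lt_pi (by positivity) (by nlinarith)

theorem cos_mul_pi_half_nonneg {t : ℝ} (h0 : 0 < t) (h1 : t ≤ 1) :
    0 ≤ Real.cos (t * (Real.pi / 2)) := by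
  have := Real.pi_pos
  exact Real.cos_nonneg_of_neg_pi_div_two_le_of_le (by nlinarith) (by nlinarith)

theorem trigRoot_iff {n h t : ℝ} (h0 : 0 < t) (h1 : t ≤ 1) :
    TrigRoot n h t ↔ trigParam n t = h := by
  have := sin_mul_pi_half_pos h0 h1
  rw [TrigRoot, trigParam, neg_eq_iff_eq_neg, div_eq_iff this.ne']
  constructor
  · rintro ⟨-, -, e⟩; linarith
  · intro e; exact ⟨h0, h1, by linarith⟩

theorem hypRoot_iff {h b : ℝ} (h0 : 0 ≤ b) : HypRoot h b ↔ hypParam b = h := by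
  have := Real.cosh_pos (b * (Real.pi / 2))
  rw [HypRoot, hypParam, neg_eq_iff_eq_neg, div_eq_iff this.ne']
  constructor
  · rintro ⟨-, e⟩; linarith
  · intro e; exact ⟨h0, by linarith⟩

/-- The derivative of `trigParam n`. -/
def trigParamDeriv (n t : ℝ) : ℝ :=
  (Real.pi / 2 * ((n + t) ^ 2 + trigParam n t ^ 2) + trigParam n t) / (n + t)

theorem hasDerivAt_mul_pi_half (t : ℝ) :
    HasDerivAt (fun t : ℝ => t * (Real.pi / 2)) (Real.pi / 2) t := by
  simpa using (hasDerivAt_id t).mul_const (Real.pi / 2)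

/-- The derivative is expressed through the parameter `trigParam n t` itself, so that after
inversion the derivative of an eigenvalue depends only on that eigenvalue and on `h`. -/
theorem hasDerivAt_trigParam {n t : ℝ} (hn : 0 ≤ n) (h0 : 0 < t) (h1 : t ≤ 1) :
    HasDerivAt (trigParam n) (trigParamDeriv n t) t := by
  have hs := sin_mul_pi_half_pos h0 h1
  have hl := hasDerivAt_mul_pi_half t
  have h2 := ((((hasDerivAt_id t).const_add n).mul hl.cos).div hl.sin hs.ne').neg
  refine h2.congr_deriv ?_
  have hnt : n + t ≠ 0 := by positivity
  have hsc := Real.sin_sq_add_cos_sq (t * (Real.pi / 2))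
  simp only [trigParamDeriv, trigParam, id, Pi.mul_apply]
  clear h2 hl
  generalize Real.sin (t * (Real.pi / 2)) = S at *
  generalize Real.cos (t * (Real.pi / 2)) = C at *
  have hS := hs.ne'
  field_simp
  ring

/-- Multiplied by `sin²` the derivative becomes `(π/2)(n + t) - sin x cos x` with `x = t π/2`, and
`sin x < x`. Hence roots are unique and depend monotonically on `h`. -/
theorem trigParamDeriv_pos {n t : ℝ} (hn : 0 ≤ n) (h0 : 0 < t) (h1 : t ≤ 1) :
    0 < trigParamDeriv n t := by
  have hs := sin_mul_pi_half_pos h0 h1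
  have hc := cos_mul_pi_half_nonneg h0 h1
  have hnt : 0 < n + t := by positivity
  have hpi := Real.pi_pos
  have hsc := Real.sin_sq_add_cos_sq (t * (Real.pi / 2))
  have hsx := Real.sin_lt (show 0 < t * (Real.pi / 2) by positivity)
  have key : trigParamDeriv n t * Real.sin (t * (Real.pi / 2)) ^ 2 =
      Real.pi / 2 * (n + t) - Real.sin (t * (Real.pi / 2)) * Real.cos (t * (Real.pi / 2)) := by
    simp only [trigParamDeriv, trigParam]
    clear hsx
    generalize Real.sin (t * (Real.pi / 2)) = S at *
    generalize Real.cos (t * (Real.pi / 2)) = C at *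
    have hS := hs.ne'
    field_simp
    linear_combination (n + t) * Real.pi * hsc
  have hc1 := Real.cos_le_one (t * (Real.pi / 2))
  have : 0 < trigParamDeriv n t * Real.sin (t * (Real.pi / 2)) ^ 2 := by
    rw [key]; nlinarith
  exact pos_of_mul_pos_left this (by positivity)

theorem strictMonoOn_trigParam {n : ℝ} (hn : 0 ≤ n) : StrictMonoOn (trigParam n) (Ioc 0 1) := by
  refine strictMonoOn_of_deriv_pos (convex_Ioc 0 1)
    (fun t ht => (hasDerivAt_trigParam hn ht.1 ht.2).continuousAt.continuousWithinAt) fun t ht => ?_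
  rw [interior_Ioc] at ht
  rw [(hasDerivAt_trigParam hn ht.1 ht.2.le).deriv]
  exact trigParamDeriv_pos hn ht.1 ht.2.le

theorem exists_trigRoot {n h : ℝ} (hn : 1 ≤ n) (hh : h ≤ 0) : ∃ t, TrigRoot n h t := by
  have hpi := Real.pi_pos
  -- Chosen with `cot (t₀ π/2) = 1 - h`, so that `trigParam n t₀ = -(n + t₀)(1 - h) ≤ h`; the other
  -- endpoint `t = 1` has parameter 0.
  set t₀ := 2 / Real.pi * Real.arctan (1 / (1 - h)) with ht0
  have hx : 0 < 1 / (1 - h) := by have : 0 < 1 - h := by linarith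
                                  positivity
  have hat := Real.arctan_pos.2 hx
  have hat' := Real.arctan_lt_pi_div_two (1 / (1 - h))
  have e : t₀ * (Real.pi / 2) = Real.arctan (1 / (1 - h)) := by rw [ht0]; field_simp
  have h0 : 0 < t₀ := by positivity
  have h1 : t₀ ≤ 1 := by
    by_contra! hc
    nlinarith
  have hs := sin_mul_pi_half_pos h0 h1
  have hcpos := Real.cos_arctan_pos (1 / (1 - h))
  have htan : Real.cos (t₀ * (Real.pi / 2)) = (1 - h) * Real.sin (t₀ * (Real.pi / 2)) := by
    have h2 := Real.tan_arctan (1 / (1 - h))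
    rw [← e, Real.tan_eq_sin_div_cos, div_eq_div_iff (by rw [e]; exact hcpos.ne') (by linarith)] at h2
    linarith
  have hlo : trigParam n t₀ ≤ h := by
    rw [trigParam, htan, ← mul_assoc, mul_div_cancel_right₀ _ hs.ne']
    nlinarith
  have hhi : trigParam n 1 = 0 := by simp [trigParam]
  have hcont : ContinuousOn (trigParam n) (Icc t₀ 1) := fun t ht =>
    (hasDerivAt_trigParam (by linarith) (h0.trans_le ht.1) ht.2).continuousAt.continuousWithinAt
  obtain ⟨t, ht, e⟩ := intermediate_value_Icc h1 hcont ⟨hlo, hhi.symm ▸ hh⟩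
  exact ⟨t, (trigRoot_iff (h0.trans_le ht.1) ht.2).2 e⟩

/-- The characteristic expression at `t₀` equals `sin (t₀ π/2) * (h - trigParam n t₀)`, so its sign
tells on which side of the root `t₀` lies. -/
theorem TrigRoot.le_of_nonneg {n h t t₀ : ℝ} (hn : 0 ≤ n) (ht : TrigRoot n h t) (h0 : 0 < t₀)
    (h1 : t₀ ≤ 1) (hc : 0 ≤ (n + t₀) * Real.cos (t₀ * (Real.pi / 2)) +
      h * Real.sin (t₀ * (Real.pi / 2))) : t₀ ≤ t := by
  have hs := sin_mul_pi_half_pos h0 h1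
  rw [← (strictMonoOn_trigParam hn).le_iff_le ⟨h0, h1⟩ ⟨ht.1, ht.2.1⟩,
    (trigRoot_iff ht.1 ht.2.1).1 ht, trigParam, neg_le, le_div_iff₀ hs]
  linarith

theorem TrigRoot.le_of_nonpos {n h t t₀ : ℝ} (hn : 0 ≤ n) (ht : TrigRoot n h t) (h0 : 0 < t₀)
    (h1 : t₀ ≤ 1) (hc : (n + t₀) * Real.cos (t₀ * (Real.pi / 2)) +
      h * Real.sin (t₀ * (Real.pi / 2)) ≤ 0) : t ≤ t₀ := by
  have hs := sin_mul_pi_half_pos h0 h1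
  rw [← (strictMonoOn_trigParam hn).le_iff_le ⟨ht.1, ht.2.1⟩ ⟨h0, h1⟩,
    (trigRoot_iff ht.1 ht.2.1).1 ht, trigParam, le_neg, div_le_iff₀ hs]
  linarith

theorem TrigRoot.unique {n h t t' : ℝ} (hn : 0 ≤ n) (ht : TrigRoot n h t)
    (ht' : TrigRoot n h t') : t = t' :=
  le_antisymm (ht.le_of_nonpos hn ht'.1 ht'.2.1 ht'.2.2.le)
    (ht.le_of_nonneg hn ht'.1 ht'.2.1 ht'.2.2.ge)

/-- The derivative of `hypParam`. -/
def hypParamDeriv (b : ℝ) : ℝ :=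
  -((Real.pi / 2 * (b ^ 2 - hypParam b ^ 2) - hypParam b) / b)

theorem hasDerivAt_hypParam_aux (b : ℝ) :
    HasDerivAt hypParam (-(Real.sinh (b * (Real.pi / 2)) * Real.cosh (b * (Real.pi / 2)) +
      b * (Real.pi / 2)) / Real.cosh (b * (Real.pi / 2)) ^ 2) b := by
  have hc := Real.cosh_pos (b * (Real.pi / 2))
  have hl := hasDerivAt_mul_pi_half b
  have h2 := (((hasDerivAt_id b).mul hl.sinh).div hl.cosh hc.ne').neg
  refine h2.congr_deriv ?_
  have hsc := Real.cosh_sq (b * (Real.pi / 2))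
  simp only [id, Pi.mul_apply]
  rw [← neg_div]
  congr 1
  linear_combination (-b * (Real.pi / 2)) * hsc

theorem hasDerivAt_hypParam {b : ℝ} (hb : b ≠ 0) : HasDerivAt hypParam (hypParamDeriv b) b := by
  refine (hasDerivAt_hypParam_aux b).congr_deriv ?_
  have hc := Real.cosh_pos (b * (Real.pi / 2))
  have hsc := Real.cosh_sq (b * (Real.pi / 2))
  simp only [hypParamDeriv, hypParam]
  generalize Real.sinh (b * (Real.pi / 2)) = S at *
  generalize Real.cosh (b * (Real.pi / 2)) = C at *
  have hC := hc.ne'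
  field_simp
  linear_combination Real.pi * b * hsc

theorem continuous_hypParam : Continuous hypParam :=
  continuous_iff_continuousAt.2 fun b => (hasDerivAt_hypParam_aux b).continuousAt

theorem strictAntiOn_hypParam : StrictAntiOn hypParam (Ici 0) := by
  refine strictAntiOn_of_deriv_neg (convex_Ici 0) continuous_hypParam.continuousOn fun b hb => ?_
  rw [interior_Ici] at hb
  have hb : 0 < b := hb
  have hpi := Real.pi_pos
  rw [(hasDerivAt_hypParam_aux b).deriv]
  have hc := Real.cosh_pos (b * (Real.pi / 2))
  have hs : 0 < Real.sinh (b * (Real.pi / 2)) := Real.sinh_pos_iff.2 (by positivity)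
  rw [neg_div, neg_lt_zero]
  positivity

theorem exists_hypRoot {h : ℝ} (hh : h ≤ 0) : ∃ b, HypRoot h b := by
  have hpi := Real.pi_gt_three
  have h0 : 0 ≤ 2 - 2 * h := by linarith
  have hc := Real.cosh_pos ((2 - 2 * h) * (Real.pi / 2))
  -- At `x = (2 - 2h) π/2 ≥ 1` one has `cosh x ≤ sinh x + 1 ≤ 2 sinh x`, so `b tanh x ≥ b/2 = 1 - h`
  -- for `b = 2 - 2h`.
  have hlo : hypParam (2 - 2 * h) ≤ h := by
    rw [hypParam, neg_le, le_div_iff₀ hc]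
    have h1 : 1 ≤ (2 - 2 * h) * (Real.pi / 2) := by nlinarith
    have h2 := Real.self_le_sinh_iff.2 (by linarith : 0 ≤ (2 - 2 * h) * (Real.pi / 2))
    have h3 := Real.cosh_sub_sinh ((2 - 2 * h) * (Real.pi / 2))
    have h4 : Real.exp (-((2 - 2 * h) * (Real.pi / 2))) ≤ 1 := Real.exp_le_one_iff.2 (by linarith)
    nlinarith
  obtain ⟨b, hb, e⟩ := intermediate_value_Icc' h0 continuous_hypParam.continuousOn
    ⟨hlo, (by simpa [hypParam] using hh : h ≤ hypParam 0)⟩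
  exact ⟨b, (hypRoot_iff hb.1).2 e⟩

theorem HypRoot.le_of_nonpos {h b b₀ : ℝ} (hb : HypRoot h b) (h0 : 0 ≤ b₀)
    (hc : b₀ * Real.sinh (b₀ * (Real.pi / 2)) + h * Real.cosh (b₀ * (Real.pi / 2)) ≤ 0) :
    b₀ ≤ b := by
  have hs := Real.cosh_pos (b₀ * (Real.pi / 2))
  rw [← strictAntiOn_hypParam.le_iff_ge (mem_Ici.2 hb.1) (mem_Ici.2 h0),
    (hypRoot_iff hb.1).1 hb, hypParam, le_neg, div_le_iff₀ hs]
  linarith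

theorem HypRoot.le_of_nonneg {h b b₀ : ℝ} (hb : HypRoot h b) (h0 : 0 ≤ b₀)
    (hc : 0 ≤ b₀ * Real.sinh (b₀ * (Real.pi / 2)) + h * Real.cosh (b₀ * (Real.pi / 2))) :
    b ≤ b₀ := by
  have hs := Real.cosh_pos (b₀ * (Real.pi / 2))
  rw [← strictAntiOn_hypParam.le_iff_ge (mem_Ici.2 h0) (mem_Ici.2 hb.1),
    (hypRoot_iff hb.1).1 hb, hypParam, neg_le, le_div_iff₀ hs]
  linarith

theorem HypRoot.unique {h b b' : ℝ} (hb : HypRoot h b) (hb' : HypRoot h b') : b = b' :=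
  le_antisymm (hb.le_of_nonneg hb'.1 hb'.2.ge) (hb.le_of_nonpos hb'.1 hb'.2.le)

/-- The inverse of a strictly increasing bijection between open sets has the expected
derivative. -/
theorem hasDerivAt_inverse {f g f' : ℝ → ℝ} {J T : Set ℝ} (hJ : IsOpen J) (hT : IsOpen T)
    (hmono : StrictMonoOn f J) (hd : ∀ x ∈ J, HasDerivAt f (f' x) x) (hf' : ∀ x ∈ J, f' x ≠ 0)
    (hfT : MapsTo f J T) (hg : MapsTo g T J) (hfg : ∀ h ∈ T, f (g h) = h) {h : ℝ} (hh : h ∈ T) :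
    HasDerivAt g (f' (g h))⁻¹ h := by
  have hgm : StrictMonoOn g T := fun x hx y hy hxy => by
    rw [← hmono.lt_iff_lt (hg hx) (hg hy), hfg x hx, hfg y hy]; exact hxy
  have himg : J ⊆ g '' T := fun x hx =>
    ⟨f x, hfT hx, hmono.injOn (hg (hfT hx)) hx (hfg _ (hfT hx))⟩
  have hcont : ContinuousAt g h := hgm.continuousAt_of_image_mem_nhds (hT.mem_nhds hh)
    (Filter.mem_of_superset (hJ.mem_nhds (hg hh)) himg)
  refine (hd _ (hg hh)).of_local_left_inverse hcont (hf' _ (hg hh)) ?_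
  filter_upwards [hT.mem_nhds hh] with y hy using hfg y hy

/-! ### Taylor bounds for sine and cosine -/

/-- Partial sums of the Taylor series of the sine. -/
def sinPartial (n : ℕ) (x : ℝ) : ℝ :=
  ∑ k ∈ Finset.range n, (-1) ^ k * (x ^ (2 * k + 1) / (2 * k + 1).factorial)

/-- Partial sums of the Taylor series of the cosine. -/
def cosPartial (n : ℕ) (x : ℝ) : ℝ :=
  ∑ k ∈ Finset.range n, (-1) ^ k * (x ^ (2 * k) / (2 * k).factorial)

theorem hasDerivAt_pow_div_factorial (m : ℕ) (x : ℝ) :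
    HasDerivAt (fun x : ℝ => x ^ (m + 1) / (m + 1).factorial) (x ^ m / m.factorial) x := by
  refine ((hasDerivAt_pow (m + 1) x).div_const _).congr_deriv ?_
  rw [Nat.factorial_succ]
  push_cast
  field_simp

theorem hasDerivAt_sinPartial (n : ℕ) (x : ℝ) : HasDerivAt (sinPartial n) (cosPartial n x) x :=
  HasDerivAt.fun_sum fun k _ => (hasDerivAt_pow_div_factorial (2 * k) x).const_mul _

theorem hasDerivAt_cosPartial (n : ℕ) (x : ℝ) :
    HasDerivAt (cosPartial (n + 1)) (-sinPartial n x) x := by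
  have e : cosPartial (n + 1) = fun x => (∑ k ∈ Finset.range n,
      (-1 : ℝ) ^ (k + 1) * (x ^ (2 * k + 1 + 1) / (2 * k + 1 + 1).factorial)) + 1 := by
    ext y
    rw [cosPartial, Finset.sum_range_succ']
    simp [mul_add]
  rw [e, sinPartial, ← Finset.sum_neg_distrib]
  refine (HasDerivAt.fun_sum fun k _ =>
    (hasDerivAt_pow_div_factorial (2 * k + 1) x).const_mul ((-1) ^ (k + 1))).add_const 1
    |>.congr_deriv ?_
  refine Finset.sum_congr rfl fun k _ => ?_
  ring

theorem nonneg_of_deriv_nonneg {f f' : ℝ → ℝ} (hd : ∀ x, HasDerivAt f (f' x) x)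
    (hf' : ∀ x, 0 ≤ x → 0 ≤ f' x) (h0 : f 0 = 0) {x : ℝ} (hx : 0 ≤ x) : 0 ≤ f x := by
  have hm : MonotoneOn f (Ici 0) := by
    refine monotoneOn_of_deriv_nonneg (convex_Ici 0)
      (fun y _ => (hd y).continuousAt.continuousWithinAt)
      (fun y _ => (hd y).differentiableAt.differentiableWithinAt) fun y hy => ?_
    rw [(hd y).deriv]
    exact hf' y (interior_subset hy)
  rw [← h0]
  exact hm (mem_Ici.2 le_rfl) hx hx

/-- Starting from `cos ≤ 1`, integration from 0 alternates between cosine and sine; a partial sum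
with `n + 1` terms has an error of sign `(-1) ^ n` on `[0, ∞)`. -/
theorem taylor_bounds (n : ℕ) : (∀ x : ℝ, 0 ≤ x → 0 ≤ (-1) ^ n * (cosPartial (n + 1) x - Real.cos x)) ∧
    ∀ x : ℝ, 0 ≤ x → 0 ≤ (-1) ^ n * (sinPartial (n + 1) x - Real.sin x) := by
  have step (n : ℕ) (hc : ∀ x : ℝ, 0 ≤ x → 0 ≤ (-1) ^ n * (cosPartial (n + 1) x - Real.cos x)) :
      ∀ x : ℝ, 0 ≤ x → 0 ≤ (-1) ^ n * (sinPartial (n + 1) x - Real.sin x) := fun x hx =>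
    nonneg_of_deriv_nonneg (fun y => ((hasDerivAt_sinPartial (n + 1) y).sub
      (Real.hasDerivAt_sin y)).const_mul ((-1) ^ n)) hc (by simp [sinPartial]) hx
  induction n with
  | zero =>
    have h0 : ∀ x : ℝ, 0 ≤ x → 0 ≤ (-1) ^ 0 * (cosPartial (0 + 1) x - Real.cos x) := fun x _ => by
      simpa [cosPartial] using Real.cos_le_one x
    exact ⟨h0, step 0 h0⟩
  | succ n ih =>
    have hc : ∀ x : ℝ, 0 ≤ x → 0 ≤ (-1) ^ (n + 1) * (cosPartial (n + 1 + 1) x - Real.cos x) :=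
      fun x hx => nonneg_of_deriv_nonneg (fun y => ((hasDerivAt_cosPartial (n + 1) y).sub
        (Real.hasDerivAt_cos y)).const_mul ((-1) ^ (n + 1)))
        (fun y hy => (ih.2 y hy).trans_eq (by ring))
        (by
          have : cosPartial (n + 1 + 1) 0 = 1 := by
            rw [cosPartial, Finset.sum_range_succ']
            simp
          simp [this]) hx
    exact ⟨hc, step _ hc⟩

/-! ### Rational enclosures of the roots at the two bracketing parameters -/

/-- For `h ≤ 0` the expression decreases in the angle on `[0, π/2]`, so the angle can be replaced by
a smaller rational `x`. Five terms overestimate the cosine and six underestimate the sine, which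
leaves rational arithmetic. -/
theorem trigExpr_nonpos {n h t x : ℝ} (hn : 0 ≤ n) (hh : h ≤ 0) (h0 : 0 < t) (h1 : t ≤ 1)
    (hx0 : 0 ≤ x) (hx : x ≤ t * (Real.pi / 2))
    (hv : (n + t) * cosPartial 5 x + h * sinPartial 6 x ≤ 0) :
    (n + t) * Real.cos (t * (Real.pi / 2)) + h * Real.sin (t * (Real.pi / 2)) ≤ 0 := by
  have hpi := Real.pi_pos
  have h2 : t * (Real.pi / 2) ≤ Real.pi / 2 := by nlinarith
  have hc := Real.cos_le_cos_of_nonneg_of_le_pi hx0 (by linarith) hx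
  have hs := Real.sin_le_sin_of_le_of_le_pi_div_two (by linarith) h2 hx
  have h3 := (taylor_bounds 4).1 x hx0
  have h4 := (taylor_bounds 5).2 x hx0
  norm_num at h3 h4
  have h5 : (n + t) * Real.cos (t * (Real.pi / 2)) ≤ (n + t) * cosPartial 5 x :=
    mul_le_mul_of_nonneg_left (hc.trans h3) (by positivity)
  have h6 : h * Real.sin (t * (Real.pi / 2)) ≤ h * sinPartial 6 x :=
    mul_le_mul_of_nonpos_left (h4.trans hs) hh
  linarith

theorem trigExpr_nonneg {n h t x : ℝ} (hn : 0 ≤ n) (hh : h ≤ 0) (h0 : 0 < t)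
    (hx0 : x ≤ 3 / 2) (hx : t * (Real.pi / 2) ≤ x)
    (hv : 0 ≤ (n + t) * cosPartial 6 x + h * sinPartial 5 x) :
    0 ≤ (n + t) * Real.cos (t * (Real.pi / 2)) + h * Real.sin (t * (Real.pi / 2)) := by
  have hpi := Real.pi_gt_three
  have h2 : 0 < t * (Real.pi / 2) := by positivity
  have hc := Real.cos_le_cos_of_nonneg_of_le_pi h2.le (by linarith) hx
  have hs := Real.sin_le_sin_of_le_of_le_pi_div_two (by linarith) (by linarith) hx
  have h3 := (taylor_bounds 5).1 x (by linarith)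
  have h4 := (taylor_bounds 4).2 x (by linarith)
  norm_num at h3 h4
  have h5 : (n + t) * cosPartial 6 x ≤ (n + t) * Real.cos (t * (Real.pi / 2)) :=
    mul_le_mul_of_nonneg_left (h3.trans hc) (by positivity)
  have h6 : h * sinPartial 5 x ≤ h * Real.sin (t * (Real.pi / 2)) :=
    mul_le_mul_of_nonpos_left (hs.trans h4) hh
  linarith

/-- Reduces the sign of the hyperbolic expression to a comparison of the single number `exp (b π)`
with `(b - h) / (b + h)`. -/
theorem hypExpr_eq (h b : ℝ) :
    (b * Real.sinh (b * (Real.pi / 2)) + h * Real.cosh (b * (Real.pi / 2))) *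
      (2 * Real.exp (b * (Real.pi / 2))) = (b + h) * Real.exp (b * Real.pi) + (h - b) := by
  have e : Real.exp (b * Real.pi) = Real.exp (b * (Real.pi / 2)) ^ 2 := by
    rw [← Real.exp_nat_mul]; congr 1; push_cast; ring
  rw [e, Real.sinh_eq, Real.cosh_eq, Real.exp_neg]
  have := (Real.exp_pos (b * (Real.pi / 2))).ne'
  field_simp
  ring

theorem hypRoot_lower {b : ℝ} (hb : HypRoot (-1.62935) b) : 1.647843 ≤ b := by
  refine hb.le_of_nonpos (by norm_num) ?_
  have hpi := Real.pi_lt_d6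
  -- The threshold `(b - h) / (b + h)` is about `177.21`. The exponent is split as `5 + 0.176853`,
  -- combining the known digits of `e` with a short Taylor sum.
  have h1 : Real.exp (1.647843 * Real.pi) ≤ 177.15 := by
    have h2 : Real.exp (1.647843 * Real.pi) ≤ Real.exp ((5 : ℕ) * 1 + 0.176853) :=
      Real.exp_le_exp.2 (by push_cast; linarith)
    have h3 := Real.exp_bound' (x := 0.176853) (by norm_num) (by norm_num) (n := 5) (by norm_num)
    have h4 := Real.exp_one_lt_d9
    have h5 : Real.exp 1 ^ 5 ≤ 2.7182818286 ^ 5 :=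
      pow_le_pow_left₀ (Real.exp_pos 1).le h4.le 5
    rw [Real.exp_add, Real.exp_nat_mul] at h2
    refine h2.trans ((mul_le_mul h5 h3 (Real.exp_pos _).le (by positivity)).trans ?_)
    norm_num [Finset.sum_range_succ, Nat.factorial]
  have h2 := hypExpr_eq (-1.62935) 1.647843
  have h3 := Real.exp_pos (1.647843 * (Real.pi / 2))
  by_contra! hcon
  have := mul_pos hcon (by positivity : 0 < 2 * Real.exp (1.647843 * (Real.pi / 2)))
  rw [h2] at this
  nlinarith

theorem hypRoot_upper {b : ℝ} (hb : HypRoot (-1.62925) b) : b ≤ 1.64777 := by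
  refine hb.le_of_nonneg (by norm_num) ?_
  have hpi := Real.pi_gt_d6
  -- Here `(b - h) / (b + h)` is about `176.94`.
  have h1 : 177.05 ≤ Real.exp (1.64777 * Real.pi) := by
    have h2 : Real.exp ((5 : ℕ) * 1 + 0.17662) ≤ Real.exp (1.64777 * Real.pi) :=
      Real.exp_le_exp.2 (by push_cast; linarith)
    have h3 := Real.sum_le_exp_of_nonneg (x := 0.17662) (by norm_num) 5
    have h4 := Real.exp_one_gt_d9
    have h5 : 2.7182818283 ^ 5 ≤ Real.exp 1 ^ 5 :=
      pow_le_pow_left₀ (by norm_num) h4.le 5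
    rw [Real.exp_add, Real.exp_nat_mul] at h2
    refine le_trans ?_ ((mul_le_mul h5 h3 ?_ (by positivity)).trans h2)
    · norm_num [Finset.sum_range_succ, Nat.factorial]
    · exact Finset.sum_nonneg fun i _ => by positivity
  have h2 := hypExpr_eq (-1.62925) 1.64777
  have h3 := Real.exp_pos (1.64777 * (Real.pi / 2))
  by_contra! hcon
  have := mul_neg_of_neg_of_pos hcon (by positivity : 0 < 2 * Real.exp (1.64777 * (Real.pi / 2)))
  rw [h2] at this
  nlinarith

/-- A lower bound for `b`, an upper one for `t` and a lower one for `s`. The two sides differ after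
rounding only by about `1.5 * 10⁻⁵`, hence the number of digits. -/
theorem gap_neg_at {b s t : ℝ} (hb : HypRoot (-1.62935) b) (hs : TrigRoot 1 (-1.62935) s)
    (ht : TrigRoot 2 (-1.62935) t) : (2 + t) ^ 2 - b ^ 2 < 2 * (1 + s) ^ 2 := by
  have h1 := hypRoot_lower hb
  have hpi := Real.pi_gt_d6
  have hpi' := Real.pi_lt_d6
  have h2 : t ≤ 0.648945 := by
    refine ht.le_of_nonpos (by norm_num) (by norm_num) (by norm_num) ?_
    refine trigExpr_nonpos (x := 1.01936) (by norm_num) (by norm_num) (by norm_num) (by norm_num)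
      (by norm_num) (by linarith) ?_
    norm_num [cosPartial, sinPartial, Finset.sum_range_succ, Nat.factorial]
  have h3 : 0.46655 ≤ s := by
    refine hs.le_of_nonneg (by norm_num) (by norm_num) (by norm_num) ?_
    refine trigExpr_nonneg (x := 0.732856) (by norm_num) (by norm_num) (by norm_num)
      (by norm_num) (by linarith) ?_
    norm_num [cosPartial, sinPartial, Finset.sum_range_succ, Nat.factorial]
  have := ht.1
  nlinarith

theorem gap_pos_at {b s t : ℝ} (hb : HypRoot (-1.62925) b) (hs : TrigRoot 1 (-1.62925) s)
    (ht : TrigRoot 2 (-1.62925) t) : 2 * (1 + s) ^ 2 < (2 + t) ^ 2 - b ^ 2 := by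
  have h1 := hypRoot_upper hb
  have hpi := Real.pi_gt_d6
  have hpi' := Real.pi_lt_d6
  have h2 : 0.64895 ≤ t := by
    refine ht.le_of_nonneg (by norm_num) (by norm_num) (by norm_num) ?_
    refine trigExpr_nonneg (x := 1.019369) (by norm_num) (by norm_num) (by norm_num)
      (by norm_num) (by linarith) ?_
    norm_num [cosPartial, sinPartial, Finset.sum_range_succ, Nat.factorial]
  have h3 : s ≤ 0.466585 := by
    refine hs.le_of_nonpos (by norm_num) (by norm_num) (by norm_num) ?_
    refine trigExpr_nonpos (x := 0.732909) (by norm_num) (by norm_num) (by norm_num) (by norm_num)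
      (by norm_num) (by linarith) ?_
    norm_num [cosPartial, sinPartial, Finset.sum_range_succ, Nat.factorial]
  have := hs.1
  have := hb.1
  nlinarith

/-! ### The critical Robin parameter -/

theorem HypRoot.sq_sub_sq {h b : ℝ} (hb : HypRoot h b) :
    (b ^ 2 - h ^ 2) * Real.cosh (b * (Real.pi / 2)) ^ 2 = b ^ 2 := by
  have hsc := Real.cosh_sq (b * (Real.pi / 2))
  linear_combination b ^ 2 * hsc + (b * Real.sinh (b * (Real.pi / 2)) -
    h * Real.cosh (b * (Real.pi / 2))) * hb.2

theorem HypRoot.sq_le {h b : ℝ} (hb : HypRoot h b) : h ^ 2 ≤ b ^ 2 := by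
  have h1 := hb.sq_sub_sq
  have hc := pow_pos (Real.cosh_pos (b * (Real.pi / 2))) 2
  by_contra! hcon
  nlinarith [sq_nonneg b]

/-- Inserting `cosh x ≥ x` into `HypRoot.sq_sub_sq` bounds `b² - h²` by `(2/π)²`: the lowest
eigenvalue stays close to `-h²`. -/
theorem HypRoot.sq_sub_le {h b : ℝ} (hb : HypRoot h b) :
    (b ^ 2 - h ^ 2) * (Real.pi / 2) ^ 2 ≤ 1 := by
  have hpi := Real.pi_pos
  rcases hb.1.eq_or_lt with h0 | h0
  · rw [← h0]
    nlinarith [sq_nonneg (h * (Real.pi / 2))]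
  · have h1 := hb.sq_sub_sq
    have h2 := hb.sq_le
    have h3 : b * (Real.pi / 2) ≤ Real.cosh (b * (Real.pi / 2)) :=
      (Real.self_le_sinh_iff.2 (by positivity : 0 ≤ b * (Real.pi / 2))).trans (Real.sinh_lt_cosh _).le
    have h4 : (b * (Real.pi / 2)) ^ 2 ≤ Real.cosh (b * (Real.pi / 2)) ^ 2 :=
      pow_le_pow_left₀ (by positivity) h3 2
    have h5 : (b ^ 2 - h ^ 2) * (b * (Real.pi / 2)) ^ 2 ≤ b ^ 2 := by
      exact (mul_le_mul_of_nonneg_left h4 (sub_nonneg.2 h2)).trans_eq h1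
    have h6 : 0 < b ^ 2 := by positivity
    by_contra! hcon
    nlinarith

/-- At the root `s` for `n = 1` the expression for `n = 2` exceeds it by `cos (s π/2) ≥ 0`. -/
theorem TrigRoot.one_le_two {h s t : ℝ} (hs : TrigRoot 1 h s) (ht : TrigRoot 2 h t) : s ≤ t := by
  refine ht.le_of_nonneg (by norm_num) hs.1 hs.2.1 ?_
  have := cos_mul_pi_half_nonneg hs.1 hs.2.1
  have := hs.2.2
  linarith

/-- In this range `b² (π/2)² ≤ 2`, so `b² < 1`, while `s ≤ t` gives `(2 + t)² - 2 (1 + s)² ≥ 2 - s²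
≥ 1`. -/
theorem gap_pos_of_ge {h b s t : ℝ} (hh : h ≤ 0) (hh' : -1 ≤ h * (Real.pi / 2))
    (hb : HypRoot h b) (hs : TrigRoot 1 h s) (ht : TrigRoot 2 h t) :
    2 * (1 + s) ^ 2 < (2 + t) ^ 2 - b ^ 2 := by
  have h1 := hb.sq_sub_le
  have h2 := hs.one_le_two ht
  have hpi := Real.pi_gt_three
  have h3 : (h * (Real.pi / 2)) ^ 2 ≤ 1 := by
    have : h * (Real.pi / 2) ≤ 0 := mul_nonpos_of_nonpos_of_nonneg hh (by positivity)
    nlinarith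
  have h4 : b ^ 2 * (Real.pi / 2) ^ 2 ≤ 2 := by nlinarith
  have h5 : b ^ 2 < 1 := by
    by_contra! hcon
    nlinarith
  have := hs.1
  have := hs.2.1
  nlinarith

theorem exists_critical_parameter : ∃ h₉ : ℝ, h₉ < 0 ∧ |h₉ - (-1.6293)| < 0.00005 ∧
    (∀ h b s t : ℝ, h₉ ≤ h → h ≤ 0 → HypRoot h b → TrigRoot 1 h s → TrigRoot 2 h t →
      2 * (1 + s) ^ 2 ≤ (2 + t) ^ 2 - b ^ 2) ∧
    ∀ h b s t : ℝ, h < h₉ → HypRoot h b → TrigRoot 1 h s → TrigRoot 2 h t →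
      (2 + t) ^ 2 - b ^ 2 < 2 * (1 + s) ^ 2 := by
  have hpi := Real.pi_gt_three
  have hB : ∀ h : ℝ, h < 0 → ∃ b, HypRoot h b := fun h hh => exists_hypRoot hh.le
  have hS : ∀ h : ℝ, h < 0 → ∃ b, TrigRoot 1 h b := fun h hh => exists_trigRoot le_rfl hh.le
  have hT : ∀ h : ℝ, h < 0 → ∃ b, TrigRoot 2 h b := fun h hh => exists_trigRoot (by norm_num) hh.le
  choose! B hB using hB
  choose! S hS using hS
  choose! T hT using hT
  have dTrig (n : ℝ) (hn : 0 ≤ n) (g : ℝ → ℝ) (hg : ∀ h < 0, TrigRoot n h (g h)) (h : ℝ)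
      (hh : h < 0) : HasDerivAt (fun h => (n + g h) ^ 2)
        (2 * (n + g h) ^ 2 / (Real.pi / 2 * ((n + g h) ^ 2 + h ^ 2) + h)) h := by
    have h1 (h : ℝ) (hh : h < 0) : trigParam n (g h) = h :=
      (trigRoot_iff (hg h hh).1 (hg h hh).2.1).1 (hg h hh)
    have e1 : trigParam n 1 = 0 := by simp [trigParam]
    have h2 := hasDerivAt_inverse (f := trigParam n) (g := g) (f' := trigParamDeriv n) isOpen_Ioo
      isOpen_Iio ((strictMonoOn_trigParam hn).mono Ioo_subset_Ioc_self)
      (fun x hx => hasDerivAt_trigParam hn hx.1 hx.2.le)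
      (fun x hx => (trigParamDeriv_pos hn hx.1 hx.2.le).ne')
      (fun x hx => by
        rw [mem_Iio, ← e1]
        exact strictMonoOn_trigParam hn ⟨hx.1, hx.2.le⟩ ⟨one_pos, le_rfl⟩ hx.2)
      (fun x hx => ⟨(hg x hx).1, lt_of_le_of_ne (hg x hx).2.1 fun e => by
        have := h1 x hx; rw [e, e1] at this; exact hx.ne this.symm⟩) h1 (mem_Iio.2 hh)
    have h3 := trigParamDeriv_pos hn (hg h hh).1 (hg h hh).2.1
    have h4 : 0 < n + g h := add_pos_of_nonneg_of_pos hn (hg h hh).1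
    refine ((h2.const_add n).pow 2).congr_deriv ?_
    rw [trigParamDeriv, h1 h hh] at h3 ⊢
    have h5 := (div_pos_iff_of_pos_right h4).1 h3
    generalize n + g h = a at *
    field_simp
    norm_num
  have dHyp (h : ℝ) (hh : h < 0) : HasDerivAt (fun h => -(B h) ^ 2)
        (2 * (B h) ^ 2 / (Real.pi / 2 * ((B h) ^ 2 - h ^ 2) - h)) h := by
    have heven (b : ℝ) : hypParam (-b) = hypParam b := by simp [hypParam]
    have h1 (h : ℝ) (hh : h < 0) : hypParam (-B h) = h :=
      (heven _).trans ((hypRoot_iff (hB h hh).1).1 (hB h hh))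
    have e0 : hypParam 0 = 0 := by simp [hypParam]
    have hneg (x : ℝ) (hx : x < 0) : hypParam x < 0 := by
      rw [← e0, ← heven]
      exact strictAntiOn_hypParam (mem_Ici.2 le_rfl) (mem_Ici.2 (by linarith)) (by linarith)
    have hBpos (x : ℝ) (hx : x < 0) : 0 < B x := lt_of_le_of_ne (hB x hx).1 fun e => by
      have := h1 x hx; rw [← e, neg_zero, e0] at this; exact hx.ne this.symm
    have hden (x : ℝ) (hx : x < 0) : 0 < Real.pi / 2 * (x ^ 2 - hypParam x ^ 2) - hypParam x := by
      have h2 : HypRoot (hypParam x) (-x) := (hypRoot_iff (by linarith)).2 (heven x)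
      have h3 := h2.sq_le
      have h4 := hneg x hx
      rw [neg_sq] at h3
      have : 0 ≤ Real.pi / 2 * (x ^ 2 - hypParam x ^ 2) := mul_nonneg (by positivity) (by linarith)
      linarith
    -- `hypParam` is even and decreasing on `[0, ∞)`, so it is increasing on negative arguments; the
    -- root is taken as `-B h` to have an increasing bijection.
    have h2 := hasDerivAt_inverse (f := hypParam) (g := fun h => -B h) (f' := hypParamDeriv)
      isOpen_Iio isOpen_Iio
      (fun x hx y hy hxy => by
        rw [← heven x, ← heven y]
        have hx : x < 0 := hx
        have hy : y < 0 := hy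
        exact strictAntiOn_hypParam (mem_Ici.2 (by linarith)) (mem_Ici.2 (by linarith))
          (by linarith))
      (fun x hx => hasDerivAt_hypParam (ne_of_lt hx))
      (fun x hx => neg_ne_zero.2 (div_ne_zero (hden x hx).ne' (ne_of_lt hx)))
      (fun x hx => hneg x hx) (fun x hx => neg_lt_zero.2 (hBpos x hx)) h1 (mem_Iio.2 hh)
    have h3 : HasDerivAt (fun h => -(-B h) ^ 2) _ h := (h2.pow 2).neg
    simp only [neg_sq] at h3
    refine h3.congr_deriv ?_
    have h4 := hden _ (neg_lt_zero.2 (hBpos h hh))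
    rw [h1 h hh, neg_sq] at h4
    rw [hypParamDeriv, h1 h hh, neg_sq]
    have h5 := hBpos h hh
    generalize B h = a at *
    field_simp
    push_cast
    ring
  set F : ℝ → ℝ := fun h => -(B h) ^ 2 + (2 + T h) ^ 2 - 2 * (1 + S h) ^ 2 with hF
  have dF (h : ℝ) (hh : h < 0) : HasDerivAt F _ h :=
    ((dHyp h hh).add (dTrig 2 (by norm_num) T hT h hh)).sub
      ((dTrig 1 (by norm_num) S hS h hh).const_mul 2)
  have hneg (h : ℝ) (hh : h ∈ Iio (-(1 / (Real.pi / 2)))) : h < 0 ∧ h * (Real.pi / 2) < -1 := by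
    have hc : 0 < Real.pi / 2 := by positivity
    have hh : h < -(1 / (Real.pi / 2)) := hh
    refine ⟨hh.trans (neg_lt_zero.2 (by positivity)), ?_⟩
    rw [lt_neg, div_lt_iff₀ hc] at hh
    linarith
  have hmono : StrictMonoOn F (Iio (-(1 / (Real.pi / 2)))) := by
    refine strictMonoOn_of_deriv_pos (convex_Iio _)
      (fun h hh => (dF h (hneg h hh).1).continuousAt.continuousWithinAt) fun h hh => ?_
    rw [interior_Iio] at hh
    obtain ⟨h0, h1⟩ := hneg h hh
    rw [(dF h h0).deriv]
    have hb := (hB h h0).sq_le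
    have hst := (hS h h0).one_le_two (hT h h0)
    have hs0 := (hS h h0).1
    have hA : (1 + S h) ^ 2 < (2 + T h) ^ 2 := by nlinarith
    have hS2 : 0 < (1 + S h) ^ 2 := by positivity
    have hb0 : 0 < B h ^ 2 := lt_of_lt_of_le (sq_pos_of_neg h0) hb
    set c := Real.pi / 2 with hc
    have hc0 : 0 < c := by positivity
    have hd : 0 < c * h ^ 2 + h := by nlinarith
    have hq : 0 < c * (B h ^ 2 - h ^ 2) - h := by
      have : 0 ≤ c * (B h ^ 2 - h ^ 2) := mul_nonneg hc0.le (by linarith)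
      linarith
    generalize (1 + S h) ^ 2 = s at *
    generalize (2 + T h) ^ 2 = t at *
    generalize B h ^ 2 = b at *
    have d1 : 0 < c * (s + h ^ 2) + h := by nlinarith
    have d2 : 0 < c * (t + h ^ 2) + h := by nlinarith
    -- With `d = c h² + h > 0`, `λ / (cλ + d) = (1/c)(1 - d / (cλ + d))` increases for `λ > 0` and
    -- is below `1/c`; for `λ = -b` it is above `1/c`. So both other derivatives exceed that of the
    -- third eigenvalue.
    have i1 : 2 * s / (c * (s + h ^ 2) + h) < 2 * t / (c * (t + h ^ 2) + h) := by
      rw [div_lt_div_iff₀ d1 d2]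
      nlinarith
    have i2 : 2 * s / (c * (s + h ^ 2) + h) < 2 * b / (c * (b - h ^ 2) - h) := by
      rw [div_lt_div_iff₀ d1 hq]
      nlinarith [mul_pos hd hb0, mul_pos hd hS2]
    linarith
  have hcrit : (-1.62925 : ℝ) < -(1 / (Real.pi / 2)) := by
    rw [lt_neg, div_lt_iff₀ (by positivity)]
    linarith
  have hcont : ContinuousOn F (Icc (-1.62935) (-1.62925)) := fun h hh =>
    (dF h (hneg h (lt_of_le_of_lt hh.2 hcrit)).1).continuousAt.continuousWithinAt
  have hlo : F (-1.62935) ≤ 0 := by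
    have := gap_neg_at (hB (-1.62935) (by norm_num)) (hS (-1.62935) (by norm_num))
      (hT (-1.62935) (by norm_num))
    simp only [hF]; linarith
  have hlo' : F (-1.62935) ≠ 0 := by
    have := gap_neg_at (hB (-1.62935) (by norm_num)) (hS (-1.62935) (by norm_num))
      (hT (-1.62935) (by norm_num))
    simp only [hF]; linarith
  have hhi : 0 < F (-1.62925) := by
    have := gap_pos_at (hB (-1.62925) (by norm_num)) (hS (-1.62925) (by norm_num))
      (hT (-1.62925) (by norm_num))
    simp only [hF]; linarith
  obtain ⟨h₉, hmem, hz⟩ := intermediate_value_Icc (by norm_num) hcont ⟨hlo, hhi.le⟩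
  have hl' : -1.62935 < h₉ := lt_of_le_of_ne hmem.1 fun e => hlo' (e ▸ hz)
  have hr' : h₉ < -1.62925 := lt_of_le_of_ne hmem.2 fun e => hhi.ne' (e ▸ hz)
  have hreg : h₉ ∈ Iio (-(1 / (Real.pi / 2))) := hr'.trans hcrit
  refine ⟨h₉, by linarith, by rw [abs_lt]; constructor <;> norm_num <;> linarith, ?_, ?_⟩
  · intro h b s t h1 h2 hb hs ht
    -- Left of `-2/π` monotonicity of the gap applies; on the remaining range the gap is positive by
    -- the direct estimate.
    by_cases h3 : h < -(1 / (Real.pi / 2))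
    · have h0 := (hneg h h3).1
      have h4 := hmono.monotoneOn hreg h3 h1
      rw [hz] at h4
      simp only [hF] at h4
      rw [hb.unique (hB h h0), hs.unique (by norm_num) (hS h h0),
        ht.unique (by norm_num) (hT h h0)]
      linarith
    · push Not at h3
      rw [neg_le, le_div_iff₀ (by positivity)] at h3
      exact (gap_pos_of_ge h2 (by linarith) hb hs ht).le
  · intro h b s t h1 hb hs ht
    have h3 : h ∈ Iio (-(1 / (Real.pi / 2))) := h1.trans hreg
    have h0 := (hneg h h3).1
    have h4 := hmono h3 hreg h1
    rw [hz] at h4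
    simp only [hF] at h4
    rw [hb.unique (hB h h0), hs.unique (by norm_num) (hS h h0),
      ht.unique (by norm_num) (hT h h0)]
    linarith

/-! ### The four lowest Robin eigenvalues of the interval -/

/-- One of the two square roots is always 0, so this single formula covers both signs of `l` and
makes joint continuity evident. -/
theorem cosL_eq_mul (l x : ℝ) : cosL l x = Real.cos (√l * x) * Real.cosh (√(-l) * x) := by
  unfold cosL
  split_ifs with hl
  · rw [Real.sqrt_eq_zero_of_nonpos (by linarith : -l ≤ 0)]; simp
  · rw [Real.sqrt_eq_zero_of_nonpos (by linarith : l ≤ 0)]; simp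

theorem continuous_uncurry_cosL : Continuous (Function.uncurry cosL) := by
  have : Function.uncurry cosL =
      fun p : ℝ × ℝ => Real.cos (√p.1 * p.2) * Real.cosh (√(-p.1) * p.2) := by
    ext p; exact cosL_eq_mul p.1 p.2
  rw [this]
  fun_prop

/-- Gives continuity in `l` without treating the apparent singularity of `sin (√l x) / √l` at `l =
0`. -/
theorem sinL_eq_integral (l x : ℝ) : sinL l x = ∫ y in (0 : ℝ)..x, cosL l y := by
  rw [intervalIntegral.integral_eq_sub_of_hasDerivAt (fun y _ => hasDerivAt_sinL l y)
    ((contDiff_cosL l).continuous.intervalIntegrable _ _)]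
  simp

theorem continuous_oddChar (h : ℝ) : Continuous (oddChar h) := by
  have h1 : Continuous fun l => cosL l (Real.pi / 2) :=
    continuous_uncurry_cosL.comp (Continuous.prodMk_left _)
  have h2 : Continuous fun l => sinL l (Real.pi / 2) := by
    simp_rw [sinL_eq_integral]
    exact intervalIntegral.continuous_parametric_intervalIntegral_of_continuous' 
      continuous_uncurry_cosL _ _
  exact h1.add (continuous_const.mul h2)

theorem cosL_pos {l x : ℝ} (hl : l < 1) (h0 : 0 < x) (hx : x < Real.pi / 2) : 0 < cosL l x := by
  rcases sq_cases l with ⟨a, ha, rfl⟩ | rfl | ⟨b, hb, rfl⟩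
  · rw [cosL_sq ha.le]
    have : a < 1 := by nlinarith
    exact Real.cos_pos_of_mem_Ioo ⟨by nlinarith, by nlinarith⟩
  · rw [cosL_zero_left]; exact one_pos
  · rw [cosL_neg_sq hb.le]; exact Real.cosh_pos _

theorem sinL_pos {l x : ℝ} (hl : l < 4) (h0 : 0 < x) (hx : x < Real.pi / 2) : 0 < sinL l x := by
  rcases sq_cases l with ⟨a, ha, rfl⟩ | rfl | ⟨b, hb, rfl⟩
  · rw [sinL_sq ha]
    have : a < 2 := by nlinarith
    exact div_pos (Real.sin_pos_of_pos_of_lt_pi (by positivity) (by nlinarith)) ha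
  · rwa [sinL_zero_left]
  · rw [sinL_neg_sq hb]; exact div_pos (Real.sinh_pos_iff.2 (by positivity)) hb

/-- The Wronskian of two such solutions vanishes at 0 and at `π/2`. By Rolle its derivative `(l' -
l) cosL l cosL l'` has a zero in between, but below 1 both cosines are positive there. -/
theorem evenChar_unique {h l l' : ℝ} (hl : l < 1) (hl' : l' < 1) (hE : evenChar h l = 0)
    (hE' : evenChar h l' = 0) : l = l' := by
  by_contra hne
  have hpi := Real.pi_pos
  unfold evenChar at hE hE'
  have hd (x : ℝ) : HasDerivAt (fun x => l' * sinL l' x * cosL l x - l * sinL l x * cosL l' x)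
      ((l' - l) * (cosL l x * cosL l' x)) x := by
    refine ((((hasDerivAt_sinL l' x).const_mul l').mul (hasDerivAt_cosL l x)).sub
      (((hasDerivAt_sinL l x).const_mul l).mul (hasDerivAt_cosL l' x))).congr_deriv ?_
    ring
  obtain ⟨x, hx, e⟩ := exists_hasDerivAt_eq_zero (by positivity : (0 : ℝ) < Real.pi / 2)
    (fun x _ => (hd x).continuousAt.continuousWithinAt)
    (by
      simp only [sinL_zero_right]
      linear_combination cosL l (Real.pi / 2) * hE' - cosL l' (Real.pi / 2) * hE)
    fun x _ => hd x
  have := mul_pos (cosL_pos hl hx.1 hx.2) (cosL_pos hl' hx.1 hx.2)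
  rcases mul_eq_zero.1 e with e | e
  · exact hne (by linarith)
  · exact this.ne' e

theorem oddChar_unique {h l l' : ℝ} (hl : l < 4) (hl' : l' < 4) (hE : oddChar h l = 0)
    (hE' : oddChar h l' = 0) : l = l' := by
  by_contra hne
  have hpi := Real.pi_pos
  unfold oddChar at hE hE'
  have hd (x : ℝ) : HasDerivAt (fun x => sinL l' x * cosL l x - sinL l x * cosL l' x)
      ((l' - l) * (sinL l x * sinL l' x)) x := by
    refine (((hasDerivAt_sinL l' x).mul (hasDerivAt_cosL l x)).sub
      ((hasDerivAt_sinL l x).mul (hasDerivAt_cosL l' x))).congr_deriv ?_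
    ring
  obtain ⟨x, hx, e⟩ := exists_hasDerivAt_eq_zero (by positivity : (0 : ℝ) < Real.pi / 2)
    (fun x _ => (hd x).continuousAt.continuousWithinAt)
    (by
      simp only [sinL_zero_right]
      linear_combination sinL l (Real.pi / 2) * hE' - sinL l' (Real.pi / 2) * hE)
    fun x _ => hd x
  have := mul_pos (sinL_pos hl hx.1 hx.2) (sinL_pos hl' hx.1 hx.2)
  rcases mul_eq_zero.1 e with e | e
  · exact hne (by linarith)
  · exact this.ne' e

/-- If `l' ≤ l`, the mixed Wronskian would be nondecreasing on `[0, π/2]`, yet it is 1 at 0 and 0 at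
`π/2`. -/
theorem evenChar_lt_oddChar {h l l' : ℝ} (hl : l < 1) (hl' : l' < 4) (hE : evenChar h l = 0)
    (hO : oddChar h l' = 0) : l < l' := by
  by_contra! hle
  have hpi := Real.pi_pos
  unfold evenChar at hE
  unfold oddChar at hO
  have hd (x : ℝ) : HasDerivAt (fun x => l * sinL l x * sinL l' x + cosL l' x * cosL l x)
      ((l - l') * (cosL l x * sinL l' x)) x := by
    refine ((((hasDerivAt_sinL l x).const_mul l).mul (hasDerivAt_sinL l' x)).add
      ((hasDerivAt_cosL l' x).mul (hasDerivAt_cosL l x))).congr_deriv ?_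
    ring
  have hm : MonotoneOn (fun x => l * sinL l x * sinL l' x + cosL l' x * cosL l x)
      (Icc 0 (Real.pi / 2)) := by
    refine monotoneOn_of_deriv_nonneg (convex_Icc _ _)
      (fun y _ => (hd y).continuousAt.continuousWithinAt)
      (fun y _ => (hd y).differentiableAt.differentiableWithinAt) fun y hy => ?_
    rw [interior_Icc] at hy
    rw [(hd y).deriv]
    exact mul_nonneg (by linarith) (mul_pos (cosL_pos hl hy.1 hy.2) (sinL_pos hl' hy.1 hy.2)).le
  have h1 := hm ⟨le_rfl, by linarith⟩ ⟨by linarith, le_rfl⟩ (by linarith : (0 : ℝ) ≤ Real.pi / 2)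
  have h2 : l * sinL l (Real.pi / 2) * sinL l' (Real.pi / 2) +
      cosL l' (Real.pi / 2) * cosL l (Real.pi / 2) = 0 := by
    linear_combination (-sinL l' (Real.pi / 2)) * hE + cosL l (Real.pi / 2) * hO
  simp only [sinL_zero_right, cosL_zero_right, h2] at h1
  norm_num at h1

theorem exists_oddChar_eq_zero {h : ℝ} (hh : h ≤ 0) : ∃ l ≤ 1, oddChar h l = 0 := by
  have hpi := Real.pi_pos
  have hb : 0 < 1 - h := by linarith
  have h1 : oddChar h 1 ≤ 0 := by
    have e1 := cosL_sq zero_le_one (Real.pi / 2)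
    have e2 := sinL_sq one_pos (Real.pi / 2)
    norm_num at e1 e2
    rw [oddChar, e1, e2]
    linarith
  have h2 : 0 ≤ oddChar h (-(1 - h) ^ 2) := by
    rw [oddChar, cosL_neg_sq hb.le, sinL_neg_sq hb]
    have h3 := Real.sinh_lt_cosh ((1 - h) * (Real.pi / 2))
    have h4 : 0 ≤ Real.sinh ((1 - h) * (Real.pi / 2)) := Real.sinh_nonneg_iff.2 (by positivity)
    have h5 : Real.sinh ((1 - h) * (Real.pi / 2)) / (1 - h) * (-h) ≤
        Real.sinh ((1 - h) * (Real.pi / 2)) := by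
      rw [div_mul_eq_mul_div, div_le_iff₀ hb]
      nlinarith
    linarith
  obtain ⟨l, hl, e⟩ := intermediate_value_Icc' (by nlinarith [sq_nonneg (1 - h)])
    (continuous_oddChar h).continuousOn ⟨h1, h2⟩
  exact ⟨l, hl.2, e⟩

theorem HypRoot.evenChar_eq_zero {h b : ℝ} (hb : HypRoot h b) : evenChar h (-b ^ 2) = 0 := by
  rw [evenChar, cosL_neg_sq hb.1]
  rcases hb.1.eq_or_lt with h0 | h0
  · have := hb.2
    rw [← h0] at this ⊢
    simpa using this
  · rw [sinL_neg_sq h0, ← hb.2]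
    field_simp

theorem cos_one_add_mul (s : ℝ) :
    Real.cos ((1 + s) * (Real.pi / 2)) = -Real.sin (s * (Real.pi / 2)) := by
  rw [show (1 + s) * (Real.pi / 2) = s * (Real.pi / 2) + Real.pi / 2 by ring,
    Real.cos_add_pi_div_two]

theorem sin_one_add_mul (s : ℝ) :
    Real.sin ((1 + s) * (Real.pi / 2)) = Real.cos (s * (Real.pi / 2)) := by
  rw [show (1 + s) * (Real.pi / 2) = s * (Real.pi / 2) + Real.pi / 2 by ring,
    Real.sin_add_pi_div_two]

theorem cos_two_add_mul (s : ℝ) :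
    Real.cos ((2 + s) * (Real.pi / 2)) = -Real.cos (s * (Real.pi / 2)) := by
  rw [show (2 + s) * (Real.pi / 2) = s * (Real.pi / 2) + Real.pi by ring, Real.cos_add_pi]

theorem sin_two_add_mul (s : ℝ) :
    Real.sin ((2 + s) * (Real.pi / 2)) = -Real.sin (s * (Real.pi / 2)) := by
  rw [show (2 + s) * (Real.pi / 2) = s * (Real.pi / 2) + Real.pi by ring, Real.sin_add_pi]

theorem evenChar_one_add_sq {h s : ℝ} (hs : 0 ≤ s) : evenChar h ((1 + s) ^ 2) =
    -((1 + s) * Real.cos (s * (Real.pi / 2)) + h * Real.sin (s * (Real.pi / 2))) := by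
  have h1 : 0 < 1 + s := by linarith
  rw [evenChar, cosL_sq h1.le, sinL_sq h1, cos_one_add_mul, sin_one_add_mul]
  field_simp
  ring

theorem oddChar_two_add_sq {h t : ℝ} (ht : 0 ≤ t) : (2 + t) * oddChar h ((2 + t) ^ 2) =
    -((2 + t) * Real.cos (t * (Real.pi / 2)) + h * Real.sin (t * (Real.pi / 2))) := by
  have h1 : 0 < 2 + t := by linarith
  rw [oddChar, cosL_sq h1.le, sinL_sq h1, cos_two_add_mul, sin_two_add_mul]
  field_simp
  ring

theorem TrigRoot.evenChar_eq_zero {h s : ℝ} (hs : TrigRoot 1 h s) :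
    evenChar h ((1 + s) ^ 2) = 0 := by
  rw [evenChar_one_add_sq hs.1.le, hs.2.2, neg_zero]

theorem TrigRoot.oddChar_eq_zero {h t : ℝ} (ht : TrigRoot 2 h t) :
    oddChar h ((2 + t) ^ 2) = 0 := by
  have := oddChar_two_add_sq (h := h) ht.1.le
  rw [ht.2.2, neg_zero] at this
  exact (mul_eq_zero.1 this).resolve_left (by have := ht.1; linarith)

/-- With `l = (1 + r)²` and `0 ≤ r ≤ 2`: at `r = 0` the expression is 1, and for `1 < r ≤ 2` it is
negative since the cosine is negative and `h sin ≤ 0`. Only `0 < r ≤ 1` remains, where the root is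
unique. -/
theorem eq_of_evenChar_eq_zero {h s l : ℝ} (hh : h ≤ 0) (hs : TrigRoot 1 h s) (h1 : 1 ≤ l)
    (h9 : l ≤ 9) (hl : evenChar h l = 0) : l = (1 + s) ^ 2 := by
  have hpi := Real.pi_pos
  obtain ⟨r, hr0, rfl⟩ : ∃ r, 0 ≤ r ∧ l = (1 + r) ^ 2 := by
    refine ⟨√l - 1, ?_, ?_⟩
    · rw [sub_nonneg, Real.one_le_sqrt]; exact h1
    · rw [add_sub_cancel, Real.sq_sqrt (by linarith)]
  have hr2 : r ≤ 2 := by nlinarith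
  rw [evenChar_one_add_sq hr0, neg_eq_zero] at hl
  rcases hr0.eq_or_lt with h0 | h0
  · rw [← h0] at hl; simp at hl
  by_cases hr1 : r ≤ 1
  · rw [TrigRoot.unique (by norm_num) ⟨h0, hr1, hl⟩ hs]
  · push Not at hr1
    exfalso
    have hc : Real.cos (r * (Real.pi / 2)) < 0 :=
      Real.cos_neg_of_pi_div_two_lt_of_lt (by nlinarith) (by nlinarith)
    have hs : 0 ≤ Real.sin (r * (Real.pi / 2)) :=
      Real.sin_nonneg_of_nonneg_of_le_pi (by positivity) (by nlinarith)
    nlinarith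

theorem eq_of_oddChar_eq_zero {h t l : ℝ} (ht : TrigRoot 2 h t) (h1 : 4 ≤ l)
    (h9 : l ≤ 9) (hl : oddChar h l = 0) : l = (2 + t) ^ 2 := by
  obtain ⟨r, hr0, rfl⟩ : ∃ r, 0 ≤ r ∧ l = (2 + r) ^ 2 := by
    refine ⟨√l - 2, ?_, ?_⟩
    · rw [sub_nonneg, Real.le_sqrt' (by norm_num)]; linarith
    · rw [add_sub_cancel, Real.sq_sqrt (by linarith)]
  have hr2 : r ≤ 1 := by nlinarith
  have h2 := oddChar_two_add_sq (h := h) hr0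
  rw [hl, mul_zero, eq_comm, neg_eq_zero] at h2
  rcases hr0.eq_or_lt with h0 | h0
  · rw [← h0] at h2; simp at h2
  rw [TrigRoot.unique (by norm_num) ⟨h0, hr2, h2⟩ ht]

/-- If `l ≥ 0`, then `x cos x ≤ sin x` (or directly the equation at `l = 0`) forces `h π/2 ≥ -1`,
hence `b² < 1`, and `l ≤ 1`. If `l = -β²`, both `b² - h²` and `h² - β²` are below 1, from `cosh x ≥
x`, `sinh x ≥ x` and `(π/2)² > 2`. -/
theorem second_sub_first_lt {h b l : ℝ} (hh : h ≤ 0) (hb : HypRoot h b) (hl1 : l ≤ 1)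
    (hl : oddChar h l = 0) : l + b ^ 2 < 2 := by
  have hpi := Real.pi_gt_three
  have h1 := hb.sq_sub_le
  have hP : 2 < (Real.pi / 2) ^ 2 := by nlinarith
  have hneg (hge : -1 ≤ h * (Real.pi / 2)) : b ^ 2 < 1 := by
    have h3 : (h * (Real.pi / 2)) ^ 2 ≤ 1 := by
      have : h * (Real.pi / 2) ≤ 0 := mul_nonpos_of_nonpos_of_nonneg hh (by positivity)
      nlinarith
    by_contra! hcon
    nlinarith
  unfold oddChar at hl
  rcases sq_cases l with ⟨a, ha, rfl⟩ | rfl | ⟨β, hβ, rfl⟩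
  · have ha1 : a ≤ 1 := by nlinarith
    rw [cosL_sq ha.le, sinL_sq ha] at hl
    have hs : 0 < Real.sin (a * (Real.pi / 2)) := sin_mul_pi_half_pos ha ha1
    have hx : a * (Real.pi / 2) * Real.cos (a * (Real.pi / 2)) ≤ Real.sin (a * (Real.pi / 2)) := by
      rcases ha1.eq_or_lt with e | e
      · rw [e]; simp
      · have h5 := Real.lt_tan (by positivity : 0 < a * (Real.pi / 2)) (by nlinarith)
        have h6 : 0 < Real.cos (a * (Real.pi / 2)) :=
          Real.cos_pos_of_mem_Ioo ⟨by nlinarith, by nlinarith⟩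
        rw [Real.tan_eq_sin_div_cos, lt_div_iff₀ h6] at h5
        exact h5.le
    have hge : -1 ≤ h * (Real.pi / 2) := by
      have e : a * Real.cos (a * (Real.pi / 2)) = -(h * Real.sin (a * (Real.pi / 2))) := by
        field_simp at hl ⊢
        linarith
      by_contra! hcon
      nlinarith
    have := hneg hge
    linarith
  · rw [cosL_zero_left, sinL_zero_left] at hl
    have := hneg (by linarith)
    linarith
  · rw [cosL_neg_sq hβ.le, sinL_neg_sq hβ] at hl
    have hs : β * (Real.pi / 2) ≤ Real.sinh (β * (Real.pi / 2)) :=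
      Real.self_le_sinh_iff.2 (by positivity)
    have hc := Real.cosh_sq (β * (Real.pi / 2))
    have e : β * Real.cosh (β * (Real.pi / 2)) = -(h * Real.sinh (β * (Real.pi / 2))) := by
      have e1 : β * (Real.cosh (β * (Real.pi / 2)) + h * (Real.sinh (β * (Real.pi / 2)) / β)) =
          β * Real.cosh (β * (Real.pi / 2)) + h * Real.sinh (β * (Real.pi / 2)) := by
        field_simp
      rw [hl, mul_zero] at e1
      linarith
    have e2 : (h ^ 2 - β ^ 2) * Real.sinh (β * (Real.pi / 2)) ^ 2 = β ^ 2 := by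
      linear_combination β ^ 2 * hc - (β * Real.cosh (β * (Real.pi / 2)) -
        h * Real.sinh (β * (Real.pi / 2))) * e
    have h5 : (β * (Real.pi / 2)) ^ 2 ≤ Real.sinh (β * (Real.pi / 2)) ^ 2 :=
      pow_le_pow_left₀ (by positivity) hs 2
    have h6 : h ^ 2 - β ^ 2 < 1 := by
      by_contra! hcon
      have : β ^ 2 * 2 < (β * (Real.pi / 2)) ^ 2 := by
        rw [mul_pow]; exact mul_lt_mul_of_pos_left hP (by positivity)
      nlinarith
    have h7 : b ^ 2 - h ^ 2 < 1 := by
      by_contra! hcon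
      nlinarith
    linarith

theorem exists_low_spectrum {h b s t : ℝ} (hh : h ≤ 0) (hb : HypRoot h b) (hs : TrigRoot 1 h s)
    (ht : TrigRoot 2 h t) : ∃ l, oddChar h l = 0 ∧ -b ^ 2 < l ∧ l < (1 + s) ^ 2 ∧
      (1 + s) ^ 2 < (2 + t) ^ 2 ∧ l + (1 + s) ^ 2 < -b ^ 2 + (2 + t) ^ 2 ∧
      ∀ l', IsIntervalEigenvalue h l' → l' ≤ (2 + t) ^ 2 →
        l' = -b ^ 2 ∨ l' = l ∨ l' = (1 + s) ^ 2 ∨ l' = (2 + t) ^ 2 := by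
  obtain ⟨l, hl1, hl⟩ := exists_oddChar_eq_zero hh
  have hst := hs.one_le_two ht
  have hs0 := hs.1
  have hs1 := hs.2.1
  have ht1 := ht.2.1
  have h2 := second_sub_first_lt hh hb hl1 hl
  have hb0 : -b ^ 2 < 1 := by nlinarith [sq_nonneg b]
  -- From `s ≤ t`, `(2 + t)² - (1 + s)² ≥ 3 + 2s`, which beats the bound 2 on `l + b²`.
  refine ⟨l, hl, evenChar_lt_oddChar hb0 (by linarith) hb.evenChar_eq_zero hl, by nlinarith,
    by nlinarith, by nlinarith, fun l' hl' hle => ?_⟩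
  have hl9 : l' ≤ 9 := by nlinarith
  rcases isIntervalEigenvalue_iff.1 hl' with hE | hO
  · by_cases h1 : l' < 1
    · exact Or.inl (evenChar_unique h1 hb0 hE hb.evenChar_eq_zero)
    · exact Or.inr (Or.inr (Or.inl (eq_of_evenChar_eq_zero hh hs (not_lt.1 h1) hl9 hE)))
  · by_cases h4 : l' < 4
    · exact Or.inr (Or.inl (oddChar_unique h4 (by linarith) hO hl))
    · exact Or.inr (Or.inr (Or.inr (eq_of_oddChar_eq_zero ht (not_lt.1 h4) hl9 hO)))

/-! ### Ordering of the eigenvalues -/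

/-- `L 0 < L 1 < L 2 < L 3` are the four lowest Robin eigenvalues of `I`. -/
structure IsLowSpectrum (h : ℝ) (L : Fin 4 → ℝ) : Prop where
  strictMono : StrictMono L
  eigenvalue : ∀ i, IsIntervalEigenvalue h (L i)
  exhaust : ∀ l, IsIntervalEigenvalue h l → l ≤ L 3 → ∃ i, l = L i

namespace IsLowSpectrum

variable {h : ℝ} {L : Fin 4 → ℝ}

theorem cases_eigenvalue (hL : IsLowSpectrum h L)
    {l : ℝ} (hl : IsIntervalEigenvalue h l) : (∃ i, l = L i) ∨ L 3 < l := by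
  by_cases hle : l ≤ L 3
  · exact Or.inl (hL.exhaust l hl hle)
  · exact Or.inr (not_le.1 hle)

theorem le_eigenvalue (hL : IsLowSpectrum h L)
    {l : ℝ} (hl : IsIntervalEigenvalue h l) : L 0 ≤ l := by
  rcases hL.cases_eigenvalue hl with ⟨i, rfl⟩ | hl
  · exact hL.strictMono.monotone (Fin.zero_le i)
  · exact (hL.strictMono.monotone (Fin.zero_le 3)).trans hl.le

theorem eigenvalueAt (hL : IsLowSpectrum h L) (i : Fin 4) : IsIntervalEigenvalueAt h i (L i) := by
  refine ⟨hL.eigenvalue i, ?_⟩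
  have e : {ν | ν < L i ∧ IsIntervalEigenvalue h ν} = L '' (Finset.Iio i : Finset (Fin 4)) := by
    ext ν
    constructor
    · rintro ⟨h1, h2⟩
      obtain ⟨j, rfl⟩ := hL.exhaust ν h2 (h1.le.trans (hL.strictMono.monotone (Fin.le_last i)))
      exact ⟨j, by simpa using hL.strictMono.lt_iff_lt.1 h1, rfl⟩
    · rintro ⟨j, hj, rfl⟩
      exact ⟨hL.strictMono (by simpa using hj), hL.eigenvalue j⟩
  rw [e, hL.strictMono.injective.encard_image, encard_coe_eq_coe_finsetCard, Fin.card_Iio]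

theorem of_eigenvalueAt (hL : IsLowSpectrum h L)
    {p : ℕ} {μ : ℝ} (hμ : IsIntervalEigenvalueAt h p μ) :
    (∃ i : Fin 4, p = i ∧ μ = L i) ∨ (4 ≤ p ∧ L 3 < μ) := by
  rcases hL.cases_eigenvalue hμ.1 with ⟨i, rfl⟩ | hlt
  · have := hμ.2
    rw [(hL.eigenvalueAt i).2] at this
    exact Or.inl ⟨i, by exact_mod_cast this.symm, rfl⟩
  · refine Or.inr ⟨?_, hlt⟩
    have hsub : L '' (univ : Set (Fin 4)) ⊆ {ν | ν < μ ∧ IsIntervalEigenvalue h ν} := by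
      rintro _ ⟨j, -, rfl⟩
      exact ⟨(hL.strictMono.monotone (Fin.le_last j)).trans_lt hlt, hL.eigenvalue j⟩
    have := encard_le_encard hsub
    rw [hμ.2, hL.strictMono.injective.encard_image, encard_univ] at this
    simpa using this

/-- Eight ordered pairs have a sum at most `L 1 + L 2 < μ`. Any other pair dominates `(2, 2)`, `(0,
3)` or `(3, 0)`, so its sum is at least `μ`. The case `L 2 + L 2 = L 0 + L 3`, which occurs at the
critical parameter, is included. -/
theorem isKthEigenvalue_nine (hL : IsLowSpectrum h L)
    (hh : h ≤ 0) {μ : ℝ} (h1 : L 1 + L 2 < μ) (h2 : μ ≤ L 2 + L 2)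
    (h3 : μ ≤ L 0 + L 3) (h4 : μ = L 2 + L 2 ∨ μ = L 0 + L 3) : IsKthEigenvalue h 9 μ := by
  classical
  set S : Finset (Fin 4 × Fin 4) :=
    {(0, 0), (0, 1), (1, 0), (1, 1), (0, 2), (2, 0), (1, 2), (2, 1)} with hS
  have i1 : L 0 < L 1 := hL.strictMono (by decide)
  have i2 : L 1 < L 2 := hL.strictMono (by decide)
  have i3 : L 2 < L 3 := hL.strictMono (by decide)
  set e : Fin 4 × Fin 4 → ℝ × ℝ := fun p => (L p.1, L p.2) with he
  have heinj : Function.Injective e := fun p q hpq => by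
    simp only [he, Prod.mk.injEq] at hpq
    exact Prod.ext (hL.strictMono.injective hpq.1) (hL.strictMono.injective hpq.2)
  have hSle : ∀ p ∈ S, L p.1 + L p.2 ≤ L 1 + L 2 := by
    intro p hp
    simp only [hS, Finset.mem_insert, Finset.mem_singleton] at hp
    rcases hp with rfl | rfl | rfl | rfl | rfl | rfl | rfl | rfl <;> simp only <;> linarith
  constructor
  · refine lt_of_le_of_lt (rank_spanLT_le hh (A := S.image e) ?_ ?_) ?_
    · intro p hp
      obtain ⟨q, -, rfl⟩ := Finset.mem_image.1 hp
      exact ⟨hL.eigenvalue _, hL.eigenvalue _⟩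
    · rintro ⟨x, y⟩ hx hy hlt
      simp only at hx hy hlt
      have hx0 := hL.le_eigenvalue hx
      have hy0 := hL.le_eigenvalue hy
      rcases hL.cases_eigenvalue hx with ⟨i, rfl⟩ | hx
      · rcases hL.cases_eigenvalue hy with ⟨j, rfl⟩ | hy
        · refine Finset.mem_image.2 ⟨(i, j), ?_, rfl⟩
          clear hx hy
          fin_cases i <;> fin_cases j <;>
            first
            | (exfalso; simp only [Fin.mk_one, Fin.zero_eta, Fin.reduceFinMk, Fin.isValue] at *; linarith)
            | decide
        · linarith
      · linarith
    · rw [Finset.card_image_of_injective _ heinj]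
      exact_mod_cast (by decide : S.card < 9)
  · have key (q : Fin 4 × Fin 4) (hq : (insert q S).card = 9) (hq' : L q.1 + L q.2 ≤ μ) :
        ((9 : ℕ) : Cardinal) ≤ Module.rank ℝ (spanLE h μ) := by
      have := le_rank_spanLE (h := h) (μ := μ) (A := (insert q S).image e) (by
        intro p hp
        obtain ⟨r, hr, rfl⟩ := Finset.mem_image.1 hp
        refine ⟨hL.eigenvalue _, hL.eigenvalue _, ?_⟩
        rcases Finset.mem_insert.1 hr with rfl | hr
        · exact hq'
        · exact (hSle r hr).trans h1.le)
      rwa [Finset.card_image_of_injective _ heinj, hq] at this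
    -- A ninth pair with sum `μ`, whichever of the two candidates attains the minimum.
    rcases h4 with h4 | h4
    · exact key (2, 2) (by decide) h4.ge
    · exact key (0, 3) (by decide) h4.ge

theorem comesFromPair_iff (hL : IsLowSpectrum h L)
    {μ : ℝ} (h1 : L 1 + L 2 < μ) (h2 : μ < L 2 + L 2) (h3 : μ = L 0 + L 3)
    (p q : ℕ) : ComesFromPair h p q μ ↔ (p = 0 ∧ q = 3) ∨ (p = 3 ∧ q = 0) := by
  have i1 : L 0 < L 1 := hL.strictMono (by decide)
  have i2 : L 1 < L 2 := hL.strictMono (by decide)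
  have i3 : L 2 < L 3 := hL.strictMono (by decide)
  constructor
  · rintro ⟨x, y, hx, hy, e⟩
    have hx0 := hL.le_eigenvalue hx.1
    have hy0 := hL.le_eigenvalue hy.1
    rcases hL.of_eigenvalueAt hx with ⟨i, rfl, rfl⟩ | ⟨-, hx⟩
    · rcases hL.of_eigenvalueAt hy with ⟨j, rfl, rfl⟩ | ⟨-, hy⟩
      · clear hx hy
        fin_cases i <;> fin_cases j <;>
          first
          | (exfalso; simp only [Fin.mk_one, Fin.zero_eta, Fin.reduceFinMk, Fin.isValue] at *; linarith)
          | simp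
      · linarith
    · linarith
  · rintro (⟨rfl, rfl⟩ | ⟨rfl, rfl⟩)
    · exact ⟨_, _, hL.eigenvalueAt 0, hL.eigenvalueAt 3, h3⟩
    · exact ⟨_, _, hL.eigenvalueAt 3, hL.eigenvalueAt 0, h3.trans (add_comm _ _)⟩

/-- Eigenvectors for the simple pair `{0, 3}`. -/
theorem eigenvector_eq (hL : IsLowSpectrum h L)
    (hh : h ≤ 0) {μ : ℝ} (h1 : L 1 + L 2 < μ) (h2 : μ < L 2 + L 2)
    (h3 : μ = L 0 + L 3) {u : L2S} (hu : IsEigenvector h μ u) :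
    ∃ a b : ℝ, u = a • prodMode h (L 0) (L 3) + b • prodMode h (L 3) (L 0) := by
  classical
  have i1 : L 0 < L 1 := hL.strictMono (by decide)
  have i2 : L 1 < L 2 := hL.strictMono (by decide)
  have i3 : L 2 < L 3 := hL.strictMono (by decide)
  have := hu.mem_span_prodMode hh (A := {(L 0, L 3), (L 3, L 0)}) (by
    intro p hp
    simp only [Finset.mem_insert, Finset.mem_singleton] at hp
    rcases hp with rfl | rfl <;> exact ⟨hL.eigenvalue _, hL.eigenvalue _⟩) (by
    rintro ⟨x, y⟩ hx hy e
    simp only at hx hy e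
    have hx0 := hL.le_eigenvalue hx
    have hy0 := hL.le_eigenvalue hy
    rcases hL.cases_eigenvalue hx with ⟨i, rfl⟩ | hx
    · rcases hL.cases_eigenvalue hy with ⟨j, rfl⟩ | hy
      · clear hx hy
        fin_cases i <;> fin_cases j <;>
          first
          | (exfalso; simp only [Fin.mk_one, Fin.zero_eta, Fin.reduceFinMk, Fin.isValue] at *; linarith)
          | simp
      · linarith
    · linarith)
  rw [Finset.coe_insert, Finset.coe_singleton, image_pair, Submodule.mem_span_pair] at this
  obtain ⟨a, b, e⟩ := this
  exact ⟨a, b, e.symm⟩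

end IsLowSpectrum

theorem isLowSpectrum_of_roots {h b s t l : ℝ} (hb : HypRoot h b) (hs : TrigRoot 1 h s)
    (ht : TrigRoot 2 h t) (hl : oddChar h l = 0) (h1 : -b ^ 2 < l) (h2 : l < (1 + s) ^ 2)
    (h3 : (1 + s) ^ 2 < (2 + t) ^ 2)
    (h4 : ∀ l', IsIntervalEigenvalue h l' → l' ≤ (2 + t) ^ 2 →
        l' = -b ^ 2 ∨ l' = l ∨ l' = (1 + s) ^ 2 ∨ l' = (2 + t) ^ 2) :
    IsLowSpectrum h ![-b ^ 2, l, (1 + s) ^ 2, (2 + t) ^ 2] where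
  strictMono := by
    rw [Fin.strictMono_iff_lt_succ]
    intro i
    fin_cases i
    exacts [h1, h2, h3]
  eigenvalue i := by
    rw [isIntervalEigenvalue_iff]
    fin_cases i
    exacts [Or.inl hb.evenChar_eq_zero, Or.inr hl, Or.inl hs.evenChar_eq_zero,
      Or.inr ht.oddChar_eq_zero]
  exhaust l' hl' hle := by
    rcases h4 l' hl' hle with e | e | e | e
    exacts [⟨0, e⟩, ⟨1, e⟩, ⟨2, e⟩, ⟨3, e⟩]

/-! ### Counting connected components -/

/-- The connected components of a disjoint union of nonempty connected open sets. -/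
theorem connectedComponentIn_iUnion {X ι : Type*} [TopologicalSpace X] {U : ι → Set X}
    (ho : ∀ i, IsOpen (U i)) (hc : ∀ i, IsPreconnected (U i))
    (hd : Pairwise fun i j => Disjoint (U i) (U j)) {i : ι} {p : X} (hp : p ∈ U i) :
    connectedComponentIn (⋃ i, U i) p = U i := by
  refine Subset.antisymm ?_ ((hc i).subset_connectedComponentIn hp (subset_iUnion U i))
  have hpF : p ∈ ⋃ i, U i := mem_iUnion.2 ⟨i, hp⟩
  refine IsPreconnected.subset_left_of_subset_union (ho i)
    (isOpen_biUnion fun j (_ : j ∈ {j | j ≠ i}) => ho j) ?_ ?_ ⟨p, mem_connectedComponentIn hpF, hp⟩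
    isPreconnected_connectedComponentIn
  · exact disjoint_iUnion₂_right.2 fun j hj => hd (Ne.symm hj)
  · intro q hq
    obtain ⟨j, hj⟩ := mem_iUnion.1 (connectedComponentIn_subset _ _ hq)
    by_cases hji : j = i
    · exact Or.inl (hji ▸ hj)
    · exact Or.inr (mem_iUnion₂.2 ⟨j, hji, hj⟩)

theorem nodalDomains_encard_of_iUnion {ι : Type*} [Fintype ι] {f : ℝ × ℝ → ℝ}
    {U : ι → Set (ℝ × ℝ)} (hN : {q ∈ square | f q ≠ 0} = ⋃ i, U i) (ho : ∀ i, IsOpen (U i))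
    (hc : ∀ i, IsPreconnected (U i)) (hne : ∀ i, (U i).Nonempty)
    (hd : Pairwise fun i j => Disjoint (U i) (U j)) :
    (nodalDomains f).encard = Fintype.card ι := by
  have e : nodalDomains f = range U := by
    ext D
    constructor
    · rintro ⟨p, hp, rfl⟩
      rw [hN] at hp ⊢
      obtain ⟨i, hi⟩ := mem_iUnion.1 hp
      exact ⟨i, (connectedComponentIn_iUnion ho hc hd hi).symm⟩
    · rintro ⟨i, rfl⟩
      obtain ⟨p, hp⟩ := hne i
      refine ⟨p, ?_, ?_⟩
      · rw [hN]; exact mem_iUnion.2 ⟨i, hp⟩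
      · rw [hN, connectedComponentIn_iUnion ho hc hd hp]
  have hinj : Function.Injective U := fun i j hij => by
    by_contra hne'
    have := hd hne'
    simp only [hij, disjoint_self] at this
    exact (hne j).ne_empty this
  rw [e, ← image_univ, hinj.encard_image, encard_univ, ENat.card_eq_coe_fintype_card]

/-- The nodal intervals of `cos (a x)` on `I`, for `1 < a ≤ 2`. -/
def cosNodal (a : ℝ) : Fin 3 → Set ℝ :=
  ![Ioo (-(Real.pi / 2)) (-(Real.pi / 2 / a)), Ioo (-(Real.pi / 2 / a)) (Real.pi / 2 / a),
    Ioo (Real.pi / 2 / a) (Real.pi / 2)]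

/-- On `I` one has `|a x| < a π/2 ≤ π`, so only `a x = ±π/2` gives zeros; they are interior because
`a > 1`. -/
theorem cosNodal_eq {a : ℝ} (h1 : 1 < a) (h2 : a ≤ 2) :
    {x ∈ interval | Real.cos (a * x) ≠ 0} = ⋃ i, cosNodal a i := by
  have hpi := Real.pi_pos
  have ha : 0 < a := by linarith
  have hd : Real.pi / 2 / a < Real.pi / 2 := div_lt_self (by positivity) h1
  have hd0 : 0 < Real.pi / 2 / a := by positivity
  have hneg (y : ℝ) (hy1 : Real.pi / 2 / a < y) (hy2 : y < Real.pi / 2) :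
      Real.cos (a * y) ≠ 0 := by
    rw [div_lt_iff₀ ha] at hy1
    exact (Real.cos_neg_of_pi_div_two_lt_of_lt (by linarith) (by nlinarith)).ne
  have hz : a * (Real.pi / 2 / a) = Real.pi / 2 := by field_simp
  ext x
  have hU : x ∈ ⋃ i, cosNodal a i ↔ (-(Real.pi / 2) < x ∧ x < -(Real.pi / 2 / a)) ∨
      (-(Real.pi / 2 / a) < x ∧ x < Real.pi / 2 / a) ∨ (Real.pi / 2 / a < x ∧ x < Real.pi / 2) := by
    simp [cosNodal, mem_iUnion, Fin.exists_fin_succ]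
  rw [hU]
  constructor
  · rintro ⟨hx, hne⟩
    have hx := mem_interval.1 hx
    rcases lt_trichotomy x (-(Real.pi / 2 / a)) with h | h | h
    · exact Or.inl ⟨hx.1, h⟩
    · refine (hne ?_).elim
      rw [h, mul_neg, Real.cos_neg, hz, Real.cos_pi_div_two]
    · rcases lt_trichotomy x (Real.pi / 2 / a) with h' | h' | h'
      · exact Or.inr (Or.inl ⟨h, h'⟩)
      · refine (hne ?_).elim
        rw [h', hz, Real.cos_pi_div_two]
      · exact Or.inr (Or.inr ⟨h', hx.2⟩)
  · rintro (h | h | h)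
    · refine ⟨⟨h.1, by linarith⟩, ?_⟩
      rw [← Real.cos_neg, ← mul_neg]
      exact hneg _ (by linarith) (by linarith)
    · refine ⟨⟨by linarith, by linarith⟩, (Real.cos_pos_of_mem_Ioo ⟨?_, ?_⟩).ne'⟩
      · rw [← hz, ← mul_neg]; exact mul_lt_mul_of_pos_left h.1 ha
      · rw [← hz]; exact mul_lt_mul_of_pos_left h.2 ha
    · exact ⟨⟨by linarith, h.2⟩, hneg _ h.1 h.2⟩

/-- A function with the zero set of `cos (a x) * cos (a y)` has nine nodal domains. -/
theorem nodalDomains_encard_eq_nine {a : ℝ} (h1 : 1 < a) (h2 : a ≤ 2) {f : ℝ × ℝ → ℝ}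
    (hf : ∀ p ∈ square, f p ≠ 0 ↔ Real.cos (a * p.1) ≠ 0 ∧ Real.cos (a * p.2) ≠ 0) :
    (nodalDomains f).encard = 9 := by
  have hpi := Real.pi_pos
  have ha : 0 < a := by linarith
  have hd : Real.pi / 2 / a < Real.pi / 2 := div_lt_self (by positivity) h1
  have hd0 : 0 < Real.pi / 2 / a := by positivity
  have ho (i : Fin 3) : IsOpen (cosNodal a i) := by
    fin_cases i
    exacts [isOpen_Ioo, isOpen_Ioo, isOpen_Ioo]
  have hc (i : Fin 3) : IsPreconnected (cosNodal a i) := by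
    fin_cases i
    exacts [isPreconnected_Ioo, isPreconnected_Ioo, isPreconnected_Ioo]
  have hne (i : Fin 3) : (cosNodal a i).Nonempty := by
    fin_cases i
    exacts [nonempty_Ioo.2 (by linarith), nonempty_Ioo.2 (by linarith), nonempty_Ioo.2 hd]
  have hlt (i j : Fin 3) (hij : i < j) : Disjoint (cosNodal a i) (cosNodal a j) := by
    rw [Set.disjoint_left]
    intro x hxi hxj
    fin_cases i <;> fin_cases j <;> simp [cosNodal] at hij hxi hxj <;> linarith
  have hdj : Pairwise fun i j => Disjoint (cosNodal a i) (cosNodal a j) := fun i j hij => by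
    rcases lt_or_gt_of_ne hij with h | h
    exacts [hlt i j h, (hlt j i h).symm]
  have := nodalDomains_encard_of_iUnion (ι := Fin 3 × Fin 3) (f := f)
    (U := fun ij => cosNodal a ij.1 ×ˢ cosNodal a ij.2) ?_ (fun ij => (ho _).prod (ho _))
    (fun ij => (hc _).prod (hc _)) (fun ij => (hne _).prod (hne _)) ?_
  · rw [this]; simp
  · ext p
    have e1 := Set.ext_iff.1 (cosNodal_eq h1 h2)
    have e2 : p ∈ ⋃ ij : Fin 3 × Fin 3, cosNodal a ij.1 ×ˢ cosNodal a ij.2 ↔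
        p.1 ∈ ⋃ i, cosNodal a i ∧ p.2 ∈ ⋃ i, cosNodal a i := by
      simp only [mem_iUnion, mem_prod, Prod.exists, exists_and_left, exists_and_right]
    rw [e2, ← e1, ← e1]
    constructor
    · rintro ⟨hp, hfp⟩
      exact ⟨⟨hp.1, ((hf p hp).1 hfp).1⟩, ⟨hp.2, ((hf p hp).1 hfp).2⟩⟩
    · rintro ⟨⟨hp1, h3⟩, ⟨hp2, h4⟩⟩
      exact ⟨⟨hp1, hp2⟩, (hf p ⟨hp1, hp2⟩).2 ⟨h3, h4⟩⟩
  · intro p q hpq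
    rw [Set.disjoint_prod]
    by_cases h : p.1 = q.1
    · exact Or.inr (hdj fun h' => hpq (Prod.ext h h'))
    · exact Or.inl (hdj h)

/-! ### Finiteness of the number of nodal domains -/

/-- Superlevel sets of `φ x + ψ y` on a rectangle are connected for quasiconcave `φ` and `ψ`. -/
theorem isPreconnected_superlevel {φ ψ : ℝ → ℝ} {K K' : Set ℝ} (hK : K.OrdConnected)
    (hK' : K'.OrdConnected) (hφ : ∀ a ∈ K, ∀ b ∈ K, ∀ x ∈ uIcc a b, min (φ a) (φ b) ≤ φ x)
    (hψ : ∀ a ∈ K', ∀ b ∈ K', ∀ x ∈ uIcc a b, min (ψ a) (ψ b) ≤ ψ x) :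
    IsPreconnected {p : ℝ × ℝ | p ∈ K ×ˢ K' ∧ 0 < φ p.1 + ψ p.2} := by
  refine isPreconnected_of_forall_pair ?_
  rintro ⟨x₁, y₁⟩ ⟨⟨hx1, hy1⟩, h1⟩ ⟨x₂, y₂⟩ ⟨⟨hx2, hy2⟩, h2⟩
  simp only at hx1 hy1 h1 hx2 hy2 h2
  -- The two points are joined by three segments: horizontally to the abscissa with the larger `φ`,
  -- vertically there, then horizontally again. On the vertical segment `φ x` dominates both end
  -- values, so the quasiconcavity of `ψ` suffices.
  obtain ⟨x, hx, hxx1, hxx2⟩ : ∃ x ∈ K, φ x₁ ≤ φ x ∧ φ x₂ ≤ φ x := by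
    rcases le_total (φ x₁) (φ x₂) with h | h
    exacts [⟨x₂, hx2, h, le_rfl⟩, ⟨x₁, hx1, le_rfl, h⟩]
  refine ⟨uIcc x₁ x ×ˢ {y₁} ∪ ({x} ×ˢ uIcc y₁ y₂ ∪ uIcc x x₂ ×ˢ {y₂}), ?_, ?_, ?_, ?_⟩
  · rintro ⟨u, v⟩ (⟨hu, hv⟩ | ⟨hu, hv⟩ | ⟨hu, hv⟩) <;> simp only [mem_singleton_iff] at hu hv
    · subst hv
      have := hφ _ hx1 _ hx u hu
      rw [min_eq_left hxx1] at this
      exact ⟨⟨hK.uIcc_subset hx1 hx hu, hy1⟩, by simp only; linarith⟩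
    · subst hu
      have h3 := hψ _ hy1 _ hy2 v hv
      refine ⟨⟨hx, hK'.uIcc_subset hy1 hy2 hv⟩, ?_⟩
      simp only
      rcases min_le_iff.1 h3 with h | h <;> linarith
    · subst hv
      have := hφ _ hx _ hx2 u hu
      rw [min_eq_right hxx2] at this
      exact ⟨⟨hK.uIcc_subset hx hx2 hu, hy2⟩, by simp only; linarith⟩
  · exact Or.inl ⟨left_mem_uIcc, rfl⟩
  · exact Or.inr (Or.inr ⟨right_mem_uIcc, rfl⟩)
  · refine IsPreconnected.union (x, y₁) ⟨right_mem_uIcc, rfl⟩ (Or.inl ⟨rfl, left_mem_uIcc⟩)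
      (isPreconnected_uIcc.prod isPreconnected_singleton) ?_
    exact IsPreconnected.union (x, y₂) ⟨rfl, right_mem_uIcc⟩ ⟨left_mem_uIcc, rfl⟩
      (isPreconnected_singleton.prod isPreconnected_uIcc)
      (isPreconnected_uIcc.prod isPreconnected_singleton)

theorem min_le_of_monotoneOn_or_antitoneOn {φ : ℝ → ℝ} {K : Set ℝ} (hK : K.OrdConnected)
    (h : MonotoneOn φ K ∨ AntitoneOn φ K) :
    ∀ a ∈ K, ∀ b ∈ K, ∀ x ∈ uIcc a b, min (φ a) (φ b) ≤ φ x := by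
  intro a ha b hb x hx
  have hxK := hK.uIcc_subset ha hb hx
  rw [mem_uIcc] at hx
  rw [min_le_iff]
  rcases h with h | h <;> rcases hx with hx | hx
  · exact Or.inl (h ha hxK hx.1)
  · exact Or.inr (h hb hxK hx.1)
  · exact Or.inr (h hxK hb hx.2)
  · exact Or.inl (h hxK ha hx.2)

theorem monotoneOn_or_antitoneOn_const_mul {g : ℝ → ℝ} {K : Set ℝ}
    (h : MonotoneOn g K ∨ AntitoneOn g K) (c : ℝ) :
    MonotoneOn (fun x => c * g x) K ∨ AntitoneOn (fun x => c * g x) K := by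
  rcases le_total 0 c with hc | hc <;> rcases h with h | h
  · exact Or.inl fun x hx y hy hxy => mul_le_mul_of_nonneg_left (h hx hy hxy) hc
  · exact Or.inr fun x hx y hy hxy => mul_le_mul_of_nonneg_left (h hx hy hxy) hc
  · exact Or.inr fun x hx y hy hxy => mul_le_mul_of_nonpos_left (h hx hy hxy) hc
  · exact Or.inl fun x hx y hy hxy => mul_le_mul_of_nonpos_left (h hx hy hxy) hc

/-- If `g` is piecewise monotone then `b g(x) + a g(y)`, times a positive function, has finitely
many nodal domains. -/
theorem nodalDomains_finite {ι : Type*} [Finite ι] {K : ι → Set ℝ} {g : ℝ → ℝ} {a b : ℝ}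
    {f ρ : ℝ × ℝ → ℝ} (hK : ∀ i, (K i).OrdConnected) (hKI : ∀ i, K i ⊆ interval)
    (hcov : interval ⊆ ⋃ i, K i) (hg : ∀ i, MonotoneOn g (K i) ∨ AntitoneOn g (K i))
    (hρ : ∀ p, 0 < ρ p) (hf : ∀ p ∈ square, f p = ρ p * (b * g p.1 + a * g p.2)) :
    (nodalDomains f).Finite := by
  set N := {q ∈ square | f q ≠ 0} with hN
  -- The part of the rectangle `K i × K j` on which `f` has the sign encoded by `σ`.
  let Q (i j : ι) (σ : Bool) : Set (ℝ × ℝ) :=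
    {p | p ∈ K i ×ˢ K j ∧ 0 < (if σ then b else -b) * g p.1 + (if σ then a else -a) * g p.2}
  have hQ (i j : ι) (σ : Bool) : IsPreconnected (Q i j σ) :=
    isPreconnected_superlevel (φ := fun x => (if σ then b else -b) * g x)
      (ψ := fun y => (if σ then a else -a) * g y) (hK i) (hK j)
      (min_le_of_monotoneOn_or_antitoneOn (hK i) (monotoneOn_or_antitoneOn_const_mul (hg i) _))
      (min_le_of_monotoneOn_or_antitoneOn (hK j) (monotoneOn_or_antitoneOn_const_mul (hg j) _))
  have hQN (i j : ι) (σ : Bool) : Q i j σ ⊆ N := by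
    rintro p ⟨hp, hpos⟩
    have hps : p ∈ square := ⟨hKI i hp.1, hKI j hp.2⟩
    refine ⟨hps, ?_⟩
    rw [hf p hps]
    refine mul_ne_zero (hρ p).ne' ?_
    cases σ <;> simp at hpos <;> intro h0 <;> linarith
  have hsub : nodalDomains f ⊆ ⋃ k : ι × ι × Bool,
      {D | ∃ p ∈ Q k.1 k.2.1 k.2.2, D = connectedComponentIn N p} := by
    rintro D ⟨p, hp, rfl⟩
    obtain ⟨i, hi⟩ := mem_iUnion.1 (hcov hp.1.1)
    obtain ⟨j, hj⟩ := mem_iUnion.1 (hcov hp.1.2)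
    have hne := hp.2
    rw [hf p hp.1] at hne
    have hne := right_ne_zero_of_mul hne
    rcases lt_or_gt_of_ne hne with h | h
    · exact mem_iUnion.2 ⟨(i, j, false), p, ⟨⟨hi, hj⟩, by simp; linarith⟩, rfl⟩
    · exact mem_iUnion.2 ⟨(i, j, true), p, ⟨⟨hi, hj⟩, by simpa using h⟩, rfl⟩
  -- Each `Q` is preconnected and avoids the zeros of `f`, so it meets at most one nodal domain.
  refine (finite_iUnion fun k => Set.Subsingleton.finite ?_).subset hsub
  rintro D ⟨p, hp, rfl⟩ D' ⟨p', hp', rfl⟩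
  exact connectedComponentIn_eq
    ((hQ _ _ _).subset_connectedComponentIn hp (hQN _ _ _) hp')

/-! ### Parity -/

theorem pos_or_neg_on_nodalDomain {f : ℝ × ℝ → ℝ} (hf : ContinuousOn f square)
    {D : Set (ℝ × ℝ)} (hD : D ∈ nodalDomains f) {p q : ℝ × ℝ} (hp : p ∈ D) (hq : q ∈ D)
    (hpos : 0 < f p) (hneg : f q < 0) : False := by
  obtain ⟨r, -, rfl⟩ := hD
  have hsub := connectedComponentIn_subset {q ∈ square | f q ≠ 0} r
  obtain ⟨z, hz, hz0⟩ := isPreconnected_connectedComponentIn.intermediate_value hq hp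
    (hf.mono fun x hx => (hsub hx).1) ⟨hneg.le, hpos.le⟩
  exact (hsub hz).2 hz0

/-- The point reflection permutes the nodal domains and exchanges those where `f > 0` with those
where `f < 0`, so the two kinds are equally many. -/
theorem even_ncard_nodalDomains {f : ℝ × ℝ → ℝ} (hf : ContinuousOn f square)
    (hodd : ∀ p ∈ square, f (-p) = -f p) (hfin : (nodalDomains f).Finite) :
    Even (nodalDomains f).ncard := by
  have hsq (p : ℝ × ℝ) (hp : p ∈ square) : -p ∈ square := by
    obtain ⟨⟨h1, h2⟩, ⟨h3, h4⟩⟩ := hp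
    exact ⟨⟨by simp only [Prod.fst_neg]; linarith, by simp only [Prod.fst_neg]; linarith⟩,
      ⟨by simp only [Prod.snd_neg]; linarith, by simp only [Prod.snd_neg]; linarith⟩⟩
  set N := {q ∈ square | f q ≠ 0} with hN
  let ν := Homeomorph.neg (ℝ × ℝ)
  have hνN : ν '' N = N := by
    have hsub : ν '' N ⊆ N := by
      rintro _ ⟨p, hp, rfl⟩
      exact ⟨hsq p hp.1, by change f (-p) ≠ 0; rw [hodd p hp.1]; exact neg_ne_zero.2 hp.2⟩
    refine hsub.antisymm fun p hp => ⟨-p, hsub ⟨p, hp, rfl⟩, neg_neg p⟩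
  set P := {D ∈ nodalDomains f | ∃ p ∈ D, 0 < f p} with hP
  have hmem (p : ℝ × ℝ) (hp : p ∈ N) : p ∈ connectedComponentIn N p := mem_connectedComponentIn hp
  have himg (p : ℝ × ℝ) (hp : p ∈ N) :
      ν '' connectedComponentIn N p = connectedComponentIn N (-p) := by
    rw [ν.image_connectedComponentIn hp, hνN]; rfl
  have hνD {D : Set (ℝ × ℝ)} (hD : D ∈ nodalDomains f) : ν '' D ∈ nodalDomains f := by
    obtain ⟨p, hp, rfl⟩ := hD
    have hmp : -p ∈ N := by rw [← hνN]; exact mem_image_of_mem ν hp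
    exact ⟨-p, hmp, himg p hp⟩
  have hνν (D : Set (ℝ × ℝ)) : ν '' (ν '' D) = D := by
    rw [image_image]
    simp [ν]
  have hsubD {D : Set (ℝ × ℝ)} (hD : D ∈ nodalDomains f) : D ⊆ N := by
    obtain ⟨p, hp, rfl⟩ := hD
    exact connectedComponentIn_subset _ _
  have hsplit : nodalDomains f = P ∪ (image ν) '' P := by
    ext D
    constructor
    · intro hD
      obtain ⟨p, hp, e⟩ := id hD
      have hpD : p ∈ D := e ▸ hmem p hp
      rcases lt_or_gt_of_ne hp.2 with h | h
      · refine Or.inr ⟨ν '' D, ⟨hνD hD, -p, ⟨p, hpD, rfl⟩, ?_⟩, hνν D⟩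
        rw [hodd p hp.1]; linarith
      · exact Or.inl ⟨hD, p, hpD, h⟩
    · rintro (hD | ⟨D, hD, rfl⟩)
      exacts [hD.1, hνD hD.1]
  have hdisj : Disjoint P ((image ν) '' P) := by
    rw [Set.disjoint_left]
    rintro _ ⟨hD, p, hp, hpos⟩ ⟨D, ⟨hD', q, hq, hq'⟩, rfl⟩
    refine pos_or_neg_on_nodalDomain hf hD hp ⟨q, hq, rfl⟩ hpos ?_
    change f (-q) < 0
    rw [hodd q (hsubD hD' hq).1]
    linarith
  have hPfin : P.Finite := hfin.subset fun D hD => hD.1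
  rw [hsplit, ncard_union_eq hdisj hPfin (hPfin.image _),
    ncard_image_of_injective _ ν.injective.image_injective]
  exact ⟨_, rfl⟩

/-! ### Monotonicity of the quotient of two modes -/

/-- The quotient of the fourth and the first Robin mode of `I` is piecewise monotone. -/
theorem exists_monotone_pieces {h b a : ℝ} (hb : 0 ≤ b) (ha2 : 2 < a) (ha3 : a ≤ 3)
    (hE : evenChar h (-b ^ 2) = 0) (hO : oddChar h (a ^ 2) = 0) :
    ∃ K : Fin 3 → Set ℝ, (∀ i, (K i).OrdConnected) ∧ (∀ i, K i ⊆ interval) ∧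
      interval ⊆ ⋃ i, K i ∧ ∀ i, MonotoneOn (fun x => sinL (a ^ 2) x / cosL (-b ^ 2) x) (K i) ∨
        AntitoneOn (fun x => sinL (a ^ 2) x / cosL (-b ^ 2) x) (K i) := by
  have hpi := Real.pi_pos
  have ha : 0 < a := by linarith
  set l := -b ^ 2 with hl
  have hC (x : ℝ) : 0 < cosL l x := by rw [hl, cosL_neg_sq hb]; exact Real.cosh_pos _
  have hla : l - a ^ 2 < 0 := by rw [hl]; nlinarith [sq_nonneg b]
  -- Numerator of the derivative of the quotient. It vanishes at `π/2` by the Robin conditions, and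
  -- its derivative has the sign opposite to that of `sinL (a ^ 2)`.
  set W : ℝ → ℝ := fun x => cosL (a ^ 2) x * cosL l x + sinL (a ^ 2) x * (l * sinL l x) with hW
  have hdW (x : ℝ) : HasDerivAt W ((l - a ^ 2) * (sinL (a ^ 2) x * cosL l x)) x := by
    refine (((hasDerivAt_cosL (a ^ 2) x).mul (hasDerivAt_cosL l x)).add
      ((hasDerivAt_sinL (a ^ 2) x).mul ((hasDerivAt_sinL l x).const_mul l))).congr_deriv ?_
    ring
  have hcW : Continuous W := continuous_iff_continuousAt.2 fun x => (hdW x).continuousAt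
  have hWc : W (Real.pi / 2) = 0 := by
    unfold evenChar at hE
    unfold oddChar at hO
    simp only [hW]
    linear_combination cosL l (Real.pi / 2) * hO - sinL (a ^ 2) (Real.pi / 2) * hE
  have hW0 : W 0 = 1 := by simp [hW]
  have hWeven (x : ℝ) : W (-x) = W x := by simp [hW]
  -- The positive zero of `sin (a x)`, inside `I` because `a > 2`. On `[0, π/2]`, `W` falls from 1
  -- up to `z` and then rises to 0, so it changes sign once, at some `r < z`.
  set z := Real.pi / a with hz
  have hz0 : 0 < z := by positivity
  have hzc : z < Real.pi / 2 := div_lt_div_of_pos_left hpi (by norm_num) ha2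
  have haz : a * z = Real.pi := by rw [hz]; field_simp
  have hSpos (x : ℝ) (h1 : 0 < x) (h2 : x < z) : 0 < sinL (a ^ 2) x := by
    rw [sinL_sq ha]
    exact div_pos (Real.sin_pos_of_pos_of_lt_pi (by positivity)
      (by rw [← haz]; exact mul_lt_mul_of_pos_left h2 ha)) ha
  have hSneg (x : ℝ) (h1 : z < x) (h2 : x < Real.pi / 2) : sinL (a ^ 2) x < 0 := by
    rw [sinL_sq ha]
    refine div_neg_of_neg_of_pos ?_ ha
    have h3 : Real.pi < a * x := by rw [← haz]; exact mul_lt_mul_of_pos_left h1 ha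
    rw [← neg_pos, ← Real.sin_sub_pi]
    exact Real.sin_pos_of_pos_of_lt_pi (by linarith) (by nlinarith)
  have hanti : StrictAntiOn W (Icc 0 z) := by
    refine strictAntiOn_of_deriv_neg (convex_Icc _ _) hcW.continuousOn fun x hx => ?_
    rw [interior_Icc] at hx
    rw [(hdW x).deriv]
    exact mul_neg_of_neg_of_pos hla (mul_pos (hSpos x hx.1 hx.2) (hC x))
  have hmono : StrictMonoOn W (Icc z (Real.pi / 2)) := by
    refine strictMonoOn_of_deriv_pos (convex_Icc _ _) hcW.continuousOn fun x hx => ?_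
    rw [interior_Icc] at hx
    rw [(hdW x).deriv]
    exact mul_pos_of_neg_of_neg hla (mul_neg_of_neg_of_pos (hSneg x hx.1 hx.2) (hC x))
  have hWz : W z < 0 := by
    rw [← hWc]; exact hmono ⟨le_rfl, hzc.le⟩ ⟨hzc.le, le_rfl⟩ hzc
  obtain ⟨r, hr, hWr⟩ := intermediate_value_Icc' hz0.le hcW.continuousOn
    ⟨hWz.le, by rw [hW0]; exact zero_le_one⟩
  have hr0 : 0 ≤ r := hr.1
  have hWnonneg (x : ℝ) (h1 : 0 ≤ x) (h2 : x ≤ r) : 0 ≤ W x := by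
    rw [← hWr]; exact hanti.antitoneOn ⟨h1, h2.trans hr.2⟩ hr h2
  have hWnonpos (x : ℝ) (h1 : r ≤ x) (h2 : x ≤ Real.pi / 2) : W x ≤ 0 := by
    rcases le_total x z with h3 | h3
    · rw [← hWr]; exact hanti.antitoneOn hr ⟨hr0.trans h1, h3⟩ h1
    · rw [← hWc]; exact hmono.monotoneOn ⟨h3, h2⟩ ⟨hzc.le, le_rfl⟩ h2
  have hrc : r < Real.pi / 2 := hr.2.trans_lt hzc
  have hdg (x : ℝ) : HasDerivAt (fun x => sinL (a ^ 2) x / cosL l x) (W x / cosL l x ^ 2) x := by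
    refine ((hasDerivAt_sinL (a ^ 2) x).div (hasDerivAt_cosL l x) (hC x).ne').congr_deriv ?_
    simp only [hW]
    ring
  have hgm {s : Set ℝ} (hs : Convex ℝ s) (h0 : ∀ x ∈ s, 0 ≤ W x) :
      MonotoneOn (fun x => sinL (a ^ 2) x / cosL l x) s :=
    monotoneOn_of_deriv_nonneg hs (fun x _ => (hdg x).continuousAt.continuousWithinAt)
      (fun x _ => (hdg x).differentiableAt.differentiableWithinAt) fun x hx => by
        rw [(hdg x).deriv]; exact div_nonneg (h0 x (interior_subset hx)) (sq_nonneg _)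
  have hga {s : Set ℝ} (hs : Convex ℝ s) (h0 : ∀ x ∈ s, W x ≤ 0) :
      AntitoneOn (fun x => sinL (a ^ 2) x / cosL l x) s :=
    antitoneOn_of_deriv_nonpos hs (fun x _ => (hdg x).continuousAt.continuousWithinAt)
      (fun x _ => (hdg x).differentiableAt.differentiableWithinAt) fun x hx => by
        rw [(hdg x).deriv]
        exact div_nonpos_of_nonpos_of_nonneg (h0 x (interior_subset hx)) (sq_nonneg _)
  refine ⟨![Ioc (-(Real.pi / 2)) (-r), Icc (-r) r, Ico r (Real.pi / 2)], ?_, ?_, ?_, ?_⟩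
  · intro i
    fin_cases i
    exacts [ordConnected_Ioc, ordConnected_Icc, ordConnected_Ico]
  · intro i
    fin_cases i
    · exact fun x hx => ⟨hx.1, hx.2.trans_lt (by linarith)⟩
    · exact fun x hx => ⟨lt_of_lt_of_le (by linarith) hx.1, hx.2.trans_lt hrc⟩
    · exact fun x hx => ⟨lt_of_lt_of_le (by linarith) hx.1, hx.2⟩
  · intro x hx
    rcases le_total x (-r) with h1 | h1
    · exact mem_iUnion.2 ⟨0, hx.1, h1⟩
    · rcases le_total x r with h2 | h2
      exacts [mem_iUnion.2 ⟨1, h1, h2⟩, mem_iUnion.2 ⟨2, h2, hx.2⟩]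
  · intro i
    fin_cases i
    · refine Or.inr (hga (convex_Ioc _ _) fun x hx => ?_)
      rw [← hWeven]
      exact hWnonpos _ (by linarith [hx.2]) (by linarith [hx.1])
    · refine Or.inl (hgm (convex_Icc _ _) fun x hx => ?_)
      rcases le_total 0 x with h1 | h1
      · exact hWnonneg x h1 hx.2
      · rw [← hWeven]; exact hWnonneg _ (by linarith) (by linarith [hx.1])
    · exact Or.inr (hga (convex_Ico _ _) fun x hx => hWnonpos x hx.1 hx.2.le)

/-- Every eigenfunction for the pair `{0, 3}` is odd under `p ↦ -p` and has a finite, even number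
of nodal domains. -/
theorem odd_and_finite_and_even {h b a α β : ℝ} (hb : 0 ≤ b) (ha2 : 2 < a) (ha3 : a ≤ 3)
    (hE : evenChar h (-b ^ 2) = 0) (hO : oddChar h (a ^ 2) = 0) {f : ℝ × ℝ → ℝ}
    (hfc : ContinuousOn f square) (hf : ∀ p ∈ square, f p =
      α * (cosL (-b ^ 2) p.1 * sinL (a ^ 2) p.2) + β * (sinL (a ^ 2) p.1 * cosL (-b ^ 2) p.2)) :
    (∀ x y : ℝ, (x, y) ∈ square → f (-x, -y) = -f (x, y)) ∧
      (nodalDomains f).Finite ∧ Even (nodalDomains f).ncard := by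
  have hodd : ∀ x y : ℝ, (x, y) ∈ square → f (-x, -y) = -f (x, y) := by
    rintro x y ⟨⟨h1, h2⟩, ⟨h3, h4⟩⟩
    simp only at h1 h2 h3 h4
    rw [hf (x, y) ⟨⟨h1, h2⟩, ⟨h3, h4⟩⟩, hf (-x, -y) ⟨⟨by simp only; linarith,
      by simp only; linarith⟩, ⟨by simp only; linarith, by simp only; linarith⟩⟩]
    simp only [cosL_neg, sinL_neg]
    ring
  obtain ⟨K, hK1, hK2, hK3, hK4⟩ := exists_monotone_pieces hb ha2 ha3 hE hO
  have hC (x : ℝ) : 0 < cosL (-b ^ 2) x := by rw [cosL_neg_sq hb]; exact Real.cosh_pos _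
  have hfin : (nodalDomains f).Finite :=
    nodalDomains_finite (ρ := fun p => cosL (-b ^ 2) p.1 * cosL (-b ^ 2) p.2) (a := α) (b := β)
      hK1 hK2 hK3 hK4 (fun p => mul_pos (hC _) (hC _)) fun p hp => by
        have h1 := (hC p.1).ne'
        have h2 := (hC p.2).ne'
        rw [hf p hp]
        field_simp
        ring
  exact ⟨hodd, hfin, even_ncard_nodalDomains hfc (fun p hp => hodd p.1 p.2 hp) hfin⟩

/-! ### Continuous representatives and the final assembly -/

theorem eqOn_square_of_ae_eq {f g : ℝ × ℝ → ℝ} (hf : ContinuousOn f square) (hg : Continuous g)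
    (h : f =ᵐ[volume.restrict square] g) : ∀ p ∈ square, f p = g p :=
  fun _ hp => Measure.eqOn_open_of_ae_eq (μ := volume) h isOpen_square hf hg.continuousOn hp

/-- Products of interval eigenfunctions are eigenfunctions of the square. -/
theorem isEigenfunction_mul {h l l' : ℝ} {u v : ℝ → ℝ} (hu : IsIntervalEigenfunction h l u)
    (hv : IsIntervalEigenfunction h l' v) :
    IsEigenfunction h (l + l') fun p => u p.1 * v p.2 := by
  obtain ⟨α, hα, hu'⟩ := hu.eq_mode
  obtain ⟨β, hβ, hv'⟩ := hv.eq_mode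
  have cu := continuous_mode h l
  have cv := continuous_mode h l'
  have e : ∀ p ∈ square, u p.1 * v p.2 = α * β * (mode h l p.1 * mode h l' p.2) := by
    intro p hp
    rw [hu' _ (subset_closure hp.1), hv' _ (subset_closure hp.2)]
    ring
  refine ⟨ContinuousOn.congr (f := fun p : ℝ × ℝ => α * β * (mode h l p.1 * mode h l' p.2))
    (by fun_prop) e, (α * β) • prodMode h l l', ?_,
    (isEigenvector_prodMode ⟨u, hu⟩ ⟨v, hv⟩).smul (mul_ne_zero hα hβ)⟩
  filter_upwards [Lp.coeFn_smul (α * β) (prodMode h l l'), coeFn_prodMode h l l',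
    ae_restrict_mem measurableSet_square] with p h1 h2 h3
  rw [h1, Pi.smul_apply, h2, smul_eq_mul, e p h3]

end RobinSquare

end

open RobinSquare

theorem proposition5 :
    ∃ h₉ : ℝ, h₉ < 0 ∧ |h₉ - (-1.6293)| < 0.00005 ∧
      (∀ h : ℝ, h₉ ≤ h → h ≤ 0 →
        ∃ μ : ℝ, IsKthEigenvalue h 9 μ ∧ ComesFromPair h 2 2 μ ∧ IsCourantSharp h 9 ∧
          ∀ u v : ℝ → ℝ, IsIntervalEigenfunctionAt h 2 u → IsIntervalEigenfunctionAt h 2 v →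
            IsEigenfunction h μ (fun p => u p.1 * v p.2) ∧
              (nodalDomains (fun p => u p.1 * v p.2)).encard = 9) ∧
      (∀ h : ℝ, h < h₉ →
        ∃ μ : ℝ, IsKthEigenvalue h 9 μ ∧
          (∀ p q : ℕ, ComesFromPair h p q μ ↔ (p = 0 ∧ q = 3) ∨ (p = 3 ∧ q = 0)) ∧
          ¬ IsCourantSharp h 9 ∧
          ∀ f : ℝ × ℝ → ℝ, IsEigenfunction h μ f →
            (∀ x y : ℝ, (x, y) ∈ square → f (-x, -y) = -f (x, y)) ∧
              (nodalDomains f).Finite ∧ Even (nodalDomains f).ncard) := by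
  obtain ⟨h₉, hneg, hnum, hge, hlt⟩ := exists_critical_parameter
  refine ⟨h₉, hneg, hnum, fun h hh hh0 => ?_, fun h hh => ?_⟩
  · obtain ⟨b, hb⟩ := exists_hypRoot hh0
    obtain ⟨s, hs⟩ := exists_trigRoot (n := 1) le_rfl hh0
    obtain ⟨t, ht⟩ := exists_trigRoot (n := 2) (by norm_num) hh0
    obtain ⟨l, hl, h1, h2, h3, h4, h5⟩ := exists_low_spectrum hh0 hb hs ht
    have hL := isLowSpectrum_of_roots hb hs ht hl h1 h2 h3 h5
    have hgap := hge h b s t hh hh0 hb hs ht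
    have hkth : IsKthEigenvalue h 9 ((1 + s) ^ 2 + (1 + s) ^ 2) :=
      hL.isKthEigenvalue_nine hh0 (add_lt_add_left h2 _) le_rfl
        (by change _ ≤ -b ^ 2 + (2 + t) ^ 2; linarith) (Or.inl rfl)
    have h2at : IsIntervalEigenvalueAt h 2 ((1 + s) ^ 2) := hL.eigenvalueAt 2
    have hprod : ∀ u v : ℝ → ℝ, IsIntervalEigenfunctionAt h 2 u → IsIntervalEigenfunctionAt h 2 v →
        IsEigenfunction h ((1 + s) ^ 2 + (1 + s) ^ 2) (fun p => u p.1 * v p.2) ∧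
          (nodalDomains (fun p => u p.1 * v p.2)).encard = 9 := by
      have key (w : ℝ → ℝ) (hw : IsIntervalEigenfunctionAt h 2 w) :
          IsIntervalEigenfunction h ((1 + s) ^ 2) w := by
        obtain ⟨μ, hμ, hw⟩ := hw
        rcases hL.of_eigenvalueAt hμ with ⟨i, hi, rfl⟩ | ⟨hi, -⟩
        · obtain rfl : i = 2 := Fin.ext hi.symm
          exact hw
        · omega
      have hs0 := hs.1
      have hzero (w : ℝ → ℝ) (hw : IsIntervalEigenfunction h ((1 + s) ^ 2) w) (x : ℝ)
          (hx : x ∈ interval) : w x ≠ 0 ↔ Real.cos ((1 + s) * x) ≠ 0 := by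
        obtain ⟨α, hα, e⟩ := hw.eq_mode
        rw [e x (subset_closure hx), mode_of_even hs.evenChar_eq_zero, cosL_sq (by linarith)]
        simp [hα]
      intro u v hu hv
      have hu := key u hu
      have hv := key v hv
      refine ⟨isEigenfunction_mul hu hv, ?_⟩
      refine nodalDomains_encard_eq_nine (a := 1 + s) (by linarith) (by linarith [hs.2.1])
        fun p hp => ?_
      rw [mul_ne_zero_iff, hzero u hu _ hp.1, hzero v hv _ hp.2]
    refine ⟨_, hkth, ⟨_, _, h2at, h2at, rfl⟩, ⟨_, hkth, ?_⟩, hprod⟩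
    have hm : IsIntervalEigenfunctionAt h 2 (mode h ((1 + s) ^ 2)) := ⟨_, h2at, h2at.1.mode⟩
    exact ⟨_, hprod _ _ hm hm⟩
  · have hh0 : h ≤ 0 := (hh.trans hneg).le
    obtain ⟨b, hb⟩ := exists_hypRoot hh0
    obtain ⟨s, hs⟩ := exists_trigRoot (n := 1) le_rfl hh0
    obtain ⟨t, ht⟩ := exists_trigRoot (n := 2) (by norm_num) hh0
    obtain ⟨l, hl, h1, h2, h3, h4, h5⟩ := exists_low_spectrum hh0 hb hs ht
    have hL := isLowSpectrum_of_roots hb hs ht hl h1 h2 h3 h5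
    have hgap := hlt h b s t hh hb hs ht
    have hμ : -b ^ 2 + (2 + t) ^ 2 < (1 + s) ^ 2 + (1 + s) ^ 2 := by linarith
    have hkth : IsKthEigenvalue h 9 (-b ^ 2 + (2 + t) ^ 2) :=
      hL.isKthEigenvalue_nine hh0 h4 hμ.le le_rfl (Or.inr rfl)
    have hall : ∀ f : ℝ × ℝ → ℝ, IsEigenfunction h (-b ^ 2 + (2 + t) ^ 2) f →
        (∀ x y : ℝ, (x, y) ∈ square → f (-x, -y) = -f (x, y)) ∧
          (nodalDomains f).Finite ∧ Even (nodalDomains f).ncard := by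
      rintro f ⟨hfc, u, hu, hev⟩
      -- The strict gap excludes the pair `(2, 2)`, so the eigenspace is two-dimensional; by
      -- continuity the almost everywhere identity then holds everywhere on the square.
      obtain ⟨α, β, rfl⟩ := hL.eigenvector_eq hh0 h4 hμ rfl hev
      change _ =ᵐ[_] _ at hu
      have c1 := (contDiff_cosL (-b ^ 2)).continuous
      have c2 := (contDiff_sinL ((2 + t) ^ 2)).continuous
      have ht0 := ht.1
      refine odd_and_finite_and_even (h := h) (α := α) (β := β) hb.1 (by linarith : 2 < 2 + t)
        (by linarith [ht.2.1]) hb.evenChar_eq_zero ht.oddChar_eq_zero hfc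
        (eqOn_square_of_ae_eq hfc (by fun_prop) ?_)
      have m1 : mode h (-b ^ 2) = cosL (-b ^ 2) := mode_of_even hb.evenChar_eq_zero
      have m2 : mode h ((2 + t) ^ 2) = sinL ((2 + t) ^ 2) := mode_of_odd ht.oddChar_eq_zero
      filter_upwards [hu, Lp.coeFn_add (α • prodMode h (-b ^ 2) ((2 + t) ^ 2))
          (β • prodMode h ((2 + t) ^ 2) (-b ^ 2)),
        Lp.coeFn_smul α (prodMode h (-b ^ 2) ((2 + t) ^ 2)),
        Lp.coeFn_smul β (prodMode h ((2 + t) ^ 2) (-b ^ 2)),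
        coeFn_prodMode h (-b ^ 2) ((2 + t) ^ 2), coeFn_prodMode h ((2 + t) ^ 2) (-b ^ 2)]
        with p e1 e2 e3 e4 e5 e6
      rw [← e1, ← m1, ← m2]
      refine e2.trans ?_
      rw [Pi.add_apply, e3, e4, Pi.smul_apply, Pi.smul_apply, e5, e6, smul_eq_mul, smul_eq_mul]
    refine ⟨_, hkth, hL.comesFromPair_iff h4 hμ rfl, ?_, hall⟩
    -- The ninth eigenvalue is unique, so the parity statement applies to `f`, and 9 is odd.
    rintro ⟨ν, hν, f, hf, hcard⟩
    rw [hν.unique hkth] at hf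
    obtain ⟨-, -, heven⟩ := hall f hf
    rw [ncard, hcard] at heven
    exact absurd heven (by decide)
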